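/- **Setting.** There are $n\ge 2$ identical firms with zero marginal cost and one consumer with unit demand and outside option $0$. The match values of the products with the consumer are i.i.d., equal to $1$ with probability $\mu\in(0,1)$ and to $0$ otherwise. Firms simultaneously choose a price $p\ge 0$, a signal, i.e. a distribution $F$ on $[0,1]$ with mean $\mu$ (the law of the consumer's posterior expected match value), and whether or not to post the signal; firms may mix over these choices, and the mixing is resolved before search begins. The consumer sees all prices and all posted signals, holds conjectures about the signals that are not posted, and then searches sequentially: each visit to a firm costs $c\in(0,\mu)$ and reveals the posterior at that firm (drawn independently across firms); she may at any time stop and buy from any firm already visited (free recall) or take the outside option, and she cannot buy from a firm that she has not visited. If she buys from firm $i$ after $k$ visits, her expected payoff is $x_i-p_i-kc$, where $x_i$ is the posterior at firm $i$, firm $i$ earns $p_i$ and the other firms earn $0$; if she takes the outside option after $k$ visits, she gets $-kc$ and all firms earn $0$. A *symmetric equilibrium* is a symmetric weak perfect Bayesian equilibrium with "no signaling what you don't know": all firms use the same mixed strategy, which is a best response; the consumer's search strategy is optimal, given her beliefs, after every observation and every search history; her conjecture about a firm's hidden signal depends only on what she observes of that firm, and agrees with Bayes' rule on the equilibrium path.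 The *mandatory-posting game* is the same game in which every firm has to post its signal. Let $\bar U=\frac{\mu-c}{\mu}$. **Corollary (To Post or Not to Post).** Suppose that firms can choose whether to post their signals or not. Then a symmetric equilibrium exists, and the firms' strategy in a symmetric equilibrium is unique: almost surely, every firm posts full information (the signal with posterior $1$ with probability $\mu$ and posterior $0$ with probability $1-\mu$), and every firm draws its price from the distribution $$\Phi(p)=\frac1\mu-\frac{1-\mu}{\mu}\left(\frac{\bar U}{p}\right)^{\frac1{n-1}},\qquad p\in\left[(1-\mu)^{n-1}\bar U,\ \bar U\right].$$ The same strategy is the unique symmetric equilibrium strategy of the firms in the mandatory-posting game. -/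

import Mathlib

open MeasureTheory
open scoped NNReal ENNReal

noncomputable section

namespace PostingGame

/-- Bayes-plausible distributions over posterior match values: probability measures on `[0, 1]`
with mean `μ`, the prior probability that the match value is `1`. -/
abbrev Signal (μ : ℝ) : Type :=
  {F : Measure unitInterval // IsProbabilityMeasure F ∧ ∫ x, (x : ℝ) ∂F = μ}

/-- The fully revealing signal: posterior `1` with probability `μ` and `0` with probability
`1 - μ`. -/
def fullInformation (μ : ℝ) : Measure unitInterval :=
  ENNReal.ofReal (1 - μ) • Measure.dirac 0 + ENNReal.ofReal μ • Measure.dirac 1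

/-- A pure strategy of a firm: a price `p ≥ 0`, a signal, and whether the signal is posted.
`(p, Sum.inl F)` posts the signal `F`; `(p, Sum.inr F)` uses the signal `F` without posting it. -/
abbrev FirmAction (μ : ℝ) : Type := ℝ≥0 × (Signal μ ⊕ Signal μ)

/-- What the consumer sees of a firm before searching: its price, and its signal if posted. -/
abbrev Observation (μ : ℝ) : Type := ℝ≥0 × (Signal μ ⊕ Unit)

/-- The signal that a firm really uses, posted or not. -/
def FirmAction.signal {μ : ℝ} (a : FirmAction μ) : Signal μ := Sum.elim id id a.2

/-- The signal is not posted. -/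
def FirmAction.Hidden {μ : ℝ} (a : FirmAction μ) : Prop := a.2.isRight = true

/-- The observable part of a firm's action. -/
def FirmAction.observe {μ : ℝ} (a : FirmAction μ) : Observation μ :=
  (a.1, Sum.map id (fun _ => ()) a.2)

/-- The signal that the consumer attributes to a firm: the posted one if there is one, and
otherwise her conjecture `b p` given the price `p`. As it depends on that firm's observation only,
nothing done by one firm affects what is believed about another. -/
def believedSignal {μ : ℝ} (b : ℝ≥0 → Signal μ) (o : Observation μ) : Signal μ :=
  Sum.elim id (fun _ => b o.1) o.2

/-- A (behavioural) search strategy of the consumer. `prob o l x a` is the probability of choosing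
`a` when the observations before the search are `o`, the firms visited so far are those in `l`
(most recent first), and the posteriors realized at them are `x i`, `i ∈ l` (along a search `x` is
`0` at unvisited firms). The choice `none` is to stop and take the outside option;
`some i` is to stop and buy from firm `i` if `i` was visited before (free recall), and to visit
firm `i` otherwise. -/
structure SearchStrategy (n : ℕ) (μ : ℝ) where
  prob : (Fin n → Observation μ) → List (Fin n) → (Fin n → unitInterval) → Option (Fin n) → ℝ
  nonneg : ∀ o l x a, 0 ≤ prob o l x a
  sum_eq_one : ∀ o l x, ∑ a, prob o l x a = 1
  measurable : ∀ l a, Measurable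
    fun ox : (Fin n → Observation μ) × (Fin n → unitInterval) => prob ox.1 l ox.2 a

/-- Expected value, from the history `(l, x)` on, of a reward `r` that is collected when the search
ends, minus `cost` for each further visit, when the consumer searches according to `q` and the
posterior of each firm `i` is drawn from `F i`, independently across firms. The natural number is
the number of firms that have not been visited yet. -/
def searchValue {n : ℕ}
    (q : List (Fin n) → (Fin n → unitInterval) → Option (Fin n) → ℝ)
    (F : Fin n → Measure unitInterval) (cost : ℝ)
    (r : Option (Fin n) → (Fin n → unitInterval) → ℝ) :
    ℕ → List (Fin n) → (Fin n → unitInterval) → ℝ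
  | 0, l, x => ∑ a, q l x a * r a x
  | k + 1, l, x => ∑ a, q l x a *
      match a with
      | none => r none x
      | some i =>
          if i ∈ l then r (some i) x
          else (∫ y, searchValue q F cost r k (i :: l) (Function.update x i y) ∂(F i)) - cost

/-- The consumer's reward when the search ends: `x i - p i` if she buys from `i`, and `0` if she
takes the outside option. -/
def surplus {n : ℕ} (p : Fin n → ℝ≥0) (a : Option (Fin n)) (x : Fin n → unitInterval) : ℝ :=
  match a with
  | none => 0
  | some i => (x i : ℝ) - (p i : ℝ)

/-- The consumer's expected continuation payoff at the history `(l, x)`, given the observations `o`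
and her conjectures `b i` about the hidden signals of the firms `i`. -/
def consumerPayoff {n : ℕ} {μ : ℝ} (c : ℝ) (b : Fin n → ℝ≥0 → Signal μ)
    (τ : SearchStrategy n μ) (o : Fin n → Observation μ)
    (l : List (Fin n)) (x : Fin n → unitInterval) : ℝ :=
  searchValue (τ.prob o) (fun i => (believedSignal (b i) (o i) : Measure unitInterval)) c
    (surplus fun i => (o i).1) (n - l.length) l x

/-- Sequential rationality: after every observation and every search history, on or off the path,
no search strategy gives the consumer a higher expected continuation payoff under her beliefs. -/
def SequentiallyRational {n : ℕ} {μ : ℝ} (c : ℝ) (b : Fin n → ℝ≥0 → Signal μ)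
    (τ : SearchStrategy n μ) : Prop :=
  ∀ (o : Fin n → Observation μ) (l : List (Fin n)), l.Nodup → ∀ (x : Fin n → unitInterval)
    (τ' : SearchStrategy n μ), consumerPayoff c b τ' o l x ≤ consumerPayoff c b τ o l x

/-- The probability that the consumer buys from firm `i` when the firms take the actions `s`. Her
behaviour depends on what she observes, the posteriors are drawn from the signals really used. -/
def purchaseProb {n : ℕ} {μ : ℝ} (τ : SearchStrategy n μ) (s : Fin n → FirmAction μ)
    (i : Fin n) : ℝ :=
  searchValue (τ.prob fun j => (s j).observe)
    (fun j => ((s j).signal : Measure unitInterval)) 0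
    (fun a _ => if a = some i then 1 else 0) n [] (fun _ => 0)

/-- Expected profit of firm `i` when the firms independently play the mixed strategies `σ j`. -/
def expectedProfit {n : ℕ} {μ : ℝ} (τ : SearchStrategy n μ)
    (σ : Fin n → ProbabilityMeasure (FirmAction μ)) (i : Fin n) : ℝ≥0∞ :=
  ∫⁻ s, ENNReal.ofReal ((((s i).1 : ℝ≥0) : ℝ) * purchaseProb τ s i)
    ∂(Measure.pi fun j => (σ j : Measure (FirmAction μ)))

/-- The conjecture `b` about hidden signals is correct (obeys Bayes' rule) under the mixed
strategy `σ`: `b p` is a version of the conditional law of the posterior given that the signal is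
hidden and the price is `p`. Where `σ` puts no mass, `b` is unrestricted. -/
def BeliefConsistent {μ : ℝ} (σ : ProbabilityMeasure (FirmAction μ)) (b : ℝ≥0 → Signal μ) : Prop :=
  ∀ (A : Set ℝ≥0) (B : Set unitInterval), MeasurableSet A → MeasurableSet B →
    ∫⁻ a in {a : FirmAction μ | a.Hidden ∧ a.1 ∈ A},
        (a.signal : Measure unitInterval) B ∂(σ : Measure (FirmAction μ)) =
      ∫⁻ a in {a : FirmAction μ | a.Hidden ∧ a.1 ∈ A},
        (b a.1 : Measure unitInterval) B ∂(σ : Measure (FirmAction μ))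

/-- Symmetric weak perfect Bayesian equilibrium, with no signaling of what a firm does not know,
of the game with `n` firms and search cost `c` in which the firms may use the actions in `S`:
all firms play the mixed strategy `σ`, the consumer has the conjectures `b i` and searches
according to `τ`. -/
structure IsSymmetricEquilibrium {n : ℕ} {μ : ℝ} (c : ℝ) (S : Set (FirmAction μ))
    (σ : ProbabilityMeasure (FirmAction μ)) (b : Fin n → ℝ≥0 → Signal μ)
    (τ : SearchStrategy n μ) : Prop where
  feasible : ∀ᵐ a ∂(σ : Measure (FirmAction μ)), a ∈ S
  measurable_belief : ∀ i, Measurable (b i)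
  consistent : ∀ i, BeliefConsistent σ (b i)
  rational : SequentiallyRational c b τ
  optimal : ∀ (i : Fin n) (σ' : ProbabilityMeasure (FirmAction μ)),
    (∀ᵐ a ∂(σ' : Measure (FirmAction μ)), a ∈ S) →
      expectedProfit τ (Function.update (fun _ => σ) i σ') i ≤ expectedProfit τ (fun _ => σ) i

/-- All actions: each firm chooses whether to post its signal. -/
def optionalPosting (μ : ℝ) : Set (FirmAction μ) := Set.univ

/-- The actions that are available when signals have to be posted. -/
def mandatoryPosting (μ : ℝ) : Set (FirmAction μ) := {a | ¬ a.Hidden}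

/-- The upper bound `(μ - c) / μ` on prices. -/
def priceCap (μ c : ℝ) : ℝ := (μ - c) / μ

/-- The distribution function of the price on its support. -/
def priceCDF (n : ℕ) (μ c p : ℝ) : ℝ :=
  1 / μ - (1 - μ) / μ * (priceCap μ c / p) ^ (1 / ((n : ℝ) - 1))

/-- The firm posts full information almost surely, and its price is distributed according to
`priceCDF` on `[(1 - μ) ^ (n - 1) * priceCap, priceCap]`; as `priceCDF` is `0` and `1` at the
ends of this interval, this determines the law of the price. -/
def PostsFullInformation {μ : ℝ} (n : ℕ) (c : ℝ) (σ : ProbabilityMeasure (FirmAction μ)) : Prop :=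
  (∀ᵐ a ∂(σ : Measure (FirmAction μ)),
    ∃ F : Signal μ, a.2 = Sum.inl F ∧ (F : Measure unitInterval) = fullInformation μ) ∧
  ∀ p : ℝ≥0, (1 - μ) ^ (n - 1) * priceCap μ c ≤ (p : ℝ) → (p : ℝ) ≤ priceCap μ c →
    (σ : Measure (FirmAction μ)) {a | a.1 ≤ p} = ENNReal.ofReal (priceCDF n μ c p)

end PostingGame

end

noncomputable section

namespace PostingGame

/-! ### Reservation values -/

/-! The consumer faces Pandora's problem. A signal `F` has a reservation value `z`, the root of `E
(x - z)⁺ = c`. Optimal search always follows the largest index: realized surplus at a visited firm,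
`z - p` at an unvisited one (`choiceValue_le`). Hence she buys where the effective surplus `w - p`
is largest, provided it is nonnegative, with `w = min x z` and `z` computed from the signal she
believes in (`searchValue_reward_le`, `le_searchValue_reward`); only ties are left open. The firms
thus compete through the laws of `w` and `p`. If the belief is correct, `E w = μ - c = μ Ū` whatever
the signal (`integral_min_reservation`), and `z ≤ Ū` with equality for full information only.
Consistent conjectures give the same mean when signals are hidden (`lintegral_cappedPosterior`).

Uniqueness. Let `π` be the equilibrium profit of a firm, `K = π / μ`, and `G t` the probability that
all rivals have effective surplus at most `t`. Posting full information at price `p` offers `Ū - p`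
with probability `μ`, so optimality forces `G t ≤ K / (Ū - t)` on `[0, Ū)` (`winProb_le`). A firm
with cap `w` and price `0 < p ≤ w` then earns at most `p G (w - p) ≤ p K / (Ū - w + p) ≤ (K / Ū) w`,
whose mean is `K μ = π`. So all these inequalities are equalities almost surely. Every firm earns as
if it won all its ties, so ties have probability zero and effective surpluses have no atom at any `t
≥ 0`. Equality in the last bound means `w = p` or `w = Ū`; the former is the excluded atom at zero.
So almost every action is believed to have reservation value `Ū`, and `p G (Ū - p) = K`
(`ae_price_optimal`).

If such a signal were hidden, the firm could secretly lower the good posterior from `1` to some `v <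
1` with `v ≥ Ū`: the effective surplus stays the same, but it now occurs with probability `μ / v >
μ` (`ae_not_hidden`). So full information is posted, and the price distribution function `Φ`
satisfies `p (1 - μ Φ p) ^ (n - 1) ≤ K` for prices in `(0, Ū]`, with equality almost surely. This
determines `K` and `Φ` (`cdf_eq_priceCDF`).

Existence. For the candidate strategy the bound on `G` holds with `K = (1 - μ) ^ (n - 1) Ū`. Let
hidden signals be believed uninformative; then `w ≤ μ - c` for a firm that hides, so `E w ≤ μ - c`
for every deviation, and the same chain caps its profit at `K μ`, which the candidate earns. -/

/-- Expected gain from one draw from `F` over a fallback of value `t`. -/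
def gain (F : Measure unitInterval) (t : ℝ) : ℝ := ∫ x, max ((x : ℝ) - t) 0 ∂F

/-- Weitzman's reservation value of a draw from `F` at cost `c`. -/
def reservation (c : ℝ) (F : Measure unitInterval) : ℝ := sInf {t | gain F t ≤ c}

lemma integrable_of_continuous {X : Type*} [TopologicalSpace X] [CompactSpace X]
    [MeasurableSpace X] [OpensMeasurableSpace X] {F : Measure X} [IsFiniteMeasure F]
    {f : X → ℝ} (hf : Continuous f) : Integrable f F :=
  hf.integrable_of_hasCompactSupport (HasCompactSupport.of_compactSpace f)

lemma integrable_gain (F : Measure unitInterval) [IsFiniteMeasure F] (t : ℝ) :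
    Integrable (fun x : unitInterval => max ((x : ℝ) - t) 0) F :=
  integrable_of_continuous (by fun_prop)

lemma gain_antitone (F : Measure unitInterval) [IsFiniteMeasure F] : Antitone (gain F) := by
  intro s t hst
  refine integral_mono (integrable_gain F t) (integrable_gain F s) fun x => ?_
  exact max_le_max (by linarith) le_rfl

lemma gain_continuous (F : Measure unitInterval) [IsProbabilityMeasure F] :
    Continuous (gain F) := by
  have h : LipschitzWith 1 (gain F) := by
    refine LipschitzWith.of_le_add fun s t => ?_
    rw [gain, gain]
    calc ∫ x : unitInterval, max ((x : ℝ) - s) 0 ∂F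
        ≤ ∫ x : unitInterval, (max ((x : ℝ) - t) 0 + dist s t) ∂F := by
          refine integral_mono (integrable_gain F s)
            ((integrable_gain F t).add (integrable_const _)) fun x => ?_
          rw [Real.dist_eq]
          have h1 := neg_abs_le (s - t)
          have h2 := abs_nonneg (s - t)
          refine max_le ?_ (by positivity)
          linarith [le_max_left ((x : ℝ) - t) 0]
      _ = _ := by
          rw [integral_add (integrable_gain F t) (integrable_const _)]
          simp
  exact h.continuous

/-- Equal gains would make the two positive parts agree almost everywhere, which is impossible where
`x > s`; so the gain at `s` would vanish. Strictness makes the root at level `c > 0` unique. -/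
lemma gain_strict {F : Measure unitInterval} [IsProbabilityMeasure F] {s t : ℝ} (hst : s < t)
    (hs : 0 < gain F s) : gain F t < gain F s := by
  refine lt_of_le_of_ne (gain_antitone F hst.le) fun h => ?_
  have hae : (fun x : unitInterval => max ((x : ℝ) - s) 0)
      =ᵐ[F] fun x : unitInterval => max ((x : ℝ) - t) 0 := by
    refine ((integral_eq_iff_of_ae_le (integrable_gain F t) (integrable_gain F s) ?_).1 h).symm
    exact Filter.Eventually.of_forall fun x => max_le_max (by linarith) le_rfl
  have h0 : gain F s = 0 := by
    rw [gain]
    refine integral_eq_zero_of_ae ?_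
    filter_upwards [hae] with x hx
    rcases le_total ((x : ℝ) - s) 0 with h1 | h1
    · simp [h1]
    · rw [max_eq_left h1] at hx
      rcases le_total ((x : ℝ) - t) 0 with h2 | h2
      · rw [max_eq_right h2] at hx
        simp [hx]
      · rw [max_eq_left h2] at hx
        linarith
  exact hs.ne' h0

section

variable {μ c : ℝ}

instance (F : Signal μ) : IsProbabilityMeasure (F : Measure unitInterval) := F.2.1

lemma integrable_posterior (F : Measure unitInterval) [IsFiniteMeasure F] :
    Integrable (fun x : unitInterval => (x : ℝ)) F :=
  integrable_of_continuous (by fun_prop)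

lemma Signal.integral_eq (F : Signal μ) : ∫ x, (x : ℝ) ∂(F : Measure unitInterval) = μ := F.2.2

lemma mean_sub_le_gain (F : Signal μ) (t : ℝ) : μ - t ≤ gain F t := by
  have h : ∫ x : unitInterval, ((x : ℝ) - t) ∂(F : Measure unitInterval) = μ - t := by
    rw [integral_sub (integrable_posterior _) (integrable_const _), F.integral_eq]
    simp
  rw [← h]
  exact integral_mono ((integrable_posterior _).sub (integrable_const _)) (integrable_gain _ _)
    fun x => le_max_left _ _

/-- The convex function `x ↦ (x - t)⁺` lies below its chord on `[0, 1]`. For `0 < t < 1` they meet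
only at the end points, which singles out full information. -/
lemma posterior_gain_le {t : ℝ} (ht0 : 0 ≤ t) (ht1 : t ≤ 1) (x : unitInterval) :
    max ((x : ℝ) - t) 0 ≤ x * (1 - t) := by
  have h0 := x.2.1
  have h1 := x.2.2
  refine max_le ?_ (mul_nonneg h0 (by linarith))
  nlinarith

lemma gain_le_mean_mul (F : Signal μ) {t : ℝ} (ht0 : 0 ≤ t) (ht1 : t ≤ 1) :
    gain F t ≤ μ * (1 - t) := by
  have h : ∫ x : unitInterval, ((x : ℝ) * (1 - t)) ∂(F : Measure unitInterval) = μ * (1 - t) := by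
    rw [integral_mul_const, F.integral_eq]
  rw [← h]
  exact integral_mono (integrable_gain _ _) ((integrable_posterior _).mul_const _)
    (posterior_gain_le ht0 ht1)

/-- Standing assumptions on the prior and the search cost. -/
structure Params (μ c : ℝ) : Prop where
  mean_pos : 0 < μ
  mean_lt_one : μ < 1
  cost_pos : 0 < c
  cost_lt : c < μ

namespace Params

variable (h : Params μ c)
include h

lemma priceCap_lt_one : priceCap μ c < 1 := by
  rw [priceCap, div_lt_one h.mean_pos]
  linarith [h.cost_pos]

lemma lt_priceCap : μ - c < priceCap μ c := by
  rw [priceCap, lt_div_iff₀ h.mean_pos]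
  nlinarith [h.cost_lt, h.mean_lt_one]

lemma sub_pos : 0 < μ - c := by linarith [h.cost_lt]

lemma priceCap_pos : 0 < priceCap μ c := h.sub_pos.trans h.lt_priceCap

lemma mean_mul_priceCap : μ * priceCap μ c = μ - c := by
  rw [priceCap, mul_div_cancel₀ _ h.mean_pos.ne']

lemma gain_priceCap_le (F : Signal μ) : gain F (priceCap μ c) ≤ c := by
  refine (gain_le_mean_mul F h.priceCap_pos.le h.priceCap_lt_one.le).trans_eq ?_
  rw [mul_sub, h.mean_mul_priceCap]
  ring

/-- Intermediate value theorem: the gain is at least `μ - t`, hence at least `c` at `t = μ - c`, and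
the chord bound makes it at most `c` at `priceCap`. -/
lemma exists_gain_eq (F : Signal μ) :
    ∃ z ∈ Set.Icc (μ - c) (priceCap μ c), gain F z = c := by
  have := intermediate_value_Icc' h.lt_priceCap.le (gain_continuous F).continuousOn
  refine this ⟨h.gain_priceCap_le F, ?_⟩
  simpa using mean_sub_le_gain F (μ - c)

lemma gain_le_iff_of_gain_eq {F : Signal μ} {z : ℝ} (hz : gain F z = c) (t : ℝ) :
    gain F t ≤ c ↔ z ≤ t := by
  refine ⟨fun ht => ?_, fun ht => hz ▸ gain_antitone _ ht⟩
  by_contra! hlt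
  have h1 := gain_antitone (F : Measure unitInterval) hlt.le
  have h2 := gain_strict (F := F) hlt (h.cost_pos.trans_le (hz ▸ h1))
  linarith

lemma reservation_eq_of_gain_eq {F : Signal μ} {z : ℝ} (hz : gain F z = c) :
    reservation c F = z := by
  have : {t | gain F t ≤ c} = Set.Ici z := Set.ext fun t => h.gain_le_iff_of_gain_eq hz t
  rw [reservation, this, csInf_Ici]

lemma gain_reservation (F : Signal μ) : gain F (reservation c F) = c := by
  obtain ⟨z, -, hz⟩ := h.exists_gain_eq F
  rw [h.reservation_eq_of_gain_eq hz, hz]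

lemma reservation_mem (F : Signal μ) :
    reservation c F ∈ Set.Icc (μ - c) (priceCap μ c) := by
  obtain ⟨z, hm, hz⟩ := h.exists_gain_eq F
  rwa [h.reservation_eq_of_gain_eq hz]

lemma reservation_pos (F : Signal μ) : 0 < reservation c F :=
  h.sub_pos.trans_le (h.reservation_mem F).1

lemma gain_le_iff (F : Signal μ) (t : ℝ) : gain F t ≤ c ↔ reservation c F ≤ t :=
  h.gain_le_iff_of_gain_eq (h.gain_reservation F) t

lemma measurable_reservation : Measurable fun F : Signal μ => reservation c F := by
  refine measurable_of_Iic fun t => ?_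
  have : (fun F : Signal μ => reservation c F) ⁻¹' Set.Iic t
      = {F : Signal μ | gain F t ≤ c} := by
    ext F
    simp [h.gain_le_iff]
  rw [this]
  refine measurableSet_le ?_ measurable_const
  have h2 : (fun F : Signal μ => gain F t) = fun F : Signal μ =>
      (∫⁻ x : unitInterval, ENNReal.ofReal (max ((x : ℝ) - t) 0)
        ∂(F : Measure unitInterval)).toReal := by
    ext F
    rw [gain, integral_eq_lintegral_of_nonneg_ae]
    · exact Filter.Eventually.of_forall fun x => le_max_right _ _
    · exact (by fun_prop : Continuous fun x : unitInterval => max ((x : ℝ) - t) 0)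
        |>.aestronglyMeasurable
  rw [h2]
  refine Measurable.ennreal_toReal ?_
  exact (Measure.measurable_lintegral (by fun_prop)).comp measurable_subtype_coe

/-- Since `min x z = x - (x - z)⁺`, capping at the reservation value removes exactly `c` from the
mean. Every signal therefore yields the same mean; this conservation law drives all the profit
bounds. -/
lemma integral_min_reservation (F : Signal μ) :
    ∫ x : unitInterval, min (x : ℝ) (reservation c F) ∂(F : Measure unitInterval) = μ - c := by
  have h1 : (fun x : unitInterval => min (x : ℝ) (reservation c F))
      = fun x : unitInterval => (x : ℝ) - max ((x : ℝ) - reservation c F) 0 := by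
    ext x
    rcases le_total (x : ℝ) (reservation c F) with hx | hx
    · rw [min_eq_left hx, max_eq_right (by linarith)]; ring
    · rw [min_eq_right hx, max_eq_left (by linarith)]; ring
  rw [h1, integral_sub (integrable_posterior _) (integrable_gain _ _), F.integral_eq]
  congr 1
  exact h.gain_reservation F

end Params

/-! ### Extremal signals -/

lemma measure_eq_fullInformation {F : Signal μ}
    (hF : ∀ᵐ x : unitInterval ∂(F : Measure unitInterval), x = 0 ∨ x = 1) :
    (F : Measure unitInterval) = fullInformation μ := by
  set G : Measure unitInterval := F.1 with hG
  have h1 : G.real {1} = μ := by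
    have h2 : (fun x : unitInterval => (x : ℝ)) =ᵐ[G]
        fun x => Set.indicator {(1 : unitInterval)} (fun _ => (1 : ℝ)) x := by
      filter_upwards [hF] with x hx
      rcases hx with rfl | rfl <;> simp
    have h3 := F.integral_eq
    rw [← hG, integral_congr_ae h2, integral_indicator (measurableSet_singleton _)] at h3
    simpa [measureReal_def] using h3
  have hc : G ({0}ᶜ ∩ {1}ᶜ) = 0 := by
    rw [ae_iff] at hF
    convert hF using 2
    ext x; simp
  have h0 : G.real {0} = 1 - μ := by
    have h2 : G.real ({0} ∪ {1}) = 1 := by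
      have : G.real ({0} ∪ {1})ᶜ = 0 := by
        rw [Set.compl_union, measureReal_def, hc]; simp
      rw [probReal_compl_eq_one_sub (by measurability)] at this
      linarith
    rw [measureReal_union (by simp) (measurableSet_singleton _), h1] at h2
    linarith
  ext s hs
  have hs1 : G s = G (s ∩ {0}) + G (s ∩ {1}) := by
    rw [← measure_union (by
      rw [Set.disjoint_left]; rintro x ⟨-, hx⟩ ⟨-, hx'⟩
      simp only [Set.mem_singleton_iff] at hx hx'
      exact zero_ne_one (hx.symm.trans hx')) (hs.inter (measurableSet_singleton _))]
    refine measure_congr ?_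
    filter_upwards [hF] with x hx
    refine propext ⟨fun h => ?_, fun h => ?_⟩
    · rcases hx with rfl | rfl
      · exact Or.inl ⟨h, rfl⟩
      · exact Or.inr ⟨h, rfl⟩
    · rcases h with h | h <;> exact h.1
  have key : ∀ a : unitInterval, G (s ∩ {a}) = G {a} * Measure.dirac a s := by
    intro a
    rw [Measure.dirac_apply' _ hs]
    by_cases ha : a ∈ s
    · simp [ha]
    · simp [ha]
  rw [hs1, key, key, fullInformation]
  simp only [Measure.add_apply, Measure.smul_apply, smul_eq_mul]
  rw [← h0, ← h1, ofReal_measureReal, ofReal_measureReal]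

/-- Equality in the integrated chord bound forces equality almost everywhere, hence posteriors in
`{0, 1}`; the mean then fixes the two masses. -/
lemma Params.eq_fullInformation_of_reservation (h : Params μ c) {F : Signal μ}
    (hF : reservation c F = priceCap μ c) : (F : Measure unitInterval) = fullInformation μ := by
  have hg := h.gain_reservation F
  rw [hF] at hg
  have hI : ∫ x : unitInterval, ((x : ℝ) * (1 - priceCap μ c)) ∂(F : Measure unitInterval) = c := by
    rw [integral_mul_const, F.integral_eq, mul_sub, h.mean_mul_priceCap]; ring
  have hae := (integral_eq_iff_of_ae_le (integrable_gain (F : Measure unitInterval) _)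
    ((integrable_posterior _).mul_const (1 - priceCap μ c))
    (Filter.Eventually.of_forall
      (posterior_gain_le h.priceCap_pos.le h.priceCap_lt_one.le))).1 (hg.trans hI.symm)
  refine measure_eq_fullInformation ?_
  filter_upwards [hae] with x hx
  have hU := h.priceCap_lt_one
  have hU0 := h.priceCap_pos
  rcases le_total ((x : ℝ) - priceCap μ c) 0 with h1 | h1
  · rw [max_eq_right h1] at hx
    left
    have : (x : ℝ) = 0 := by
      rcases mul_eq_zero.1 hx.symm with h2 | h2
      · exact h2
      · linarith
    exact Subtype.ext this
  · rw [max_eq_left h1] at hx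
    right
    have : (x : ℝ) = 1 := by
      have : priceCap μ c * (x - 1) = 0 := by linarith
      rcases mul_eq_zero.1 this with h2 | h2 <;> linarith
    exact Subtype.ext this

/-- The signal with posterior `v` with probability `μ / v`, and posterior `0` otherwise. -/
def twoPoint (μ : ℝ) (v : unitInterval) : Measure unitInterval :=
  ENNReal.ofReal (1 - μ / v) • Measure.dirac 0 + ENNReal.ofReal (μ / v) • Measure.dirac v

lemma twoPoint_mem (h0 : 0 < μ) {v : unitInterval} (hv : μ ≤ v) :
    IsProbabilityMeasure (twoPoint μ v) ∧ ∫ x, (x : ℝ) ∂(twoPoint μ v) = μ := by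
  have hv0 : (0 : ℝ) < v := h0.trans_le hv
  have h1 : μ / v ≤ 1 := (div_le_one hv0).2 hv
  have h2 : 0 ≤ μ / v := by positivity
  constructor
  · constructor
    rw [twoPoint]
    simp only [Measure.add_apply, Measure.smul_apply, smul_eq_mul, measure_univ, mul_one]
    rw [← ENNReal.ofReal_add (by linarith) h2]
    simp
  · rw [twoPoint, integral_add_measure, integral_smul_measure, integral_smul_measure]
    · simp [ENNReal.toReal_ofReal h2, hv0.ne']
    · exact (integrable_posterior _).smul_measure ENNReal.ofReal_ne_top
    · exact (integrable_posterior _).smul_measure ENNReal.ofReal_ne_top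

/-- `twoPoint μ v` as a signal. -/
def twoPointSignal (h0 : 0 < μ) (v : unitInterval) (hv : μ ≤ v) : Signal μ :=
  ⟨twoPoint μ v, twoPoint_mem h0 hv⟩

lemma twoPointSignal_apply_ge (h0 : 0 < μ) (v : unitInterval) (hv : μ ≤ v)
    {s : Set unitInterval} (hs : v ∈ s) :
    ENNReal.ofReal (μ / v) ≤ (twoPointSignal h0 v hv : Measure unitInterval) s := by
  change _ ≤ (twoPoint μ v) s
  rw [twoPoint]
  simp only [Measure.add_apply, Measure.smul_apply, smul_eq_mul]
  refine le_add_left ?_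
  simp [Measure.dirac_apply_of_mem hs]

lemma twoPoint_one : twoPoint μ 1 = fullInformation μ := by
  simp [twoPoint, fullInformation]

/-- Full information as a signal. -/
def fullSignal (h0 : 0 < μ) (h1 : μ ≤ 1) : Signal μ := twoPointSignal h0 1 (by simpa using h1)

lemma fullSignal_coe (h0 : 0 < μ) (h1 : μ ≤ 1) :
    (fullSignal h0 h1 : Measure unitInterval) = fullInformation μ := twoPoint_one

lemma Params.reservation_fullSignal (h : Params μ c) :
    reservation c (fullSignal h.mean_pos h.mean_lt_one.le : Signal μ) = priceCap μ c := by
  refine h.reservation_eq_of_gain_eq ?_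
  change ∫ x, _ ∂(twoPoint μ 1) = c
  have hU := h.priceCap_lt_one
  have hU0 := h.priceCap_pos
  rw [twoPoint, integral_add_measure, integral_smul_measure, integral_smul_measure]
  · simp only [integral_dirac]
    rw [max_eq_right (by simpa using hU0.le), max_eq_left (by simpa using hU.le),
      ENNReal.toReal_ofReal (by simpa using h.mean_lt_one.le),
      ENNReal.toReal_ofReal (by simpa using h.mean_pos.le)]
    have := h.mean_mul_priceCap
    simp only [Set.Icc.coe_one, smul_eq_mul]
    linarith
  · exact (integrable_gain _ _).smul_measure ENNReal.ofReal_ne_top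
  · exact (integrable_gain _ _).smul_measure ENNReal.ofReal_ne_top

/-- The uninformative signal. -/
def noInformation (h : Params μ c) : Signal μ :=
  twoPointSignal h.mean_pos ⟨μ, h.mean_pos.le, h.mean_lt_one.le⟩ le_rfl

lemma Params.reservation_noInformation (h : Params μ c) :
    reservation c (noInformation h : Signal μ) = μ - c := by
  refine h.reservation_eq_of_gain_eq ?_
  change ∫ x, _ ∂(twoPoint μ _) = c
  rw [twoPoint]
  simp [h.mean_pos.ne', h.cost_pos.le]

end

/-! ### Resampling one coordinate of a product measure -/

section Resample

variable {ι : Type*} [Fintype ι] [DecidableEq ι] {α : ι → Type*} [∀ i, MeasurableSpace (α i)]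

/-- Redrawing one coordinate independently does not change a product law. This serves both the
search recursion, where one more firm is opened, and the conditioning of profits on the outcome of
one firm. -/
lemma measurePreserving_update (F : ∀ i, Measure (α i)) [∀ i, IsProbabilityMeasure (F i)] (i : ι) :
    MeasurePreserving (fun q : α i × (∀ j, α j) => Function.update q.2 i q.1)
      ((F i).prod (Measure.pi F)) (Measure.pi F) := by
  have hm : Measurable fun q : α i × (∀ j, α j) => Function.update q.2 i q.1 :=
    measurable_pi_lambda _ fun j => by
      by_cases hj : j = i
      · subst hj; simpa using measurable_fst
      · simpa [hj, Function.comp_def] using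
          (measurable_pi_apply j).comp (measurable_snd (α := α i))
  refine ⟨hm, (Measure.pi_eq fun s hs => ?_).symm⟩
  rw [Measure.map_apply hm (MeasurableSet.univ_pi hs)]
  have hpre : (fun q : α i × (∀ j, α j) => Function.update q.2 i q.1) ⁻¹' Set.univ.pi s
      = s i ×ˢ Set.univ.pi (Function.update s i Set.univ) := by
    ext ⟨y, x⟩
    simp only [Set.mem_preimage, Set.mem_pi, Set.mem_univ, true_implies, Set.mem_prod]
    constructor
    · intro h
      refine ⟨by simpa using h i, fun j => ?_⟩
      by_cases hj : j = i
      · subst hj; simp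
      · simpa [hj] using h j
    · rintro ⟨hy, h⟩ j
      by_cases hj : j = i
      · subst hj; simpa using hy
      · simpa [hj] using h j
  rw [hpre, Measure.prod_prod, Measure.pi_pi,
    ← Finset.mul_prod_erase Finset.univ (fun j => F j (s j)) (Finset.mem_univ i),
    ← Finset.mul_prod_erase Finset.univ (fun j => F j (Function.update s i Set.univ j))
      (Finset.mem_univ i)]
  simp only [Function.update_self, measure_univ, one_mul]
  congr 1
  refine Finset.prod_congr rfl fun j hj => ?_
  rw [Function.update_of_ne (Finset.ne_of_mem_erase hj)]

lemma lintegral_pi_eq_update (F : ∀ i, Measure (α i)) [∀ i, IsProbabilityMeasure (F i)] (i : ι)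
    {g : (∀ j, α j) → ℝ≥0∞} (hg : Measurable g) :
    ∫⁻ x, g x ∂(Measure.pi F)
      = ∫⁻ y, ∫⁻ x, g (Function.update x i y) ∂(Measure.pi F) ∂(F i) := by
  have h := measurePreserving_update F i
  conv_lhs => rw [← h.map_eq, lintegral_map hg h.measurable]
  exact lintegral_prod _ (hg.comp h.measurable).aemeasurable

end Resample

/-! ### The largest of finitely many values and `0` -/

variable {n : ℕ}

/-- The value of an option `a`, where `none` is worth `0`. -/
def optVal (v : Fin n → ℝ) (a : Option (Fin n)) : ℝ := a.elim 0 v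

@[simp] lemma optVal_none (v : Fin n → ℝ) : optVal v none = 0 := rfl

@[simp] lemma optVal_some (v : Fin n → ℝ) (i : Fin n) : optVal v (some i) = v i := rfl

/-- The largest of `0` and the values `v i`. -/
def best (v : Fin n → ℝ) : ℝ :=
  Finset.univ.sup' Finset.univ_nonempty (optVal v)

/-- The option `a` has the largest value. -/
def IsBest (v : Fin n → ℝ) (a : Option (Fin n)) : Prop := ∀ a', optVal v a' ≤ optVal v a

lemma best_le_iff {v : Fin n → ℝ} {t : ℝ} : best v ≤ t ↔ ∀ a, optVal v a ≤ t := by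
  rw [best, Finset.sup'_le_iff]
  simp

lemma le_best (v : Fin n → ℝ) (a : Option (Fin n)) : optVal v a ≤ best v :=
  best_le_iff.1 le_rfl a

lemma best_nonneg (v : Fin n → ℝ) : 0 ≤ best v := le_best v none

lemma exists_isBest (v : Fin n → ℝ) : ∃ a, IsBest v a := by
  obtain ⟨a, ha⟩ := Finite.exists_max (optVal v)
  exact ⟨a, ha⟩

lemma best_update (v : Fin n → ℝ) (i : Fin n) (t : ℝ) :
    best (Function.update v i t) = max (best (Function.update v i 0)) t := by
  apply le_antisymm
  · refine best_le_iff.2 fun a => ?_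
    cases a with
    | none => exact le_max_of_le_left (best_nonneg _)
    | some j =>
      by_cases hj : j = i
      · subst hj; simp
      · refine le_max_of_le_left ?_
        have := le_best (Function.update v i 0) (some j)
        simpa [hj] using this
  · refine max_le (best_le_iff.2 fun a => ?_) ?_
    · cases a with
      | none => exact best_nonneg _
      | some j =>
        by_cases hj : j = i
        · subst hj; simpa using best_nonneg _
        · have := le_best (Function.update v i t) (some j)
          simpa [hj] using this
    · have := le_best (Function.update v i t) (some i)
      simpa using this

/-- Uncapping coordinate `i` helps only by the excess of `u` over both `r` and the best alternative.
As `v i ≤ r`, the old coordinate `i` is absorbed by `max (best v) r`. Integrated over `u`, the right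
side becomes a `gain`. -/
lemma best_update_sub (v : Fin n → ℝ) (i : Fin n) {r : ℝ} (hv : v i ≤ r) (u : ℝ) :
    best (Function.update v i u) - best (Function.update v i (min u r))
      = max (u - max (best v) r) 0 := by
  have h0 : best v = max (best (Function.update v i 0)) (v i) := by
    rw [← best_update, Function.update_eq_self]
  rw [best_update v i u, best_update v i (min u r), h0]
  set t := best (Function.update v i 0)
  rw [max_assoc, max_eq_right hv]
  rcases le_total u r with h | h
  · rw [min_eq_left h, max_eq_right (a := u - max t r)]
    · ring
    · linarith [le_max_right t r]
  · rw [min_eq_right h]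
    rcases le_total t r with h1 | h1
    · rw [max_eq_right h1, max_eq_right (h1.trans h), max_eq_left (by linarith)]
    · rw [max_eq_left h1]
      rcases le_total t u with h2 | h2
      · rw [max_eq_right h2, max_eq_left (by linarith)]
      · rw [max_eq_left h2, max_eq_right (by linarith)]; ring

lemma continuous_best {X : Type*} [TopologicalSpace X] {v : X → Fin n → ℝ} (hv : Continuous v) :
    Continuous fun x => best (v x) := by
  refine Continuous.finset_sup'_apply _ fun a _ => ?_
  cases a with
  | none => exact continuous_const
  | some i => exact (continuous_apply i).comp hv

/-! ### Optimal search -/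

section Search

variable (p : Fin n → ℝ≥0) (r : Fin n → ℝ)

/-- Posteriors `x` at the firms in `l`, and `y` elsewhere. -/
def merge (l : List (Fin n)) (x y : Fin n → unitInterval) : Fin n → unitInterval :=
  fun j => if j ∈ l then x j else y j

/-- The index of a firm: its surplus once it is visited, and its reservation utility before. -/
def score (l : List (Fin n)) (x : Fin n → unitInterval) : Fin n → ℝ :=
  fun j => if j ∈ l then (x j : ℝ) - p j else r j

/-- The surplus at the firms in `l`, and the surplus capped by the reservation utility at the other
firms. -/
def cappedSurplus (l : List (Fin n)) (x : Fin n → unitInterval) : Fin n → ℝ :=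
  fun j => if j ∈ l then (x j : ℝ) - p j else min ((x j : ℝ) - p j) (r j)

/-- The value of the search problem at the history `(l, x)`. -/
def optimalValue (F : Fin n → Measure unitInterval) (l : List (Fin n))
    (x : Fin n → unitInterval) : ℝ :=
  ∫ y, best (cappedSurplus p r l (merge l x y)) ∂(Measure.pi F)

/-- The value of a choice at the history `(l, x)` when the search continues optimally. -/
def choiceValue (F : Fin n → Measure unitInterval) (c : ℝ) (l : List (Fin n))
    (x : Fin n → unitInterval) : Option (Fin n) → ℝ
  | none => 0
  | some i => if i ∈ l then (x i : ℝ) - p i else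
      (∫ y, optimalValue p r F (i :: l) (Function.update x i y) ∂(F i)) - c

lemma merge_cons_update {l : List (Fin n)} {i : Fin n} (hi : i ∉ l)
    (x y : Fin n → unitInterval) (t : unitInterval) :
    merge (i :: l) (Function.update x i t) y = merge l x (Function.update y i t) := by
  ext j
  by_cases hj : j = i
  · subst hj; simp [merge, hi]
  · simp [merge, hj]

lemma continuous_cappedSurplus (l : List (Fin n)) : Continuous (cappedSurplus p r l) := by
  refine continuous_pi fun j => ?_
  unfold cappedSurplus
  split_ifs <;> fun_prop

lemma continuous_merge (l : List (Fin n)) (x : Fin n → unitInterval) :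
    Continuous (merge l x) := by
  refine continuous_pi fun j => ?_
  unfold merge
  split_ifs <;> fun_prop

lemma cappedSurplus_merge_update {l : List (Fin n)} {i : Fin n} (hi : i ∉ l)
    (x y : Fin n → unitInterval) (t : unitInterval) :
    cappedSurplus p r l (merge l x (Function.update y i t))
      = Function.update (cappedSurplus p r l (merge l x y)) i (min ((t : ℝ) - p i) (r i)) := by
  ext j
  by_cases hj : j = i
  · subst hj; simp [cappedSurplus, merge, hi]
  · simp [cappedSurplus, merge, hj]

lemma cappedSurplus_cons_merge {l : List (Fin n)} {i : Fin n} (hi : i ∉ l)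
    (x y : Fin n → unitInterval) (t : unitInterval) :
    cappedSurplus p r (i :: l) (merge (i :: l) (Function.update x i t) y)
      = Function.update (cappedSurplus p r l (merge l x y)) i ((t : ℝ) - p i) := by
  rw [merge_cons_update hi]
  ext j
  by_cases hj : j = i
  · subst hj; simp [cappedSurplus, merge, hi]
  · simp [cappedSurplus, merge, hj]

variable {p r} {F : Fin n → Measure unitInterval} [∀ i, IsProbabilityMeasure (F i)] {c : ℝ}

lemma integrable_best (l : List (Fin n)) (x : Fin n → unitInterval) :
    Integrable (fun y => best (cappedSurplus p r l (merge l x y))) (Measure.pi F) :=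
  integrable_of_continuous
    (continuous_best ((continuous_cappedSurplus p r l).comp (continuous_merge l x)))

omit [∀ i, IsProbabilityMeasure (F i)] in
lemma optimalValue_nonneg (l : List (Fin n)) (x : Fin n → unitInterval) :
    0 ≤ optimalValue p r F l x := integral_nonneg fun _ => best_nonneg _

lemma const_le_optimalValue {l : List (Fin n)} {x : Fin n → unitInterval} {t : ℝ}
    (ht : ∀ y, t ≤ best (cappedSurplus p r l (merge l x y))) :
    t ≤ optimalValue p r F l x ∧ (t = optimalValue p r F l x ↔
      ∀ᵐ y ∂(Measure.pi F), best (cappedSurplus p r l (merge l x y)) ≤ t) := by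
  have h0 : ∫ _y : Fin n → unitInterval, t ∂(Measure.pi F) = t := by simp
  constructor
  · rw [optimalValue, ← h0]
    exact integral_mono (integrable_const _) (integrable_best l x) ht
  · have h := integral_eq_iff_of_ae_le (μ := Measure.pi F) (integrable_const t)
      (integrable_best (p := p) (r := r) l x) (Filter.Eventually.of_forall ht)
    rw [h0] at h
    rw [optimalValue, h]
    refine Filter.eventually_congr (Filter.Eventually.of_forall fun y => ?_)
    exact ⟨fun h => h.ge, fun h => le_antisymm (ht y) h⟩

omit [∀ i, IsProbabilityMeasure (F i)] in
-- A gain of `c > 0` needs mass above the threshold. So the capped surplus of an unvisited firm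
-- attains its cap with positive probability.
lemma measure_reservation_le_ne_zero {i : Fin n} (hc : 0 < c)
    (hr : gain (F i) (p i + r i) = c) : F i {x | r i ≤ (x : ℝ) - p i} ≠ 0 := by
  intro h0
  have h1 : ∀ᵐ x : unitInterval ∂(F i), ¬ r i ≤ (x : ℝ) - p i := by
    rw [ae_iff]; simpa using h0
  have : gain (F i) (p i + r i) = 0 := by
    refine integral_eq_zero_of_ae ?_
    filter_upwards [h1] with x hx
    simp only [Pi.zero_apply, max_eq_right_iff]
    linarith
  linarith

/-- The essential supremum of the capped surplus of an unvisited firm is its reservation utility, so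
the essential supremum of `best` is the largest index or `0`. -/
lemma ae_best_le_iff (hc : 0 < c) (hr : ∀ i, gain (F i) (p i + r i) = c) (l : List (Fin n))
    (x : Fin n → unitInterval) (t : ℝ) :
    (∀ᵐ y ∂(Measure.pi F), best (cappedSurplus p r l (merge l x y)) ≤ t)
      ↔ ∀ a, optVal (score p r l x) a ≤ t := by
  constructor
  · intro h a
    cases a with
    | none =>
      obtain ⟨y, hy⟩ := h.exists
      exact (best_nonneg _).trans hy
    | some j =>
      by_cases hj : j ∈ l
      · obtain ⟨y, hy⟩ := h.exists
        have := (best_le_iff.1 hy) (some j)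
        simpa [score, cappedSurplus, merge, hj] using this
      · by_contra! hlt
        simp only [optVal_some, score, hj, if_false] at hlt
        refine measure_reservation_le_ne_zero hc (hr j) ?_
        have hmp := measurePreserving_eval F j
        have hms : MeasurableSet {y : unitInterval | r j ≤ (y : ℝ) - p j} :=
          measurableSet_le measurable_const (by fun_prop)
        rw [← hmp.measure_preimage hms.nullMeasurableSet]
        rw [ae_iff] at h
        refine measure_mono_null (fun y hy => ?_) h
        simp only [Set.mem_ofPred_eq, not_le]
        have h2 : r j ≤ (y j : ℝ) - p j := hy
        refine lt_of_lt_of_le ?_ (le_best _ (some j))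
        simpa [cappedSurplus, merge, hj, h2] using hlt
  · intro h
    refine Filter.Eventually.of_forall fun y => best_le_iff.2 fun a => ?_
    cases a with
    | none => exact h none
    | some j =>
      have := h (some j)
      by_cases hj : j ∈ l
      · simpa [score, cappedSurplus, merge, hj] using this
      · simp only [optVal_some, score, cappedSurplus, hj, if_false] at this ⊢
        exact min_le_of_right_le this

/-- The two values are integrals over the same resampled posteriors, with the surplus of firm `i`
capped in one and not in the other; `best_update_sub` and Fubini turn the difference into a gain, to
be compared with the visiting cost. -/
lemma optimalValue_sub_choiceValue {l : List (Fin n)} {i : Fin n} (hi : i ∉ l)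
    (x : Fin n → unitInterval) :
    optimalValue p r F l x - choiceValue p r F c l x (some i)
      = ∫ y, (c - gain (F i) (p i + max (best (cappedSurplus p r l (merge l x y))) (r i)))
          ∂(Measure.pi F) := by
  have hmp := measurePreserving_update F i
  have hV : Continuous fun y => cappedSurplus p r l (merge l x y) :=
    (continuous_cappedSurplus p r l).comp (continuous_merge l x)
  set V := fun y => cappedSurplus p r l (merge l x y) with hVd
  have hc1 : Continuous fun q : unitInterval × (Fin n → unitInterval) =>
      best (Function.update (V q.2) i ((q.1 : ℝ) - p i)) :=
    continuous_best ((hV.comp continuous_snd).update i (by fun_prop))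
  have hc2 : Continuous fun q : unitInterval × (Fin n → unitInterval) =>
      best (Function.update (V q.2) i (min ((q.1 : ℝ) - p i) (r i))) :=
    continuous_best ((hV.comp continuous_snd).update i (by fun_prop))
  have hW : optimalValue p r F l x = ∫ q : unitInterval × (Fin n → unitInterval),
      best (Function.update (V q.2) i (min ((q.1 : ℝ) - p i) (r i)))
        ∂((F i).prod (Measure.pi F)) := by
    rw [optimalValue]
    conv_lhs => rw [← hmp.map_eq]
    rw [integral_map hmp.measurable.aemeasurable
      (by rw [hmp.map_eq]; exact (integrable_best l x).aestronglyMeasurable)]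
    refine integral_congr_ae (Filter.Eventually.of_forall fun q => ?_)
    simp only [cappedSurplus_merge_update p r hi, hVd]
  have hQ : choiceValue p r F c l x (some i)
      = (∫ q : unitInterval × (Fin n → unitInterval),
      best (Function.update (V q.2) i ((q.1 : ℝ) - p i)) ∂((F i).prod (Measure.pi F))) - c := by
    rw [choiceValue, if_neg hi, integral_prod _ (integrable_of_continuous hc1)]
    simp only [optimalValue, cappedSurplus_cons_merge p r hi, hVd]
  have hi1 : Integrable _ ((F i).prod (Measure.pi F)) := integrable_of_continuous hc1
  have hi2 : Integrable _ ((F i).prod (Measure.pi F)) := integrable_of_continuous hc2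
  have hd : (∫ q : unitInterval × (Fin n → unitInterval),
      best (Function.update (V q.2) i ((q.1 : ℝ) - p i)) ∂((F i).prod (Measure.pi F)))
      - optimalValue p r F l x = ∫ y, gain (F i) (p i + max (best (V y)) (r i))
        ∂(Measure.pi F) := by
    rw [hW, ← integral_sub hi1 hi2]
    refine (integral_prod_symm _ (hi1.sub hi2)).trans ?_
    refine integral_congr_ae (Filter.Eventually.of_forall fun y => ?_)
    simp only [gain]
    refine integral_congr_ae (Filter.Eventually.of_forall fun t => ?_)
    have hVi : V y i ≤ r i := by simp [hVd, cappedSurplus, hi]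
    refine (best_update_sub (V y) i hVi _).trans ?_
    rw [sub_sub]
  rw [integral_sub (integrable_const _)]
  · rw [hQ]
    simp only [integral_const, probReal_univ, one_smul]
    linarith
  · refine integrable_of_continuous ((gain_continuous (F i)).comp ?_)
    have := continuous_best hV
    fun_prop

/-- The Bellman inequality with its equality case. Stopping loses the excess of `best` over the
chosen value; visiting `i` loses `c` minus a gain at a level of at least `r i`. Either loss is
nonnegative and vanishes exactly when `best` almost surely does not exceed the index of the choice.
-/
lemma choiceValue_le (hc : 0 < c) (hr : ∀ i, gain (F i) (p i + r i) = c) (l : List (Fin n))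
    (x : Fin n → unitInterval) (a : Option (Fin n)) :
    choiceValue p r F c l x a ≤ optimalValue p r F l x ∧
      (choiceValue p r F c l x a = optimalValue p r F l x ↔ IsBest (score p r l x) a) := by
  cases a with
  | none =>
    have h := const_le_optimalValue (F := F) (p := p) (r := r) (l := l) (x := x) (t := 0)
      fun y => best_nonneg _
    exact ⟨h.1, h.2.trans (ae_best_le_iff hc hr l x 0)⟩
  | some i =>
    by_cases hi : i ∈ l
    · have h := const_le_optimalValue (F := F) (p := p) (r := r) (l := l) (x := x)
        (t := (x i : ℝ) - p i) fun y => by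
          have := le_best (cappedSurplus p r l (merge l x y)) (some i)
          simpa [cappedSurplus, merge, hi] using this
      rw [choiceValue, if_pos hi]
      refine ⟨h.1, h.2.trans ((ae_best_le_iff hc hr l x _).trans ?_)⟩
      simp [IsBest, score, hi]
    · have hsub := optimalValue_sub_choiceValue (p := p) (r := r) (F := F) (c := c) hi x
      have hle : ∀ s, c - gain (F i) (p i + max s (r i)) ≥ 0 := fun s => by
        have := gain_antitone (F i) (show (p i : ℝ) + r i ≤ p i + max s (r i) by
          linarith [le_max_right s (r i)])
        rw [hr i] at this
        linarith
      have hint : Integrable (fun y => c - gain (F i)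
          (p i + max (best (cappedSurplus p r l (merge l x y))) (r i))) (Measure.pi F) := by
        refine integrable_of_continuous (continuous_const.sub ((gain_continuous (F i)).comp ?_))
        have := continuous_best ((continuous_cappedSurplus p r l).comp (continuous_merge l x))
        simp only [Function.comp_def] at this
        fun_prop
      refine ⟨?_, ?_⟩
      · rw [← sub_nonneg, hsub]
        exact integral_nonneg fun y => hle _
      · have h1 : choiceValue p r F c l x (some i) = optimalValue p r F l x ↔
            optimalValue p r F l x - choiceValue p r F c l x (some i) = 0 :=
          ⟨fun h => by linarith, fun h => by linarith⟩
        rw [h1, hsub, integral_eq_zero_iff_of_nonneg (fun y => hle _) hint]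
        have h2 : IsBest (score p r l x) (some i) ↔
            ∀ a, optVal (score p r l x) a ≤ r i := by simp [IsBest, score, hi]
        rw [h2, ← ae_best_le_iff hc hr l x]
        refine Filter.eventually_congr (Filter.Eventually.of_forall fun y => ?_)
        simp only [Pi.zero_apply]
        constructor
        · intro h
          by_contra! hlt
          rw [max_eq_left hlt.le] at h
          have := gain_strict (F := F i)
            (show (p i : ℝ) + r i < p i + best (cappedSurplus p r l (merge l x y)) by linarith)
            (by rw [hr i]; exact hc)
          rw [hr i] at this
          linarith
        · intro h
          rw [max_eq_right h, hr i, sub_self]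

lemma mem_of_nodup_of_length {l : List (Fin n)} (hl : l.Nodup) (hn : l.length = n) (i : Fin n) :
    i ∈ l := by
  have h : l.toFinset = Finset.univ := by
    rw [← Finset.card_eq_iff_eq_univ, List.toFinset_card_of_nodup hl, hn, Fintype.card_fin]
  rw [← List.mem_toFinset, h]
  exact Finset.mem_univ i

variable {q : List (Fin n) → (Fin n → unitInterval) → Option (Fin n) → ℝ}

lemma searchValue_le (hq0 : ∀ l x a, 0 ≤ q l x a) (hq1 : ∀ l x, ∑ a, q l x a = 1) (hc : 0 < c)
    (hr : ∀ i, gain (F i) (p i + r i) = c) (k : ℕ) :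
    ∀ (l : List (Fin n)), l.Nodup → l.length + k = n → ∀ x,
      searchValue q F c (surplus p) k l x ≤ optimalValue p r F l x := by
  induction k with
  | zero =>
    intro l hl hn x
    rw [searchValue, ← one_mul (optimalValue p r F l x), ← hq1 l x, Finset.sum_mul]
    refine Finset.sum_le_sum fun a _ => mul_le_mul_of_nonneg_left ?_ (hq0 _ _ _)
    refine le_trans (le_of_eq ?_) (choiceValue_le hc hr l x a).1
    cases a with
    | none => rfl
    | some i => simp [choiceValue, surplus, mem_of_nodup_of_length hl hn i]
  | succ k ih =>
    intro l hl hn x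
    rw [searchValue, ← one_mul (optimalValue p r F l x), ← hq1 l x, Finset.sum_mul]
    refine Finset.sum_le_sum fun a _ => mul_le_mul_of_nonneg_left ?_ (hq0 _ _ _)
    cases a with
    | none => exact (choiceValue_le hc hr l x none).1
    | some i =>
      refine le_trans ?_ (choiceValue_le hc hr l x (some i)).1
      simp only [choiceValue]
      split_ifs with hi
      · exact le_rfl
      · refine sub_le_sub_right ?_ c
        have hind : ∀ y : unitInterval,
            searchValue q F c (surplus p) k (i :: l) (Function.update x i y)
            ≤ optimalValue p r F (i :: l) (Function.update x i y) := fun y =>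
          ih (i :: l) (List.nodup_cons.2 ⟨hi, hl⟩) (by rw [List.length_cons]; omega) _
        by_cases hint : Integrable
            (fun y => optimalValue p r F (i :: l) (Function.update x i y)) (F i)
        · by_cases hint' : Integrable (fun y =>
              searchValue q F c (surplus p) k (i :: l) (Function.update x i y)) (F i)
          · exact integral_mono hint' hint hind
          -- No measurability of `q` is assumed, so the integral may be the default `0`; this is
          -- harmless because the optimal value is nonnegative.
          · rw [integral_undef hint']
            exact integral_nonneg fun y => optimalValue_nonneg _ _
        · refine absurd ?_ hint
          simp only [optimalValue, cappedSurplus_cons_merge p r hi]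
          refine (integrable_of_continuous (F := (F i).prod (Measure.pi F))
            (f := fun q : unitInterval × (Fin n → unitInterval) =>
              best (Function.update (cappedSurplus p r l (merge l x q.2)) i
                ((q.1 : ℝ) - p i))) ?_).integral_prod_left
          exact continuous_best ((((continuous_cappedSurplus p r l).comp
            (continuous_merge l x)).comp continuous_snd).update i (by fun_prop))

lemma searchValue_eq (hq1 : ∀ l x, ∑ a, q l x a = 1) (hc : 0 < c)
    (hr : ∀ i, gain (F i) (p i + r i) = c)
    (hq : ∀ l : List (Fin n), l.Nodup → ∀ x a, q l x a ≠ 0 → IsBest (score p r l x) a) (k : ℕ) :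
    ∀ (l : List (Fin n)), l.Nodup → l.length + k = n → ∀ x,
      searchValue q F c (surplus p) k l x = optimalValue p r F l x := by
  induction k with
  | zero =>
    intro l hl hn x
    rw [searchValue, ← one_mul (optimalValue p r F l x), ← hq1 l x, Finset.sum_mul]
    refine Finset.sum_congr rfl fun a _ => ?_
    by_cases ha : q l x a = 0
    · simp [ha]
    rw [← (choiceValue_le hc hr l x a).2.2 (hq l hl x a ha)]
    cases a with
    | none => rfl
    | some i => simp [choiceValue, surplus, mem_of_nodup_of_length hl hn i]
  | succ k ih =>
    intro l hl hn x
    rw [searchValue, ← one_mul (optimalValue p r F l x), ← hq1 l x, Finset.sum_mul]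
    refine Finset.sum_congr rfl fun a _ => ?_
    by_cases ha : q l x a = 0
    · simp [ha]
    rw [← (choiceValue_le hc hr l x a).2.2 (hq l hl x a ha)]
    cases a with
    | none => rfl
    | some i =>
      simp only [choiceValue]
      split_ifs with hi
      · rfl
      · congr 2
        refine integral_congr_ae (Filter.Eventually.of_forall fun y => ?_)
        exact ih (i :: l) (List.nodup_cons.2 ⟨hi, hl⟩) (by rw [List.length_cons]; omega) _

/-- Converse of `searchValue_eq`: if the value is optimal after every history, the current mixture
averages choice values none of which exceeds that optimum, so only maximizers get weight. -/
lemma isBest_of_searchValue_eq (hq0 : ∀ l x a, 0 ≤ q l x a) (hq1 : ∀ l x, ∑ a, q l x a = 1)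
    (hc : 0 < c) (hr : ∀ i, gain (F i) (p i + r i) = c)
    (hV : ∀ (l : List (Fin n)), l.Nodup → ∀ x,
      searchValue q F c (surplus p) (n - l.length) l x = optimalValue p r F l x)
    {l : List (Fin n)} (hl : l.Nodup) {x : Fin n → unitInterval} {a : Option (Fin n)}
    (ha : q l x a ≠ 0) : IsBest (score p r l x) a := by
  have hsum : ∑ a, q l x a * choiceValue p r F c l x a = optimalValue p r F l x := by
    rw [← hV l hl x]
    have hlen : l.length ≤ n := by simpa using hl.length_le_card
    rcases Nat.eq_zero_or_pos (n - l.length) with h0 | h0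
    · rw [h0, searchValue]
      refine Finset.sum_congr rfl fun a _ => ?_
      cases a with
      | none => rfl
      | some i => simp [choiceValue, surplus, mem_of_nodup_of_length hl (by omega) i]
    · obtain ⟨k, hk⟩ := Nat.exists_eq_add_of_lt h0
      rw [zero_add] at hk
      rw [hk, searchValue]
      refine Finset.sum_congr rfl fun a _ => ?_
      cases a with
      | none => rfl
      | some i =>
        simp only [choiceValue]
        split_ifs with hi
        · rfl
        · congr 2
          refine integral_congr_ae (Filter.Eventually.of_forall fun y => ?_)
          have := hV (i :: l) (List.nodup_cons.2 ⟨hi, hl⟩) (Function.update x i y)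
          rw [List.length_cons, show n - (l.length + 1) = k by omega] at this
          exact this.symm
  have hz : ∑ a, q l x a * (optimalValue p r F l x - choiceValue p r F c l x a) = 0 := by
    simp only [mul_sub, Finset.sum_sub_distrib]
    rw [hsum, ← Finset.sum_mul, hq1, one_mul, sub_self]
  rw [Finset.sum_eq_zero_iff_of_nonneg fun a _ => mul_nonneg (hq0 _ _ _)
    (sub_nonneg.2 (choiceValue_le hc hr l x a).1)] at hz
  have := hz a (Finset.mem_univ a)
  rcases mul_eq_zero.1 this with h | h
  · exact absurd h ha
  · exact (choiceValue_le hc hr l x a).2.1 (by linarith)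

end Search

/-! ### Sequentially rational search -/

section Rational

variable {n : ℕ} {μ c : ℝ}

lemma measurable_believedSignal {b : ℝ≥0 → Signal μ} (hb : Measurable b) :
    Measurable (believedSignal b) := by
  have h : believedSignal b
      = Sum.elim Prod.snd (fun q : ℝ≥0 × Unit => b q.1) ∘
        (MeasurableEquiv.prodSumDistrib ℝ≥0 (Signal μ) Unit) := by
    ext ⟨p, s⟩
    cases s <;> rfl
  rw [h]
  exact (measurable_snd.sumElim (hb.comp measurable_fst)).comp (MeasurableEquiv.measurable _)

lemma measurable_signal : Measurable (FirmAction.signal : FirmAction μ → Signal μ) :=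
  (measurable_id.sumElim measurable_id).comp measurable_snd

lemma measurable_observe : Measurable (FirmAction.observe : FirmAction μ → Observation μ) :=
  measurable_fst.prodMk ((measurable_id.sumMap measurable_const).comp measurable_snd)

/-- The reservation utility of a firm given its observation. -/
def reservationUtility (c : ℝ) (b : ℝ≥0 → Signal μ) (o : Observation μ) : ℝ :=
  reservation c (believedSignal b o) - o.1

lemma Params.measurable_reservationUtility (h : Params μ c) {b : ℝ≥0 → Signal μ}
    (hb : Measurable b) : Measurable (reservationUtility c b) :=
  (h.measurable_reservation.comp (measurable_believedSignal hb)).sub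
    (measurable_coe_nnreal_real.comp measurable_fst)

lemma Params.gain_reservationUtility (h : Params μ c) (b : ℝ≥0 → Signal μ) (o : Observation μ) :
    gain (believedSignal b o) (o.1 + reservationUtility c b o) = c := by
  rw [reservationUtility, add_sub_cancel, h.gain_reservation]

/-- The index of each firm given the observations. -/
def observedScore (c : ℝ) (b : Fin n → ℝ≥0 → Signal μ) (o : Fin n → Observation μ) :
    List (Fin n) → (Fin n → unitInterval) → Fin n → ℝ :=
  score (fun i => (o i).1) (fun i => reservationUtility c (b i) (o i))

lemma measurableSet_isBest (a : Option (Fin n)) : MeasurableSet {v : Fin n → ℝ | IsBest v a} := by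
  have hm : ∀ a : Option (Fin n), Measurable fun v : Fin n → ℝ => optVal v a := fun a => by
    cases a with
    | none => exact measurable_const
    | some i => exact measurable_pi_apply i
  have : {v : Fin n → ℝ | IsBest v a} = ⋂ a', {v | optVal v a' ≤ optVal v a} := by
    ext v; simp [IsBest]
  rw [this]
  exact MeasurableSet.iInter fun a' => measurableSet_le (hm a') (hm a)

open Classical in
/-- The uniform distribution over the options of largest value. -/
def uniformBest (v : Fin n → ℝ) (a : Option (Fin n)) : ℝ :=
  (if IsBest v a then 1 else 0) / ∑ a', if IsBest v a' then 1 else 0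

lemma uniformBest_nonneg (v : Fin n → ℝ) (a : Option (Fin n)) : 0 ≤ uniformBest v a := by
  unfold uniformBest
  exact div_nonneg (by split_ifs <;> norm_num)
    (Finset.sum_nonneg fun a _ => by split_ifs <;> norm_num)

lemma sum_uniformBest (v : Fin n → ℝ) : ∑ a, uniformBest v a = 1 := by
  classical
  unfold uniformBest
  rw [← Finset.sum_div]
  refine div_self (ne_of_gt ?_)
  obtain ⟨a, ha⟩ := exists_isBest v
  exact Finset.sum_pos' (fun a _ => by split_ifs <;> norm_num)
    ⟨a, Finset.mem_univ a, by simp [ha]⟩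

lemma isBest_of_uniformBest_ne_zero {v : Fin n → ℝ} {a : Option (Fin n)}
    (h : uniformBest v a ≠ 0) : IsBest v a := by
  by_contra hb
  simp [uniformBest, hb] at h

lemma measurable_uniformBest (a : Option (Fin n)) :
    Measurable fun v : Fin n → ℝ => uniformBest v a := by
  classical
  have hm : ∀ a : Option (Fin n), Measurable fun v : Fin n → ℝ =>
      if IsBest v a then (1 : ℝ) else 0 := fun a =>
    Measurable.ite (measurableSet_isBest a) measurable_const measurable_const
  exact (hm a).div (Finset.measurable_sum _ fun a' _ => hm a')

/-- The search strategy that follows an option of largest index. -/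
def indexStrategy (h : Params μ c) (b : Fin n → ℝ≥0 → Signal μ) (hb : ∀ i, Measurable (b i)) :
    SearchStrategy n μ where
  prob o l x a := uniformBest (observedScore c b o l x) a
  nonneg _ _ _ _ := uniformBest_nonneg _ _
  sum_eq_one _ _ _ := sum_uniformBest _
  measurable l a := by
    refine (measurable_uniformBest a).comp (measurable_pi_lambda _ fun i => ?_)
    simp only [observedScore, score]
    have h1 : Measurable fun ox : (Fin n → Observation μ) × (Fin n → unitInterval) => ox.1 i :=
      (measurable_pi_apply i).comp measurable_fst
    have h2 : Measurable fun ox : (Fin n → Observation μ) × (Fin n → unitInterval) => ox.2 i :=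
      (measurable_pi_apply i).comp measurable_snd
    split_ifs
    · exact (measurable_subtype_coe.comp h2).sub
        (measurable_coe_nnreal_real.comp (measurable_fst.comp h1))
    · exact (h.measurable_reservationUtility (hb i)).comp h1

variable (h : Params μ c) {b : Fin n → ℝ≥0 → Signal μ}
include h

lemma Params.consumerPayoff_le (τ : SearchStrategy n μ) (o : Fin n → Observation μ)
    {l : List (Fin n)} (hl : l.Nodup) (x : Fin n → unitInterval) :
    consumerPayoff c b τ o l x ≤ optimalValue (fun i => (o i).1)
      (fun i => reservationUtility c (b i) (o i)) (fun i => believedSignal (b i) (o i)) l x := by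
  have hlen : l.length ≤ n := by simpa using hl.length_le_card
  exact searchValue_le (τ.nonneg o) (τ.sum_eq_one o) h.cost_pos
    (fun i => h.gain_reservationUtility (b i) (o i)) _ l hl (by omega) x

lemma Params.consumerPayoff_indexStrategy (hb : ∀ i, Measurable (b i))
    (o : Fin n → Observation μ) {l : List (Fin n)} (hl : l.Nodup) (x : Fin n → unitInterval) :
    consumerPayoff c b (indexStrategy h b hb) o l x = optimalValue (fun i => (o i).1)
      (fun i => reservationUtility c (b i) (o i)) (fun i => believedSignal (b i) (o i)) l x := by
  have hlen : l.length ≤ n := by simpa using hl.length_le_card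
  exact searchValue_eq ((indexStrategy h b hb).sum_eq_one o) h.cost_pos
    (fun i => h.gain_reservationUtility (b i) (o i))
    (fun l _ x a ha => isBest_of_uniformBest_ne_zero ha) _ l hl (by omega) x

lemma Params.sequentiallyRational_indexStrategy (hb : ∀ i, Measurable (b i)) :
    SequentiallyRational c b (indexStrategy h b hb) := fun o l hl x τ' => by
  rw [h.consumerPayoff_indexStrategy hb o hl]
  exact h.consumerPayoff_le τ' o hl x

/-- `indexStrategy` attains the upper bound on the payoff at every history, so a rational strategy
must attain it too. -/
lemma Params.isBest_of_sequentiallyRational (hb : ∀ i, Measurable (b i)) {τ : SearchStrategy n μ}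
    (hτ : SequentiallyRational c b τ) (o : Fin n → Observation μ) {l : List (Fin n)}
    (hl : l.Nodup) {x : Fin n → unitInterval} {a : Option (Fin n)} (ha : τ.prob o l x a ≠ 0) :
    IsBest (observedScore c b o l x) a := by
  refine isBest_of_searchValue_eq (F := fun i => believedSignal (b i) (o i)) (τ.nonneg o)
    (τ.sum_eq_one o) h.cost_pos (fun i => h.gain_reservationUtility (b i) (o i)) ?_ hl ha
  intro l hl x
  refine le_antisymm (h.consumerPayoff_le τ o hl x) ?_
  rw [← h.consumerPayoff_indexStrategy hb o hl]
  exact hτ o l hl x _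

end Rational

/-! ### Demand -/

section Demand

variable {n : ℕ} (p : Fin n → ℝ≥0) (r : Fin n → ℝ)

/-- The surplus at each firm capped by its reservation utility. -/
def effectiveSurplus (x : Fin n → unitInterval) : Fin n → ℝ :=
  fun j => min ((x j : ℝ) - p j) (r j)

/-- The histories that arise from visiting firms in the order of their reservation utilities, and
only while no visited firm offers more than that. -/
def ReachedByIndex (l : List (Fin n)) (x : Fin n → unitInterval) : Prop :=
  ∀ a ∈ l, 0 ≤ r a ∧ (∀ j ∈ l, min ((x j : ℝ) - p j) (r j) ≤ r a) ∧ ∀ j ∉ l, r j ≤ r a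

variable {p r}

/-- The newly opened firm had the largest index, so `r i` dominates the visited surpluses and the
remaining reservation utilities. For an earlier firm `a`, the new capped surplus is at most `r i ≤ r
a`, as `i` was unvisited. -/
lemma ReachedByIndex.cons {l : List (Fin n)} {x : Fin n → unitInterval}
    (h : ReachedByIndex p r l x) {i : Fin n} (hi : i ∉ l)
    (hb : IsBest (score p r l x) (some i)) (y : unitInterval) :
    ReachedByIndex p r (i :: l) (Function.update x i y) := by
  have hs : ∀ a, optVal (score p r l x) a ≤ r i := fun a => by
    simpa [score, hi] using hb a
  have hne : ∀ j ∈ l, j ≠ i := fun j hj hji => hi (hji ▸ hj)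
  intro a ha
  rcases List.mem_cons.1 ha with rfl | ha
  · refine ⟨hs none, fun j hj => ?_, fun j hj => ?_⟩
    · rcases List.mem_cons.1 hj with rfl | hj
      · exact min_le_right _ _
      · have := hs (some j)
        simp only [optVal_some, score, hj, if_true] at this
        rw [Function.update_of_ne (hne j hj)]
        exact min_le_of_left_le this
    · have hj' : j ∉ l := fun h => hj (List.mem_cons_of_mem _ h)
      simpa [score, hj'] using hs (some j)
  · obtain ⟨h1, h2, h3⟩ := h a ha
    refine ⟨h1, fun j hj => ?_, fun j hj => h3 j fun h => hj (List.mem_cons_of_mem _ h)⟩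
    rcases List.mem_cons.1 hj with rfl | hj
    · exact min_le_of_right_le (h3 _ hi)
    · rw [Function.update_of_ne (hne j hj)]
      exact h2 j hj

/-- Where the search ends is already optimal for the effective surpluses, whatever the unseen
posteriors `y`: both the realized surplus of the chosen firm and its reservation utility dominate
all of them, hence so does their minimum. -/
lemma ReachedByIndex.isBest {l : List (Fin n)} {x : Fin n → unitInterval}
    (h : ReachedByIndex p r l x) {a : Option (Fin n)} (ha : ∀ i, a = some i → i ∈ l)
    (hb : IsBest (score p r l x) a) (y : Fin n → unitInterval) :
    IsBest (effectiveSurplus p r (merge l x y)) a := by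
  have key : ∀ a', optVal (effectiveSurplus p r (merge l x y)) a'
      ≤ optVal (score p r l x) a' := fun a' => by
    cases a' with
    | none => exact le_rfl
    | some j =>
      by_cases hj : j ∈ l
      · simp [effectiveSurplus, score, merge, hj]
      · simp [effectiveSurplus, score, hj]
  cases a with
  | none => exact fun a' => (key a').trans (hb a')
  | some i =>
    have hi := ha i rfl
    obtain ⟨h1, h2, h3⟩ := h i hi
    intro a'
    have h4 : optVal (effectiveSurplus p r (merge l x y)) a' ≤ (x i : ℝ) - p i := by
      simpa [score, hi] using (key a').trans (hb a')
    have h5 : optVal (effectiveSurplus p r (merge l x y)) a' ≤ r i := by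
      cases a' with
      | none => exact h1
      | some j =>
        by_cases hj : j ∈ l
        · simpa [effectiveSurplus, merge, hj] using h2 j hj
        · simpa [effectiveSurplus] using Or.inr (h3 j hj)
    simpa [effectiveSurplus, merge, hi] using And.intro h4 h5

lemma measurable_effectiveSurplus : Measurable (effectiveSurplus p r) :=
  (continuous_pi fun j => by unfold effectiveSurplus; fun_prop :
    Continuous (effectiveSurplus p r)).measurable

lemma measurableSet_exists_isBest (T : Set (Option (Fin n))) :
    MeasurableSet {y : Fin n → unitInterval | ∃ a ∈ T, IsBest (effectiveSurplus p r y) a} := by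
  have : {y : Fin n → unitInterval | ∃ a ∈ T, IsBest (effectiveSurplus p r y) a}
      = ⋃ a ∈ T, effectiveSurplus p r ⁻¹' {v | IsBest v a} := by
    ext y; simp
  rw [this]
  exact MeasurableSet.biUnion (Set.to_countable T) fun a _ =>
    measurable_effectiveSurplus (measurableSet_isBest a)

variable (F : Fin n → Measure unitInterval) [∀ i, IsProbabilityMeasure (F i)]

lemma measureReal_pi_eq_integral (i : Fin n) {A : Set (Fin n → unitInterval)}
    (hA : MeasurableSet A) :
    Integrable (fun y => (Measure.pi F).real {x | Function.update x i y ∈ A}) (F i) ∧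
    ∫ y, (Measure.pi F).real {x | Function.update x i y ∈ A} ∂(F i) = (Measure.pi F).real A := by
  have hmp := measurePreserving_update F i
  have hA' := hmp.measurable hA
  have hm := measurable_measure_prodMk_left (ν := Measure.pi F) hA'
  constructor
  · refine Integrable.of_bound hm.ennreal_toReal.aestronglyMeasurable 1
      (Filter.Eventually.of_forall fun y => ?_)
    rw [Real.norm_of_nonneg measureReal_nonneg]
    exact measureReal_le_one
  · rw [measureReal_def, ← hmp.measure_preimage hA.nullMeasurableSet, Measure.prod_apply hA',
      ← integral_toReal hm.aemeasurable (Filter.Eventually.of_forall fun y => measure_lt_top _ _)]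
    rfl

variable {q : List (Fin n) → (Fin n → unitInterval) → Option (Fin n) → ℝ}

open Classical in
/-- The reward `1` for ending the search with an option in `T`. -/
def reward (T : Set (Option (Fin n))) (a : Option (Fin n)) (_ : Fin n → unitInterval) : ℝ :=
  if a ∈ T then 1 else 0

lemma reward_nonneg (T : Set (Option (Fin n))) (a : Option (Fin n)) (x : Fin n → unitInterval) :
    0 ≤ reward T a x := by unfold reward; split_ifs <;> norm_num

lemma reward_le_one (T : Set (Option (Fin n))) (a : Option (Fin n)) (x : Fin n → unitInterval) :
    reward T a x ≤ 1 := by unfold reward; split_ifs <;> norm_num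

variable {F} in
lemma reward_le_measureReal {l : List (Fin n)} {x : Fin n → unitInterval}
    (h : ReachedByIndex p r l x) {a : Option (Fin n)} (ha : ∀ i, a = some i → i ∈ l)
    (hb : IsBest (score p r l x) a) (T : Set (Option (Fin n))) :
    reward T a x ≤ (Measure.pi F).real
      {y | ∃ a ∈ T, IsBest (effectiveSurplus p r (merge l x y)) a} := by
  unfold reward
  split_ifs with haT
  · have : {y | ∃ a ∈ T, IsBest (effectiveSurplus p r (merge l x y)) a} = Set.univ :=
      Set.eq_univ_of_forall fun y => ⟨a, haT, h.isBest ha hb y⟩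
    rw [this, probReal_univ]
  · exact measureReal_nonneg

/-- Induction on the unvisited firms. When the search ends in `T`, the event on the right is
certain; when a firm is opened, both sides average over its posterior. A set `T` of options is
allowed because complements give the lower bound and pairs control ties. -/
lemma searchValue_reward_le (hq0 : ∀ l x a, 0 ≤ q l x a) (hq1 : ∀ l x, ∑ a, q l x a = 1)
    (hq : ∀ l : List (Fin n), l.Nodup → ∀ x a, q l x a ≠ 0 → IsBest (score p r l x) a)
    (T : Set (Option (Fin n))) (k : ℕ) :
    ∀ (l : List (Fin n)), l.Nodup → l.length + k = n → ∀ x, ReachedByIndex p r l x →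
      searchValue q F 0 (reward T) k l x ≤ (Measure.pi F).real
        {y | ∃ a ∈ T, IsBest (effectiveSurplus p r (merge l x y)) a} := by
  induction k with
  | zero =>
    intro l hl hn x hx
    rw [searchValue]
    refine (Finset.sum_le_sum fun a _ => ?_).trans_eq
      ((Finset.sum_mul _ _ _).symm.trans ((congrArg (· * _) (hq1 l x)).trans (one_mul _)))
    by_cases ha : q l x a = 0
    · simp [ha]
    exact mul_le_mul_of_nonneg_left (reward_le_measureReal hx
      (fun i _ => mem_of_nodup_of_length hl hn i) (hq l hl x a ha) T) (hq0 _ _ _)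
  | succ k ih =>
    intro l hl hn x hx
    rw [searchValue]
    refine (Finset.sum_le_sum fun a _ => ?_).trans_eq
      ((Finset.sum_mul _ _ _).symm.trans ((congrArg (· * _) (hq1 l x)).trans (one_mul _)))
    by_cases ha : q l x a = 0
    · simp [ha]
    have hb := hq l hl x a ha
    refine mul_le_mul_of_nonneg_left ?_ (hq0 _ _ _)
    cases a with
    | none => exact reward_le_measureReal hx (by simp) hb T
    | some i =>
      by_cases hi : i ∈ l
      · simp only [hi, if_true]
        exact reward_le_measureReal hx (by rintro j h; cases h; exact hi) hb T
      · simp only [hi, if_false, sub_zero]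
        have hA : MeasurableSet
            {y | ∃ a ∈ T, IsBest (effectiveSurplus p r (merge l x y)) a} :=
          (continuous_merge l x).measurable (measurableSet_exists_isBest T)
        obtain ⟨h1, h2⟩ := measureReal_pi_eq_integral F i hA
        rw [← h2]
        have hle : ∀ y, searchValue q F 0 (reward T) k (i :: l) (Function.update x i y)
            ≤ (Measure.pi F).real {z | Function.update z i y ∈
              {y | ∃ a ∈ T, IsBest (effectiveSurplus p r (merge l x y)) a}} := fun y => by
          have := ih (i :: l) (List.nodup_cons.2 ⟨hi, hl⟩) (by rw [List.length_cons]; omega) _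
            (hx.cons hi hb y)
          simp only [merge_cons_update hi] at this
          exact this
        by_cases hint : Integrable (fun y =>
            searchValue q F 0 (reward T) k (i :: l) (Function.update x i y)) (F i)
        · exact integral_mono hint h1 hle
        · rw [integral_undef hint]
          exact integral_nonneg fun y => measureReal_nonneg

lemma measurable_searchValue (hqm : ∀ l a, Measurable fun x => q l x a) (c : ℝ)
    (T : Set (Option (Fin n))) (k : ℕ) :
    ∀ l, Measurable (searchValue q F c (reward T) k l) := by
  induction k with
  | zero =>
    intro l
    exact Finset.measurable_sum _ fun a _ => (hqm l a).mul measurable_const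
  | succ k ih =>
    intro l
    refine Finset.measurable_sum _ fun a _ => (hqm l a).mul ?_
    cases a with
    | none => exact measurable_const
    | some i =>
      by_cases hi : i ∈ l
      · simp only [hi, if_true]
        exact measurable_const
      · simp only [hi, if_false]
        refine Measurable.sub_const ?_ _
        have : Measurable fun z : (Fin n → unitInterval) × unitInterval =>
            searchValue q F c (reward T) k (i :: l) (Function.update z.1 i z.2) :=
          (ih (i :: l)).comp
            (continuous_fst.update i continuous_snd : Continuous fun
              z : (Fin n → unitInterval) × unitInterval => Function.update z.1 i z.2).measurable
        exact this.stronglyMeasurable.integral_prod_right.measurable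

lemma searchValue_reward_mem (hq0 : ∀ l x a, 0 ≤ q l x a) (hq1 : ∀ l x, ∑ a, q l x a = 1)
    (T : Set (Option (Fin n))) (k : ℕ) :
    ∀ l x, searchValue q F 0 (reward T) k l x ∈ Set.Icc (0 : ℝ) 1 := by
  have aux : ∀ l x (f : Option (Fin n) → ℝ), (∀ a, f a ∈ Set.Icc (0 : ℝ) 1) →
      ∑ a, q l x a * f a ∈ Set.Icc (0 : ℝ) 1 := fun l x f hf =>
    ⟨Finset.sum_nonneg fun a _ => mul_nonneg (hq0 _ _ _) (hf a).1,
      (Finset.sum_le_sum fun a _ => mul_le_of_le_one_right (hq0 l x a) (hf a).2).trans_eq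
        (hq1 l x)⟩
  have hr : ∀ a x, reward T a x ∈ Set.Icc (0 : ℝ) 1 := fun a x =>
    ⟨reward_nonneg T a x, reward_le_one T a x⟩
  induction k with
  | zero => exact fun l x => aux l x _ fun a => hr a x
  | succ k ih =>
    intro l x
    refine aux l x _ fun a => ?_
    cases a with
    | none => exact hr _ _
    | some i =>
      by_cases hi : i ∈ l
      · simpa only [hi, if_true] using hr _ _
      · simp only [hi, if_false, sub_zero]
        refine ⟨integral_nonneg fun y => (ih _ _).1, ?_⟩
        by_cases hint : Integrable (fun y =>
            searchValue q F 0 (reward T) k (i :: l) (Function.update x i y)) (F i)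
        · exact (integral_mono hint (integrable_const 1) fun y => (ih _ _).2).trans_eq (by simp)
        · rw [integral_undef hint]; exact zero_le_one

lemma searchValue_reward_union (hq0 : ∀ l x a, 0 ≤ q l x a) (hq1 : ∀ l x, ∑ a, q l x a = 1)
    (hqm : ∀ l a, Measurable fun x => q l x a) {S T : Set (Option (Fin n))} (hST : Disjoint S T)
    (k : ℕ) : ∀ l x, searchValue q F 0 (reward (S ∪ T)) k l x
      = searchValue q F 0 (reward S) k l x + searchValue q F 0 (reward T) k l x := by
  have hr : ∀ a x, reward (S ∪ T) a x = reward S a x + reward T a x := fun a x => by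
    unfold reward
    by_cases h1 : a ∈ S
    · simp [h1, Set.disjoint_left.1 hST h1]
    · by_cases h2 : a ∈ T <;> simp [h1, h2]
  induction k with
  | zero =>
    intro l x
    simp only [searchValue, hr, mul_add, Finset.sum_add_distrib]
  | succ k ih =>
    intro l x
    simp only [searchValue, ← Finset.sum_add_distrib, ← mul_add]
    refine Finset.sum_congr rfl fun a _ => ?_
    congr 1
    cases a with
    | none => exact hr _ _
    | some i =>
      by_cases hi : i ∈ l
      · simpa only [hi, if_true] using hr _ _
      · simp only [hi, if_false, sub_zero, ih]
        have hint : ∀ T : Set (Option (Fin n)), Integrable (fun y =>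
            searchValue q F 0 (reward T) k (i :: l) (Function.update x i y)) (F i) := fun T => by
          refine Integrable.of_bound (((measurable_searchValue F hqm 0 T k (i :: l)).comp
            (measurable_update x)).aestronglyMeasurable) 1 (Filter.Eventually.of_forall fun y => ?_)
          have := searchValue_reward_mem F hq0 hq1 T k (i :: l) (Function.update x i y)
          rw [Real.norm_of_nonneg this.1]
          exact this.2
        exact integral_add (hint S) (hint T)

lemma searchValue_reward_univ (hq1 : ∀ l x, ∑ a, q l x a = 1) (k : ℕ) :
    ∀ l x, searchValue q F 0 (reward Set.univ) k l x = 1 := by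
  induction k with
  | zero =>
    intro l x
    simp [searchValue, reward, hq1]
  | succ k ih =>
    intro l x
    rw [searchValue, ← hq1 l x]
    refine Finset.sum_congr rfl fun a _ => ?_
    cases a with
    | none => simp [reward]
    | some i => simp [reward, ih]

/-- The upper bound for the complement of `{i}`, subtracted from total probability `1`. -/
lemma le_searchValue_reward (hq0 : ∀ l x a, 0 ≤ q l x a) (hq1 : ∀ l x, ∑ a, q l x a = 1)
    (hqm : ∀ l a, Measurable fun x => q l x a)
    (hq : ∀ l : List (Fin n), l.Nodup → ∀ x a, q l x a ≠ 0 → IsBest (score p r l x) a)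
    (i : Option (Fin n)) (x : Fin n → unitInterval) :
    (Measure.pi F).real {y | ∀ a, a ≠ i →
        optVal (effectiveSurplus p r y) a < optVal (effectiveSurplus p r y) i}
      ≤ searchValue q F 0 (reward {i}) n [] x := by
  have h1 := searchValue_reward_union F hq0 hq1 hqm
    (disjoint_compl_right (a := ({i} : Set (Option (Fin n))))) n [] x
  rw [Set.union_compl_self, searchValue_reward_univ F hq1] at h1
  have h2 := searchValue_reward_le F hq0 hq1 hq ({i}ᶜ) n [] List.nodup_nil (by simp) x
    (by intro a ha; simp at ha)
  have h3 : (Measure.pi F).real {y | ∀ a, a ≠ i →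
        optVal (effectiveSurplus p r y) a < optVal (effectiveSurplus p r y) i}
      ≤ (Measure.pi F).real {y | ∃ a ∈ ({i}ᶜ : Set (Option (Fin n))),
          IsBest (effectiveSurplus p r y) a}ᶜ := by
    refine measureReal_mono fun y hy => ?_
    rintro ⟨a, ha, hb⟩
    exact absurd (hb i) (not_le.2 (hy a ha))
  rw [probReal_compl_eq_one_sub (measurableSet_exists_isBest _)] at h3
  have h4 : ∀ y, merge [] x y = y := fun y => by ext; simp [merge]
  simp only [h4] at h2
  linarith

end Demand

/-! ### Products of composition products -/

section PiCompProd

open ProbabilityTheory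

variable {ι : Type*} [Fintype ι] {α β : ι → Type*} [∀ i, MeasurableSpace (α i)]
  [∀ i, MeasurableSpace (β i)]

lemma lintegral_pi_prod (σ : ∀ i, Measure (α i)) [∀ i, IsProbabilityMeasure (σ i)]
    {f : ∀ i, α i → ℝ≥0∞} (hf : ∀ i, Measurable (f i)) :
    ∫⁻ s, ∏ i, f i (s i) ∂(Measure.pi σ) = ∏ i, ∫⁻ a, f i a ∂(σ i) := by
  refine (lintegral_prod_eq_prod_lintegral_of_indepFun Finset.univ (fun i (s : ∀ i, α i) => f i (s i))
    (iIndepFun_pi fun i => (hf i).aemeasurable)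
    fun i => (hf i).comp (measurable_pi_apply i)).trans ?_
  exact Finset.prod_congr rfl fun i _ =>
    (measurePreserving_eval σ i).lintegral_comp (hf i)

omit [Fintype ι] in
lemma measurable_pi_prodMk (s : ∀ i, α i) :
    Measurable fun (x : ∀ i, β i) i => (s i, x i) :=
  measurable_pi_lambda _ fun i => measurable_const.prodMk (measurable_pi_apply i)

lemma map_pi_prodMk_univ_pi (κ : ∀ i, Kernel (α i) (β i)) [∀ i, IsMarkovKernel (κ i)]
    (s : ∀ i, α i) {B : ∀ i, Set (α i × β i)} (hB : ∀ i, MeasurableSet (B i)) :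
    ((Measure.pi fun i => κ i (s i)).map fun x i => (s i, x i)) (Set.univ.pi B)
      = ∏ i, κ i (s i) (Prod.mk (s i) ⁻¹' B i) := by
  rw [Measure.map_apply (measurable_pi_prodMk s) (MeasurableSet.univ_pi hB), ← Measure.pi_pi]
  rfl

/-- Draw the second components independently given the first ones. -/
def piKernel (κ : ∀ i, Kernel (α i) (β i)) [∀ i, IsMarkovKernel (κ i)] :
    Kernel (∀ i, α i) (∀ i, α i × β i) where
  toFun s := (Measure.pi fun i => κ i (s i)).map fun x i => (s i, x i)
  measurable' := by
    have : ∀ s : ∀ i, α i, IsProbabilityMeasure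
        ((Measure.pi fun i => κ i (s i)).map fun x i => (s i, x i)) := fun s =>
      Measure.isProbabilityMeasure_map (measurable_pi_prodMk s).aemeasurable
    refine Measurable.measure_of_isPiSystem_of_isProbabilityMeasure generateFrom_pi.symm
      isPiSystem_pi ?_
    rintro _ ⟨B, hB, rfl⟩
    have hB' : ∀ i, MeasurableSet (B i) := fun i => hB i (Set.mem_univ i)
    simp only [map_pi_prodMk_univ_pi κ _ hB']
    exact Finset.measurable_prod _ fun i _ =>
      (Kernel.measurable_kernel_prodMk_left (hB' i)).comp (measurable_pi_apply i)

lemma piKernel_apply (κ : ∀ i, Kernel (α i) (β i)) [∀ i, IsMarkovKernel (κ i)] (s : ∀ i, α i) :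
    piKernel κ s = (Measure.pi fun i => κ i (s i)).map fun x i => (s i, x i) := rfl

/-- Checked on boxes. The posteriors are independent given the actions and the actions are
independent, so the pairs of action and posterior are independent across firms. -/
lemma pi_compProd (κ : ∀ i, Kernel (α i) (β i)) [∀ i, IsMarkovKernel (κ i)]
    (σ : ∀ i, Measure (α i)) [∀ i, IsProbabilityMeasure (σ i)] :
    Measure.pi (fun i => σ i ⊗ₘ κ i) = (Measure.pi σ).bind (piKernel κ) := by
  refine Measure.pi_eq fun B hB => ?_
  rw [Measure.bind_apply (MeasurableSet.univ_pi hB) (Kernel.aemeasurable _)]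
  simp only [piKernel_apply, map_pi_prodMk_univ_pi κ _ hB]
  rw [lintegral_pi_prod σ fun i => Kernel.measurable_kernel_prodMk_left (hB i)]
  exact Finset.prod_congr rfl fun i _ => (Measure.compProd_apply (hB i)).symm

lemma lintegral_pi_compProd (κ : ∀ i, Kernel (α i) (β i)) [∀ i, IsMarkovKernel (κ i)]
    (σ : ∀ i, Measure (α i)) [∀ i, IsProbabilityMeasure (σ i)] {g : (∀ i, α i × β i) → ℝ≥0∞}
    (hg : Measurable g) :
    ∫⁻ ω, g ω ∂(Measure.pi fun i => σ i ⊗ₘ κ i)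
      = ∫⁻ s, ∫⁻ x, g (fun i => (s i, x i)) ∂(Measure.pi fun i => κ i (s i)) ∂(Measure.pi σ) := by
  rw [pi_compProd, Measure.lintegral_bind (Kernel.aemeasurable _) hg.aemeasurable]
  refine lintegral_congr fun s => ?_
  rw [piKernel_apply, lintegral_map hg (measurable_pi_prodMk s)]

end PiCompProd

/-! ### Expected profits -/

section Profit

open ProbabilityTheory

variable {n : ℕ} {μ c : ℝ}

/-- The signal as a kernel. -/
def signalKernel (μ : ℝ) : Kernel (FirmAction μ) unitInterval where
  toFun a := a.signal
  measurable' := measurable_subtype_coe.comp measurable_signal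

instance : IsMarkovKernel (signalKernel μ) := ⟨fun a => inferInstanceAs
  (IsProbabilityMeasure (a.signal : Measure unitInterval))⟩

lemma signalKernel_apply (a : FirmAction μ) :
    signalKernel μ a = (a.signal : Measure unitInterval) := rfl

/-- The joint law of the action of a firm and the posterior at that firm. -/
def outcomeLaw (σ : ProbabilityMeasure (FirmAction μ)) : Measure (FirmAction μ × unitInterval) :=
  (σ : Measure (FirmAction μ)) ⊗ₘ signalKernel μ

instance (σ : ProbabilityMeasure (FirmAction μ)) : IsProbabilityMeasure (outcomeLaw σ) :=
  inferInstanceAs (IsProbabilityMeasure (_ ⊗ₘ _))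

/-- The surplus of a firm capped by its reservation utility. -/
def firmSurplus (c : ℝ) (b : ℝ≥0 → Signal μ) (ω : FirmAction μ × unitInterval) : ℝ :=
  min ((ω.2 : ℝ) - ω.1.1) (reservationUtility c b ω.1.observe)

/-- The largest effective surplus is at firm `i`, in the sense of the relation `R`. -/
def Wins (R : ℝ → ℝ → Prop) (v : Fin n → ℝ) (i : Fin n) : Prop :=
  R 0 (v i) ∧ ∀ j, j ≠ i → R (v j) (v i)

lemma isBest_some_iff (v : Fin n → ℝ) (i : Fin n) :
    IsBest v (some i) ↔ Wins (· ≤ ·) v i := by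
  constructor
  · exact fun h => ⟨h none, fun j _ => h (some j)⟩
  · rintro ⟨h0, h⟩ a
    cases a with
    | none => exact h0
    | some j =>
      by_cases hj : j = i
      · rw [hj]
      · exact h j hj

lemma strict_some_iff (v : Fin n → ℝ) (i : Fin n) :
    (∀ a, a ≠ some i → optVal v a < optVal v (some i)) ↔ Wins (· < ·) v i := by
  constructor
  · exact fun h => ⟨h none (by simp), fun j hj => h (some j) (by simpa using hj)⟩
  · rintro ⟨h0, h⟩ a ha
    cases a with
    | none => exact h0
    | some j => exact h j (by simpa using ha)

/-- The effective surpluses when the actions are `s` and the posteriors are `x`. -/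
def surpluses (c : ℝ) (b : Fin n → ℝ≥0 → Signal μ)
    (ω : Fin n → FirmAction μ × unitInterval) : Fin n → ℝ :=
  fun j => firmSurplus c (b j) (ω j)

/-- The law of the posteriors given the actions. -/
abbrev posteriorLaw (s : Fin n → FirmAction μ) : Measure (Fin n → unitInterval) :=
  Measure.pi fun j => ((s j).signal : Measure unitInterval)

lemma purchaseProb_eq (τ : SearchStrategy n μ) (s : Fin n → FirmAction μ) (i : Fin n) :
    purchaseProb τ s i = searchValue (τ.prob fun j => (s j).observe)
      (fun j => ((s j).signal : Measure unitInterval)) 0 (reward {some i}) n [] (fun _ => 0) := by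
  unfold purchaseProb reward
  congr 1
  funext a _
  by_cases ha : a = some i <;> simp [ha]

lemma SearchStrategy.measurable_prob (τ : SearchStrategy n μ) (o : Fin n → Observation μ)
    (l : List (Fin n)) (a : Option (Fin n)) : Measurable fun x => τ.prob o l x a :=
  (τ.measurable l a).comp measurable_prodMk_left

variable (h : Params μ c) {b : Fin n → ℝ≥0 → Signal μ} (hb : ∀ i, Measurable (b i))
  {τ : SearchStrategy n μ} (hτ : SequentiallyRational c b τ)

include h in
lemma Params.measurable_firmSurplus {b : ℝ≥0 → Signal μ} (hb : Measurable b) :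
    Measurable (firmSurplus c b) := by
  unfold firmSurplus
  refine Measurable.min ?_ ((h.measurable_reservationUtility hb).comp
    (measurable_observe.comp measurable_fst))
  exact (measurable_subtype_coe.comp measurable_snd).sub
    (measurable_coe_nnreal_real.comp (measurable_fst.comp measurable_fst))

include h hb hτ

lemma Params.purchaseProb_le (s : Fin n → FirmAction μ) (i : Fin n) :
    purchaseProb τ s i ≤ (posteriorLaw s).real
      {x | Wins (· ≤ ·) (surpluses c b fun j => (s j, x j)) i} := by
  rw [purchaseProb_eq]
  have := searchValue_reward_le (fun j => ((s j).signal : Measure unitInterval)) (τ.nonneg fun j => (s j).observe)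
    (τ.sum_eq_one _) (fun l hl x a ha => h.isBest_of_sequentiallyRational hb hτ _ hl ha) {some i} n
    [] List.nodup_nil (by simp) (fun _ => 0) (by intro a ha; simp at ha)
  simp only [Set.mem_singleton_iff, exists_eq_left, isBest_some_iff] at this
  exact this

/-- Two firms cannot both sell, so jointly they get at most the union of their weak wins; this is
what limits their gains from ties. -/
lemma Params.purchaseProb_add_le (s : Fin n → FirmAction μ) {i j : Fin n} (hij : i ≠ j) :
    purchaseProb τ s i + purchaseProb τ s j ≤ (posteriorLaw s).real
      ({x | Wins (· ≤ ·) (surpluses c b fun j => (s j, x j)) i} ∪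
        {x | Wins (· ≤ ·) (surpluses c b fun j => (s j, x j)) j}) := by
  rw [purchaseProb_eq, purchaseProb_eq, ← searchValue_reward_union _ (τ.nonneg _)
    (τ.sum_eq_one _) (τ.measurable_prob _) (by simpa using hij)]
  have := searchValue_reward_le (fun j => ((s j).signal : Measure unitInterval)) (τ.nonneg fun j => (s j).observe)
    (τ.sum_eq_one _) (fun l hl x a ha => h.isBest_of_sequentiallyRational hb hτ _ hl ha)
    ({some i} ∪ {some j}) n
    [] List.nodup_nil (by simp) (fun _ => 0) (by intro a ha; simp at ha)
  refine this.trans_eq ?_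
  congr 1
  ext x
  simp only [Set.mem_union, Set.mem_singleton_iff, Set.mem_ofPred_eq, exists_eq_or_imp,
    exists_eq_left, isBest_some_iff]
  rfl

lemma Params.le_purchaseProb (s : Fin n → FirmAction μ) (i : Fin n) :
    (posteriorLaw s).real {x | Wins (· < ·) (surpluses c b fun j => (s j, x j)) i}
      ≤ purchaseProb τ s i := by
  rw [purchaseProb_eq]
  have := le_searchValue_reward (fun j => ((s j).signal : Measure unitInterval)) (τ.nonneg fun j => (s j).observe)
    (τ.sum_eq_one _) (τ.measurable_prob _)
    (fun l hl x a ha => h.isBest_of_sequentiallyRational hb hτ _ hl ha) (some i) (fun _ => 0)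
  simp only [strict_some_iff] at this
  exact this

omit hτ

lemma Params.measurableSet_wins {R : ℝ → ℝ → Prop}
    (hR : MeasurableSet {q : ℝ × ℝ | R q.1 q.2}) (i : Fin n) :
    MeasurableSet {ω | Wins R (surpluses c b ω) i} := by
  have hm : ∀ j, Measurable fun ω : Fin n → FirmAction μ × unitInterval => surpluses c b ω j :=
    fun j => (h.measurable_firmSurplus (hb j)).comp (measurable_pi_apply j)
  have : {ω | Wins R (surpluses c b ω) i}
      = {ω | R 0 (surpluses c b ω i)} ∩
        ⋂ (j) (_ : j ≠ i), {ω | R (surpluses c b ω j) (surpluses c b ω i)} := by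
    ext ω
    simp [Wins]
  rw [this]
  refine MeasurableSet.inter ((measurable_const.prodMk (hm i)) hR) ?_
  exact MeasurableSet.iInter fun j => MeasurableSet.iInter fun _ => ((hm j).prodMk (hm i)) hR

omit h hb

/-- The probability that all firms but `i` have an effective surplus below `t`, in the sense of the
relation `R`. -/
def winProb (c : ℝ) (b : Fin n → ℝ≥0 → Signal μ) (R : ℝ → ℝ → Prop)
    (σ : ProbabilityMeasure (FirmAction μ)) (i : Fin n) (t : ℝ) : ℝ≥0∞ :=
  ∏ j ∈ Finset.univ.erase i, outcomeLaw σ {ω | R (firmSurplus c (b j) ω) t}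

open Classical in
/-- The revenue from the outcome `ω` of firm `i` when it sells if its effective surplus exceeds `0`
and those of the other firms in the sense of the relation `R`. -/
def revenue (c : ℝ) (b : Fin n → ℝ≥0 → Signal μ) (R : ℝ → ℝ → Prop)
    (σ : ProbabilityMeasure (FirmAction μ)) (i : Fin n) (ω : FirmAction μ × unitInterval) : ℝ≥0∞ :=
  if R 0 (firmSurplus c (b i) ω) then
    ENNReal.ofReal ω.1.1 * winProb c b R σ i (firmSurplus c (b i) ω) else 0

include h hb

/-- Conditioning on the outcome of firm `i`, the event that it wins is a box in the independent
outcomes of the rivals, so its probability is the product `winProb`. -/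
lemma Params.lintegral_wins {R : ℝ → ℝ → Prop} (hR : MeasurableSet {q : ℝ × ℝ | R q.1 q.2})
    (σ σ' : ProbabilityMeasure (FirmAction μ)) (i : Fin n) :
    ∫⁻ s, ENNReal.ofReal (s i).1 * posteriorLaw s
        {x | Wins R (surpluses c b fun j => (s j, x j)) i}
        ∂(Measure.pi fun j => (Function.update (fun _ => σ) i σ' j : Measure (FirmAction μ)))
      = ∫⁻ ω, revenue c b R σ i ω ∂(outcomeLaw σ') := by
  classical
  have hA := h.measurableSet_wins hb hR i
  set A := {ω | Wins R (surpluses c b ω) i} with hAd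
  have hp : Measurable fun a : FirmAction μ => ENNReal.ofReal (a.1 : ℝ) :=
    ENNReal.measurable_ofReal.comp (measurable_coe_nnreal_real.comp measurable_fst)
  have hg : Measurable fun ω : Fin n → FirmAction μ × unitInterval =>
      ENNReal.ofReal ((ω i).1.1 : ℝ) * A.indicator (fun _ => (1 : ℝ≥0∞)) ω :=
    (hp.comp (measurable_fst.comp (measurable_pi_apply i))).mul
      (measurable_const.indicator hA)
  have h1 := lintegral_pi_compProd (fun _ : Fin n => signalKernel μ)
    (fun j => (Function.update (fun _ => σ) i σ' j : Measure (FirmAction μ))) hg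
  have h2 : ∀ s : Fin n → FirmAction μ,
      ∫⁻ x, ENNReal.ofReal ((s i).1 : ℝ) * A.indicator (fun _ => (1 : ℝ≥0∞)) (fun i => (s i, x i))
        ∂(Measure.pi fun j => signalKernel μ (s j))
      = ENNReal.ofReal (s i).1 * posteriorLaw s
        {x : Fin n → unitInterval | Wins R (surpluses c b fun j => (s j, x j)) i} := by
    intro s
    have hm : MeasurableSet {x : Fin n → unitInterval | Wins R (surpluses c b fun j => (s j, x j)) i} :=
      measurable_pi_prodMk s hA
    rw [lintegral_const_mul' _ _ ENNReal.ofReal_ne_top, ← lintegral_indicator_one hm]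
    rfl
  simp only [h2] at h1
  rw [← h1, lintegral_pi_eq_update _ i hg, Function.update_self]
  change _ = ∫⁻ ω, revenue c b R σ i ω ∂((σ' : Measure (FirmAction μ)) ⊗ₘ signalKernel μ)
  refine lintegral_congr fun y => ?_
  simp only [Function.update_self]
  rw [lintegral_const_mul' _ _ ENNReal.ofReal_ne_top]
  unfold revenue
  have hset : ∀ ω : Fin n → FirmAction μ × unitInterval,
      Function.update ω i y ∈ A ↔ R 0 (firmSurplus c (b i) y) ∧
        ω ∈ Set.univ.pi fun j =>
          if j = i then Set.univ else {z | R (firmSurplus c (b j) z) (firmSurplus c (b i) y)} := by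
    intro ω
    simp only [hAd, Wins, surpluses, Set.mem_ofPred_eq, Function.update_self, Set.mem_pi,
      Set.mem_univ, true_implies]
    refine and_congr_right fun _ => forall_congr' fun j => ?_
    by_cases hj : j = i
    · simp [hj]
    · simp [hj]
  have hind : ∀ ω : Fin n → FirmAction μ × unitInterval, A.indicator (fun _ => (1 : ℝ≥0∞))
      (Function.update ω i y) = if R 0 (firmSurplus c (b i) y) then
        (Set.univ.pi fun j => if j = i then Set.univ else
          {z | R (firmSurplus c (b j) z) (firmSurplus c (b i) y)}).indicator (fun _ => (1 : ℝ≥0∞)) ω else 0 := by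
    intro ω
    simp only [Set.indicator_apply, hset]
    by_cases hR0 : R 0 (firmSurplus c (b i) y) <;> simp [hR0]
  simp only [hind]
  split_ifs with hR0
  · rw [lintegral_indicator_const _ 1, one_mul]
    · rw [Measure.pi_pi, winProb, ← Finset.mul_prod_erase Finset.univ _ (Finset.mem_univ i)]
      simp only [if_true, measure_univ, one_mul]
      congr 1
      refine Finset.prod_congr rfl fun j hj => ?_
      have hj := Finset.ne_of_mem_erase hj
      rw [Function.update_of_ne hj, if_neg hj]
      rfl
    · refine MeasurableSet.univ_pi fun j => ?_
      split_ifs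
      · exact MeasurableSet.univ
      · exact ((h.measurable_firmSurplus (hb j)).prodMk measurable_const) hR
  · simp

omit h hb in
lemma measurableSet_rel_le : MeasurableSet {q : ℝ × ℝ | q.1 ≤ q.2} :=
  measurableSet_le measurable_fst measurable_snd

omit h hb in
lemma measurableSet_rel_lt : MeasurableSet {q : ℝ × ℝ | q.1 < q.2} :=
  measurableSet_lt measurable_fst measurable_snd

omit h hb in
lemma ofReal_mul_measureReal (s : Fin n → FirmAction μ) (i : Fin n)
    (A : Set (Fin n → unitInterval)) :
    ENNReal.ofReal (((s i).1 : ℝ) * (posteriorLaw s).real A)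
      = ENNReal.ofReal (s i).1 * posteriorLaw s A := by
  rw [ENNReal.ofReal_mul (NNReal.coe_nonneg _), ofReal_measureReal]

include hτ

lemma Params.expectedProfit_le (σ σ' : ProbabilityMeasure (FirmAction μ)) (i : Fin n) :
    expectedProfit τ (Function.update (fun _ => σ) i σ') i
      ≤ ∫⁻ ω, revenue c b (· ≤ ·) σ i ω ∂(outcomeLaw σ') := by
  rw [← h.lintegral_wins hb measurableSet_rel_le σ σ' i]
  refine lintegral_mono fun s => ?_
  rw [← ofReal_mul_measureReal]
  exact ENNReal.ofReal_le_ofReal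
    (mul_le_mul_of_nonneg_left (h.purchaseProb_le hb hτ s i) (NNReal.coe_nonneg _))

lemma Params.le_expectedProfit (σ σ' : ProbabilityMeasure (FirmAction μ)) (i : Fin n) :
    ∫⁻ ω, revenue c b (· < ·) σ i ω ∂(outcomeLaw σ')
      ≤ expectedProfit τ (Function.update (fun _ => σ) i σ') i := by
  rw [← h.lintegral_wins hb measurableSet_rel_lt σ σ' i]
  refine lintegral_mono fun s => ?_
  rw [← ofReal_mul_measureReal]
  exact ENNReal.ofReal_le_ofReal
    (mul_le_mul_of_nonneg_left (h.le_purchaseProb hb hτ s i) (NNReal.coe_nonneg _))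

/-- If both firms earn as much as if they won all ties, then no ties between them occur. -/
lemma Params.pi_both_win_eq_zero {σ : ProbabilityMeasure (FirmAction μ)}
    (hpos : ∀ᵐ a ∂(σ : Measure (FirmAction μ)), 0 < a.1)
    (hfin : ∀ i, expectedProfit τ (fun _ => σ) i ≠ ∞)
    (hmax : ∀ i, ∫⁻ ω, revenue c b (· ≤ ·) σ i ω ∂(outcomeLaw σ)
      ≤ expectedProfit τ (fun _ => σ) i) {i j : Fin n} (hij : i ≠ j) :
    Measure.pi (fun _ : Fin n => outcomeLaw σ)
      ({ω | Wins (· ≤ ·) (surpluses c b ω) i} ∩ {ω | Wins (· ≤ ·) (surpluses c b ω) j}) = 0 := by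
  have hA : ∀ i, MeasurableSet {ω | Wins (· ≤ ·) (surpluses c b ω) i} :=
    h.measurableSet_wins hb measurableSet_rel_le
  have hAs : ∀ (s : Fin n → FirmAction μ) i, MeasurableSet
      {x : Fin n → unitInterval | Wins (· ≤ ·) (surpluses c b fun j => (s j, x j)) i} := fun s i =>
    measurable_pi_prodMk s (hA i)
  have hkey : ∀ i, ∀ᵐ s ∂(Measure.pi fun _ : Fin n => (σ : Measure (FirmAction μ))),
      purchaseProb τ s i = (posteriorLaw s).real
        {x | Wins (· ≤ ·) (surpluses c b fun j => (s j, x j)) i} := by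
    intro i
    have hint := h.lintegral_wins hb measurableSet_rel_le σ σ i
    rw [Function.update_eq_self] at hint
    have hmeas : Measurable fun s : Fin n → FirmAction μ => ENNReal.ofReal (s i).1 * posteriorLaw s
        {x | Wins (· ≤ ·) (surpluses c b fun j => (s j, x j)) i} := by
      refine Measurable.mul (ENNReal.measurable_ofReal.comp (measurable_coe_nnreal_real.comp
        (measurable_fst.comp (measurable_pi_apply i)))) ?_
      convert (piKernel fun _ : Fin n => signalKernel μ).measurable_coe (hA i) using 2 with s
      rw [piKernel_apply, Measure.map_apply (measurable_pi_prodMk s) (hA i)]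
      rfl
    have hae := ae_eq_of_ae_le_of_lintegral_le (Filter.Eventually.of_forall fun s => ?_) (hfin i)
      hmeas.aemeasurable (hint.le.trans (hmax i))
    · have hpos' : ∀ᵐ s ∂(Measure.pi fun _ : Fin n => (σ : Measure (FirmAction μ))),
          0 < (s i).1 :=
        (Measure.quasiMeasurePreserving_eval
          (fun _ : Fin n => (σ : Measure (FirmAction μ))) i).ae hpos
      filter_upwards [hae, hpos'] with s hs hp
      rw [← ofReal_mul_measureReal, ENNReal.ofReal_eq_ofReal_iff _
        (mul_nonneg (NNReal.coe_nonneg _) measureReal_nonneg)] at hs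
      · exact mul_left_cancel₀ (NNReal.coe_pos.2 hp).ne' hs
      · refine mul_nonneg (NNReal.coe_nonneg _) ?_
        exact measureReal_nonneg.trans (h.le_purchaseProb hb hτ s i)
    · rw [← ofReal_mul_measureReal]
      exact ENNReal.ofReal_le_ofReal
        (mul_le_mul_of_nonneg_left (h.purchaseProb_le hb hτ s i) (NNReal.coe_nonneg _))
  have hboth : ∀ᵐ s ∂(Measure.pi fun _ : Fin n => (σ : Measure (FirmAction μ))),
      piKernel (fun _ : Fin n => signalKernel μ) s
      ({ω | Wins (· ≤ ·) (surpluses c b ω) i} ∩ {ω | Wins (· ≤ ·) (surpluses c b ω) j}) = 0 := by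
    filter_upwards [hkey i, hkey j] with s hi hj
    -- Each firm sells with the full probability of its weak win, yet the sum is at most the
    -- probability of the union. Inclusion and exclusion leaves nothing for the intersection.
    have h1 := h.purchaseProb_add_le hb hτ s hij
    have h2 := measureReal_union_add_inter (μ := posteriorLaw s)
      (s := {x : Fin n → unitInterval | Wins (· ≤ ·) (surpluses c b fun j => (s j, x j)) i})
      (hAs s j)
    rw [piKernel_apply, Measure.map_apply (measurable_pi_prodMk s) ((hA i).inter (hA j))]
    have h3 : (posteriorLaw s).real
        ({x | Wins (· ≤ ·) (surpluses c b fun j => (s j, x j)) i} ∩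
        {x | Wins (· ≤ ·) (surpluses c b fun j => (s j, x j)) j}) = 0 :=
      le_antisymm (by linarith) measureReal_nonneg
    exact (measureReal_eq_zero_iff).1 h3
  change Measure.pi (fun _ : Fin n => (σ : Measure (FirmAction μ)) ⊗ₘ signalKernel μ) _ = 0
  rw [pi_compProd, Measure.bind_apply ((hA i).inter (hA j)) (Kernel.aemeasurable _),
    lintegral_congr_ae hboth]
  simp

end Profit

/-! ### A bound on the revenue -/

section Bound

open ProbabilityTheory

variable {n : ℕ} {μ c : ℝ}

/-- The posterior capped by the reservation value. -/
def cappedPosterior (c : ℝ) (b : ℝ≥0 → Signal μ) (ω : FirmAction μ × unitInterval) : ℝ :=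
  min (ω.2 : ℝ) (reservation c (believedSignal b ω.1.observe))

lemma firmSurplus_eq (b : ℝ≥0 → Signal μ) (ω : FirmAction μ × unitInterval) :
    firmSurplus c b ω = cappedPosterior c b ω - ω.1.1 :=
  min_sub_sub_right _ _ _

variable (h : Params μ c)
include h

lemma Params.cappedPosterior_mem (b : ℝ≥0 → Signal μ) (ω : FirmAction μ × unitInterval) :
    cappedPosterior c b ω ∈ Set.Icc 0 (priceCap μ c) :=
  ⟨le_min ω.2.2.1 (h.reservation_pos _).le, min_le_of_right_le (h.reservation_mem _).2⟩

lemma Params.measurable_cappedPosterior {b : ℝ≥0 → Signal μ} (hb : Measurable b) :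
    Measurable (cappedPosterior c b) :=
  (measurable_subtype_coe.comp measurable_snd).min
    (h.measurable_reservation.comp ((measurable_believedSignal hb).comp
      (measurable_observe.comp measurable_fst)))

omit h in
-- After clearing denominators this is `0 ≤ K (w - p) (U - w)`; so for `K > 0` equality means `p =
-- w` or `w = U`.
lemma mul_div_le_of_le {p U w K : ℝ} (hp : 0 < p) (hpw : p ≤ w) (hwU : w ≤ U) (hK : 0 ≤ K) :
    p * (K / (U - (w - p))) ≤ K / U * w := by
  have hU : 0 < U := by linarith
  rw [mul_div_assoc', div_mul_eq_mul_div, div_le_div_iff₀ (by linarith) hU]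
  nlinarith [mul_nonneg hK (mul_nonneg (sub_nonneg.2 hpw) (sub_nonneg.2 hwU))]

/-- The bound is linear in the capped posterior and does not involve the price, so its expectation
depends only on the mean of the capped posterior. -/
lemma Params.revenue_le {b : Fin n → ℝ≥0 → Signal μ} {σ : ProbabilityMeasure (FirmAction μ)}
    {i : Fin n} {K : ℝ} (hK : 0 ≤ K)
    (hwin : ∀ t, 0 ≤ t → t < priceCap μ c →
      winProb c b (· ≤ ·) σ i t ≤ ENNReal.ofReal (K / (priceCap μ c - t)))
    (ω : FirmAction μ × unitInterval) :
    revenue c b (· ≤ ·) σ i ω ≤ ENNReal.ofReal (K / priceCap μ c * cappedPosterior c (b i) ω) := by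
  unfold revenue
  split_ifs with h0
  · rw [firmSurplus_eq] at h0 ⊢
    obtain ⟨hw0, hwU⟩ := h.cappedPosterior_mem (b i) ω
    rcases (NNReal.coe_nonneg ω.1.1).eq_or_lt with hp | hp
    · simp [← hp]
    refine (mul_le_mul_right (hwin _ h0 (by linarith)) _).trans ?_
    rw [← ENNReal.ofReal_mul hp.le]
    exact ENNReal.ofReal_le_ofReal (mul_div_le_of_le hp (by linarith) hwU hK)
  · exact zero_le

lemma Params.of_revenue_eq {b : Fin n → ℝ≥0 → Signal μ} {σ : ProbabilityMeasure (FirmAction μ)}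
    {i : Fin n} {K : ℝ} (hK : 0 < K)
    (hwin : ∀ t, 0 ≤ t → t < priceCap μ c →
      winProb c b (· ≤ ·) σ i t ≤ ENNReal.ofReal (K / (priceCap μ c - t)))
    {ω : FirmAction μ × unitInterval} (hω : 0 < cappedPosterior c (b i) ω)
    (heq : revenue c b (· ≤ ·) σ i ω
      = ENNReal.ofReal (K / priceCap μ c * cappedPosterior c (b i) ω)) :
    0 < (ω.1.1 : ℝ) ∧ 0 ≤ firmSurplus c (b i) ω ∧
      (firmSurplus c (b i) ω = 0 ∨ cappedPosterior c (b i) ω = priceCap μ c) ∧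
      winProb c b (· ≤ ·) σ i (firmSurplus c (b i) ω)
        = ENNReal.ofReal (K / (priceCap μ c - firmSurplus c (b i) ω)) := by
  have hU := h.priceCap_pos
  have hpos : 0 < ENNReal.ofReal (K / priceCap μ c * cappedPosterior c (b i) ω) :=
    ENNReal.ofReal_pos.2 (by positivity)
  rw [← heq] at hpos
  unfold revenue at hpos heq
  split_ifs at hpos heq with h0
  · obtain ⟨hw0, hwU⟩ := h.cappedPosterior_mem (b i) ω
    have hp : 0 < (ω.1.1 : ℝ) := by
      refine (NNReal.coe_nonneg ω.1.1).lt_of_ne fun hp => ?_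
      simp [← hp] at hpos
    have hs := firmSurplus_eq (c := c) (b i) ω
    set t := firmSurplus c (b i) ω
    set w := cappedPosterior c (b i) ω
    have hwt := hwin t h0 (by linarith)
    have h1 : ENNReal.ofReal (K / priceCap μ c * w)
        ≤ ENNReal.ofReal (ω.1.1 * (K / (priceCap μ c - t))) := by
      rw [← heq, ENNReal.ofReal_mul hp.le]
      exact mul_le_mul_right hwt _
    have h2 : 0 ≤ ω.1.1 * (K / (priceCap μ c - t)) :=
      mul_nonneg hp.le (div_nonneg hK.le (by linarith))
    rw [ENNReal.ofReal_le_ofReal_iff h2] at h1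
    have h3 : K / priceCap μ c * w = ω.1.1 * (K / (priceCap μ c - t)) := by
      refine le_antisymm h1 ?_
      rw [hs]
      exact mul_div_le_of_le hp (by linarith) hwU hK.le
    refine ⟨hp, h0, ?_, ?_⟩
    · rw [mul_div_assoc', div_mul_eq_mul_div, div_eq_div_iff hU.ne' (by linarith), hs] at h3
      have h4 : K * ((w - ω.1.1) * (priceCap μ c - w)) = 0 := by linear_combination h3
      rcases mul_eq_zero.1 h4 with h5 | h5
      · exact absurd h5 hK.ne'
      · rcases mul_eq_zero.1 h5 with h6 | h6
        · left; linarith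
        · right; linarith
    · rw [h3, ENNReal.ofReal_mul hp.le] at heq
      exact (ENNReal.mul_right_inj (ENNReal.ofReal_pos.2 hp).ne' ENNReal.ofReal_ne_top).1 heq
  · exact absurd hpos (lt_irrefl _)

end Bound

/-! ### Firms that post full information -/

section FullInformation

open ProbabilityTheory

variable {n : ℕ} {μ c : ℝ}

/-- Full information is posted almost surely. -/
def PostsFullSignal (σ : ProbabilityMeasure (FirmAction μ)) : Prop :=
  ∀ᵐ a ∂(σ : Measure (FirmAction μ)),
    ∃ F : Signal μ, a.2 = Sum.inl F ∧ (F : Measure unitInterval) = fullInformation μ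

variable (h : Params μ c)
include h

lemma Params.reservation_fullInformation : reservation c (fullInformation μ) = priceCap μ c := by
  rw [← h.reservation_fullSignal, fullSignal_coe]

lemma Params.cappedPosterior_full (b : ℝ≥0 → Signal μ) {a : FirmAction μ} {F : Signal μ}
    (ha : a.2 = Sum.inl F) (hF : (F : Measure unitInterval) = fullInformation μ)
    (x : unitInterval) : cappedPosterior c b (a, x) = min (x : ℝ) (priceCap μ c) := by
  rw [← h.reservation_fullInformation, ← hF]
  simp [cappedPosterior, believedSignal, FirmAction.observe, ha]

omit h in
lemma signal_of_posted {a : FirmAction μ} {F : Signal μ} (ha : a.2 = Sum.inl F) :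
    a.signal = F := by
  simp [FirmAction.signal, ha]

/-- Under full information the effective surplus is `-p` with probability `1 - μ` and `priceCap - p`
with probability `μ`; by `ht` the first value never stands in the way. -/
lemma Params.outcomeLaw_rel {R : ℝ → ℝ → Prop} (hR : MeasurableSet {q : ℝ × ℝ | R q.1 q.2})
    {b : ℝ≥0 → Signal μ} (hb : Measurable b) {σ : ProbabilityMeasure (FirmAction μ)}
    (hσ : PostsFullSignal σ) {t : ℝ}
    (ht : ∀ᵐ a ∂(σ : Measure (FirmAction μ)), R (-(a.1 : ℝ)) t) :
    outcomeLaw σ {ω | R (firmSurplus c b ω) t} = ENNReal.ofReal (1 - μ)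
      + ENNReal.ofReal μ * (σ : Measure (FirmAction μ)) {a | R (priceCap μ c - a.1) t} := by
  have hm : MeasurableSet {ω | R (firmSurplus c b ω) t} :=
    ((h.measurable_firmSurplus hb).prodMk measurable_const) hR
  have hm' : MeasurableSet {a : FirmAction μ | R (priceCap μ c - a.1) t} :=
    ((measurable_const.sub (measurable_coe_nnreal_real.comp measurable_fst)).prodMk
      measurable_const) hR
  have hU := h.priceCap_pos
  have hU1 := h.priceCap_lt_one
  rw [outcomeLaw, Measure.compProd_apply hm]
  have hae : ∀ᵐ a ∂(σ : Measure (FirmAction μ)),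
      signalKernel μ a (Prod.mk a ⁻¹' {ω | R (firmSurplus c b ω) t})
      = ENNReal.ofReal (1 - μ) + ENNReal.ofReal μ *
        {a : FirmAction μ | R (priceCap μ c - a.1) t}.indicator (fun _ => 1) a := by
    filter_upwards [hσ, ht] with a ⟨F, ha, hF⟩ hR0
    rw [signalKernel_apply, signal_of_posted ha, hF, fullInformation]
    simp only [Measure.add_apply, Measure.smul_apply, smul_eq_mul]
    rw [Measure.dirac_apply, Measure.dirac_apply]
    have e0 : firmSurplus c b (a, 0) = -(a.1 : ℝ) := by
      rw [firmSurplus_eq, h.cappedPosterior_full b ha hF, min_eq_left (by simpa using hU.le)]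
      simp
    have e1 : firmSurplus c b (a, 1) = priceCap μ c - a.1 := by
      rw [firmSurplus_eq, h.cappedPosterior_full b ha hF, min_eq_right (by simpa using hU1.le)]
    congr 1
    · rw [Set.indicator_of_mem]
      · rw [Pi.one_apply, mul_one]
      · rw [Set.mem_preimage, Set.mem_ofPred_eq, e0]
        exact hR0
    · by_cases hR1 : R (priceCap μ c - a.1) t
      · rw [Set.indicator_of_mem (by rwa [Set.mem_preimage, Set.mem_ofPred_eq, e1]),
          Set.indicator_of_mem (by exact hR1), Pi.one_apply]
      · rw [Set.indicator_of_notMem (by rwa [Set.mem_preimage, Set.mem_ofPred_eq, e1]),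
          Set.indicator_of_notMem (by exact hR1)]
  rw [lintegral_congr_ae hae, lintegral_add_left measurable_const, lintegral_const_mul' _ _
    ENNReal.ofReal_ne_top, lintegral_indicator_const hm']
  simp

lemma Params.winProb_rel {R : ℝ → ℝ → Prop} (hR : MeasurableSet {q : ℝ × ℝ | R q.1 q.2})
    {b : Fin n → ℝ≥0 → Signal μ} (hb : ∀ i, Measurable (b i))
    {σ : ProbabilityMeasure (FirmAction μ)} (hσ : PostsFullSignal σ) {t : ℝ}
    (ht : ∀ᵐ a ∂(σ : Measure (FirmAction μ)), R (-(a.1 : ℝ)) t) (i : Fin n) :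
    winProb c b R σ i t = (ENNReal.ofReal (1 - μ) + ENNReal.ofReal μ *
      (σ : Measure (FirmAction μ)) {a | R (priceCap μ c - a.1) t}) ^ (n - 1) := by
  rw [winProb]
  simp only [fun j => h.outcomeLaw_rel hR (hb j) hσ ht]
  rw [Finset.prod_const, Finset.card_erase_of_mem (Finset.mem_univ i), Finset.card_univ,
    Fintype.card_fin]

end FullInformation

/-! ### The equilibrium price distribution -/

section PriceDistribution

variable {n : ℕ} {μ c : ℝ} (hn : 2 ≤ n) (h : Params μ c)
include hn h

omit hn in
lemma Params.one_sub_mul_priceCDF (p : ℝ) : 1 - μ * priceCDF n μ c p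
    = (1 - μ) * (priceCap μ c / p) ^ (1 / ((n : ℝ) - 1)) := by
  have := h.mean_pos.ne'
  rw [priceCDF]
  field_simp
  ring

omit hn in
lemma Params.one_sub_mul_priceCDF_pos {p : ℝ} (hp : 0 < p) : 0 < 1 - μ * priceCDF n μ c p := by
  rw [h.one_sub_mul_priceCDF]
  have := h.priceCap_pos
  have := h.mean_lt_one
  exact mul_pos (by linarith) (Real.rpow_pos_of_pos (by positivity) _)

/-- The indifference condition: price times the probability that no rival offers a better deal is
constant. All later facts about `priceCDF` are read off from it. -/
lemma Params.one_sub_mul_priceCDF_pow {p : ℝ} (hp : 0 < p) :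
    (1 - μ * priceCDF n μ c p) ^ (n - 1) = (1 - μ) ^ (n - 1) * priceCap μ c / p := by
  have := h.priceCap_pos
  have hn1 : ((n - 1 : ℕ) : ℝ) = (n : ℝ) - 1 := by
    rw [Nat.cast_sub (by omega), Nat.cast_one]
  rw [h.one_sub_mul_priceCDF, mul_pow, mul_div_assoc, ← hn1, one_div,
    Real.rpow_inv_natCast_pow (by positivity) (by omega)]

lemma Params.priceCDF_le_one {p : ℝ} (hp : 0 < p) (hpU : p ≤ priceCap μ c) :
    priceCDF n μ c p ≤ 1 := by
  have h1 := h.one_sub_mul_priceCDF_pow hn hp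
  have hμ := h.mean_pos
  have hμ1 := h.mean_lt_one
  have h2 : (1 - μ) ^ (n - 1) ≤ (1 - μ * priceCDF n μ c p) ^ (n - 1) := by
    rw [h1, mul_div_assoc]
    exact le_mul_of_one_le_right (pow_nonneg (by linarith) _) ((one_le_div hp).2 hpU)
  rw [pow_le_pow_iff_left₀ (by linarith) (h.one_sub_mul_priceCDF_pos hp).le (by omega)] at h2
  nlinarith

lemma Params.priceCDF_nonneg {p : ℝ} (hp : 0 < p)
    (hpL : (1 - μ) ^ (n - 1) * priceCap μ c ≤ p) : 0 ≤ priceCDF n μ c p := by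
  have h1 := h.one_sub_mul_priceCDF_pow hn hp
  have hμ := h.mean_pos
  have h2 : (1 - μ * priceCDF n μ c p) ^ (n - 1) ≤ 1 := by
    rw [h1]
    exact (div_le_one hp).2 hpL
  rw [pow_le_one_iff_of_nonneg (h.one_sub_mul_priceCDF_pos hp).le (by omega)] at h2
  have h3 : 0 ≤ μ * priceCDF n μ c p := by linarith
  exact nonneg_of_mul_nonneg_right h3 hμ

omit hn in
lemma Params.lowPrice_pos : 0 < (1 - μ) ^ (n - 1) * priceCap μ c :=
  mul_pos (pow_pos (by linarith [h.mean_lt_one]) _) h.priceCap_pos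

/-- The quantile function of the price. -/
def priceQuantile (n : ℕ) (μ c : ℝ) (u : unitInterval) : ℝ :=
  (1 - μ) ^ (n - 1) * priceCap μ c / (1 - μ * u) ^ (n - 1)

omit hn in
lemma Params.one_sub_mul_pos (u : unitInterval) : 0 < 1 - μ * (u : ℝ) := by
  have h1 := h.mean_pos
  have h2 := h.mean_lt_one
  have h3 := u.2.2
  nlinarith

omit hn in
lemma Params.priceQuantile_pos (u : unitInterval) : 0 < priceQuantile n μ c u :=
  div_pos h.lowPrice_pos (pow_pos (h.one_sub_mul_pos u) _)

omit hn in
lemma Params.lowPrice_le_priceQuantile (u : unitInterval) :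
    (1 - μ) ^ (n - 1) * priceCap μ c ≤ priceQuantile n μ c u := by
  have h0 := mul_nonneg h.mean_pos.le u.2.1
  exact le_div_self h.lowPrice_pos.le (pow_pos (h.one_sub_mul_pos u) _)
    (pow_le_one₀ (h.one_sub_mul_pos u).le (by linarith))

omit hn in
lemma Params.priceQuantile_lt {u : unitInterval} (hu : (u : ℝ) < 1) (hn : 2 ≤ n) :
    priceQuantile n μ c u < priceCap μ c := by
  rw [priceQuantile, div_lt_iff₀ (pow_pos (h.one_sub_mul_pos u) _), mul_comm]
  refine mul_lt_mul_of_pos_left ?_ h.priceCap_pos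
  have := h.mean_pos
  exact pow_lt_pow_left₀ (by nlinarith) (by linarith [h.mean_lt_one]) (by omega)

lemma Params.priceQuantile_le_iff (u : unitInterval) {p : ℝ} (hp : 0 < p) :
    priceQuantile n μ c u ≤ p ↔ (u : ℝ) ≤ priceCDF n μ c p := by
  have h1 := h.one_sub_mul_priceCDF_pow hn hp
  have hA := h.one_sub_mul_pos u
  have hB := h.one_sub_mul_priceCDF_pos (n := n) hp
  rw [priceQuantile, div_le_iff₀ (pow_pos hA _), ← div_le_iff₀' hp, ← h1,
    pow_le_pow_iff_left₀ hB.le hA.le (by omega), sub_le_sub_iff_left,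
    mul_le_mul_iff_right₀ h.mean_pos]

lemma Params.le_priceQuantile_iff (u : unitInterval) {p : ℝ} (hp : 0 < p) :
    p ≤ priceQuantile n μ c u ↔ priceCDF n μ c p ≤ u := by
  have h1 := h.one_sub_mul_priceCDF_pow hn hp
  have hA := h.one_sub_mul_pos u
  have hB := h.one_sub_mul_priceCDF_pos (n := n) hp
  rw [priceQuantile, le_div_iff₀ (pow_pos hA _), ← le_div_iff₀' hp, ← h1,
    pow_le_pow_iff_left₀ hA.le hB.le (by omega), sub_le_sub_iff_left,
    mul_le_mul_iff_right₀ h.mean_pos]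

omit hn

/-- Post full information and choose the price at the quantile `u`. -/
def quantileAction (n : ℕ) (h : Params μ c) (u : unitInterval) : FirmAction μ :=
  ((priceQuantile n μ c u).toNNReal, Sum.inl (fullSignal h.mean_pos h.mean_lt_one.le))

omit h in
lemma measurable_quantileAction (h : Params μ c) : Measurable (quantileAction n h) := by
  refine Measurable.prodMk (Measurable.real_toNNReal ?_) measurable_const
  unfold priceQuantile
  fun_prop

lemma coe_quantileAction (u : unitInterval) :
    ((quantileAction n h u).1 : ℝ) = priceQuantile n μ c u :=
  Real.coe_toNNReal _ (h.priceQuantile_pos u).le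

/-- The equilibrium strategy of the firms. -/
def equilibriumStrategy (n : ℕ) (h : Params μ c) : ProbabilityMeasure (FirmAction μ) :=
  ⟨(volume : Measure unitInterval).map (quantileAction n h),
    Measure.isProbabilityMeasure_map (measurable_quantileAction h).aemeasurable⟩

omit h in
lemma equilibriumStrategy_coe (h : Params μ c) :
    (equilibriumStrategy n h : Measure (FirmAction μ))
      = (volume : Measure unitInterval).map (quantileAction n h) := rfl

omit h in
lemma ae_equilibriumStrategy (h : Params μ c) {P : FirmAction μ → Prop}
    (hm : MeasurableSet {a | P a})
    (hP : ∀ u : unitInterval, (u : ℝ) < 1 → P (quantileAction n h u)) :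
    ∀ᵐ a ∂(equilibriumStrategy n h : Measure (FirmAction μ)), P a := by
  rw [equilibriumStrategy_coe, ae_map_iff (measurable_quantileAction h).aemeasurable hm]
  have h1 : ∀ᵐ u : unitInterval, u ≠ 1 := by
    rw [ae_iff]; simp
  filter_upwards [h1] with u hu
  exact hP u (lt_of_le_of_ne u.2.2 fun h => hu (Subtype.ext h))

lemma Params.postsFullSignal_equilibriumStrategy : PostsFullSignal (equilibriumStrategy n h) := by
  refine ae_equilibriumStrategy h ?_ fun u _ => ⟨_, rfl, fullSignal_coe _ _⟩
  have : {a : FirmAction μ | ∃ F : Signal μ, a.2 = Sum.inl F ∧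
      (F : Measure unitInterval) = fullInformation μ}
      = Prod.snd ⁻¹' (Sum.inl '' {F : Signal μ | reservation c F = priceCap μ c}) := by
    ext a
    simp only [Set.mem_ofPred_eq, Set.mem_preimage, Set.mem_image]
    constructor
    · rintro ⟨F, ha, hF⟩
      exact ⟨F, by rw [hF, h.reservation_fullInformation], ha.symm⟩
    · rintro ⟨F, hF, ha⟩
      exact ⟨F, ha.symm, h.eq_fullInformation_of_reservation hF⟩
  rw [this]
  exact measurable_snd ((h.measurable_reservation (measurableSet_singleton _)).inl_image)

omit h in
lemma measurableSet_price {s : Set ℝ} (hs : MeasurableSet s) :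
    MeasurableSet {a : FirmAction μ | (a.1 : ℝ) ∈ s} :=
  (measurable_coe_nnreal_real.comp measurable_fst) hs

omit h in
lemma equilibriumStrategy_price (h : Params μ c) {s : Set ℝ} (hs : MeasurableSet s) :
    (equilibriumStrategy n h : Measure (FirmAction μ)) {a | (a.1 : ℝ) ∈ s}
      = volume {u : unitInterval | priceQuantile n μ c u ∈ s} := by
  rw [equilibriumStrategy_coe, Measure.map_apply (measurable_quantileAction h)
    (measurableSet_price hs)]
  congr 1
  ext u
  rw [Set.mem_preimage, Set.mem_ofPred_eq, Set.mem_ofPred_eq, coe_quantileAction]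

omit h in
-- Negative `s` must be allowed: it will be `priceCDF` at a price below the support.
lemma volume_le_coe_le {s : ℝ} (hs : s ≤ 1) :
    volume {u : unitInterval | s ≤ (u : ℝ)} ≤ ENNReal.ofReal (1 - s) := by
  rcases le_total 0 s with h0 | h0
  · exact (unitInterval.volume_Ici (x := ⟨s, h0, hs⟩)).le
  · refine prob_le_one.trans ?_
    rw [← ENNReal.ofReal_one]
    exact ENNReal.ofReal_le_ofReal (by linarith)

lemma Params.ofReal_add_mul_pow {s : ℝ} (hs : s ≤ 1) :
    (ENNReal.ofReal (1 - μ) + ENNReal.ofReal μ * ENNReal.ofReal (1 - s)) ^ (n - 1)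
      = ENNReal.ofReal ((1 - μ * s) ^ (n - 1)) := by
  have := h.mean_pos
  have := h.mean_lt_one
  rw [← ENNReal.ofReal_mul (by linarith), ← ENNReal.ofReal_add (by linarith)
    (mul_nonneg (by linarith) (by linarith)), ← ENNReal.ofReal_pow]
  · congr 2; ring
  · nlinarith

/-! ### The candidate strategy: price law, win probabilities, equilibrium property -/

include hn

lemma Params.equilibriumStrategy_postsFullInformation :
    PostsFullInformation n c (equilibriumStrategy n h) := by
  refine ⟨h.postsFullSignal_equilibriumStrategy, fun p hpL hpU => ?_⟩
  have hp : 0 < (p : ℝ) := h.lowPrice_pos.trans_le hpL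
  have h1 := equilibriumStrategy_price (n := n) h (measurableSet_Iic (a := (p : ℝ)))
  simp only [Set.mem_Iic, NNReal.coe_le_coe, h.priceQuantile_le_iff hn _ hp] at h1
  rw [h1]
  exact unitInterval.volume_Iic
    (x := ⟨_, h.priceCDF_nonneg hn hp hpL, h.priceCDF_le_one hn hp hpU⟩)

lemma Params.winProb_equilibriumStrategy_le {b : Fin n → ℝ≥0 → Signal μ}
    (hb : ∀ i, Measurable (b i)) (i : Fin n) {t : ℝ} (ht0 : 0 ≤ t) (htU : t < priceCap μ c) :
    winProb c b (· ≤ ·) (equilibriumStrategy n h) i t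
      ≤ ENNReal.ofReal ((1 - μ) ^ (n - 1) * priceCap μ c / (priceCap μ c - t)) := by
  have hv : 0 < priceCap μ c - t := by linarith
  have hle := h.priceCDF_le_one hn hv (by linarith)
  rw [h.winProb_rel measurableSet_rel_le hb h.postsFullSignal_equilibriumStrategy
    (Filter.Eventually.of_forall fun a => by have := NNReal.coe_nonneg a.1; linarith),
    ← h.one_sub_mul_priceCDF_pow hn hv, ← h.ofReal_add_mul_pow hle]
  refine pow_le_pow_left₀ zero_le (add_le_add_right (mul_le_mul_right ?_ _) _) _
  refine le_trans (le_of_eq ?_) (volume_le_coe_le hle)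
  have h1 := equilibriumStrategy_price (n := n) h (measurableSet_Ici (a := priceCap μ c - t))
  simp only [Set.mem_Ici, h.le_priceQuantile_iff hn _ hv] at h1
  rw [← h1]
  congr 1
  ext a
  simp only [Set.mem_ofPred_eq, sub_le_comm]

lemma Params.winProb_equilibriumStrategy_eq {b : Fin n → ℝ≥0 → Signal μ}
    (hb : ∀ i, Measurable (b i)) (i : Fin n) {p : ℝ}
    (hpL : (1 - μ) ^ (n - 1) * priceCap μ c ≤ p) (hpU : p < priceCap μ c) :
    winProb c b (· < ·) (equilibriumStrategy n h) i (priceCap μ c - p)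
      = ENNReal.ofReal ((1 - μ) ^ (n - 1) * priceCap μ c / p) := by
  have hp : 0 < p := h.lowPrice_pos.trans_le hpL
  have hle := h.priceCDF_le_one hn hp hpU.le
  rw [h.winProb_rel measurableSet_rel_lt hb h.postsFullSignal_equilibriumStrategy
    (Filter.Eventually.of_forall fun a => by have := NNReal.coe_nonneg a.1; linarith),
    ← h.one_sub_mul_priceCDF_pow hn hp, ← h.ofReal_add_mul_pow hle]
  congr 3
  have h1 := equilibriumStrategy_price (n := n) h (measurableSet_Ioi (a := p))
  simp only [Set.mem_Ioi] at h1
  have h2 : {a : FirmAction μ | priceCap μ c - (a.1 : ℝ) < priceCap μ c - p}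
      = {a | p < (a.1 : ℝ)} := by
    ext a
    simp only [Set.mem_ofPred_eq, sub_lt_sub_iff_left]
  rw [h2, h1]
  simp only [← not_le, h.priceQuantile_le_iff hn _ hp]
  simp only [not_le]
  exact unitInterval.volume_Ioi (x := ⟨_, h.priceCDF_nonneg hn hp hpL, hle⟩)

omit h hn in
lemma ae_outcomeLaw_of_ae {σ : ProbabilityMeasure (FirmAction μ)} {P : FirmAction μ → Prop}
    (hP : ∀ᵐ a ∂(σ : Measure (FirmAction μ)), P a) : ∀ᵐ ω ∂(outcomeLaw σ), P ω.1 := by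
  have : (outcomeLaw σ).map Prod.fst = (σ : Measure (FirmAction μ)) := Measure.fst_compProd _ _
  rw [← this] at hP
  exact ae_of_ae_map measurable_fst.aemeasurable hP

omit h hn in
lemma outcomeLaw_snd_eq_one {σ : ProbabilityMeasure (FirmAction μ)}
    (hσ : PostsFullSignal σ) : outcomeLaw σ {ω | ω.2 = 1} = ENNReal.ofReal μ := by
  have hm : MeasurableSet {ω : FirmAction μ × unitInterval | ω.2 = 1} :=
    measurable_snd (measurableSet_singleton 1)
  rw [outcomeLaw, Measure.compProd_apply hm]
  have : ∀ᵐ a ∂(σ : Measure (FirmAction μ)),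
      signalKernel μ a (Prod.mk a ⁻¹' {ω | ω.2 = 1}) = ENNReal.ofReal μ := by
    filter_upwards [hσ] with a ⟨F, ha, hF⟩
    rw [signalKernel_apply, signal_of_posted ha, hF, fullInformation]
    simp only [Measure.add_apply, Measure.smul_apply, smul_eq_mul]
    rw [Measure.dirac_apply, Measure.dirac_apply]
    simp
  rw [lintegral_congr_ae this]
  simp

/-- Each price in the support, when the posterior is `1`, earns the constant from the indifference
condition, even if all ties are lost. -/
lemma Params.le_lintegral_revenue_equilibriumStrategy {b : Fin n → ℝ≥0 → Signal μ}
    (hb : ∀ i, Measurable (b i)) (i : Fin n) :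
    ENNReal.ofReal ((1 - μ) ^ (n - 1) * priceCap μ c * μ)
      ≤ ∫⁻ ω, revenue c b (· < ·) (equilibriumStrategy n h) i ω
        ∂(outcomeLaw (equilibriumStrategy n h)) := by
  have hm : MeasurableSet {ω : FirmAction μ × unitInterval | ω.2 = 1} :=
    measurable_snd (measurableSet_singleton 1)
  have hfull := h.postsFullSignal_equilibriumStrategy (n := n)
  rw [ENNReal.ofReal_mul h.lowPrice_pos.le, ← outcomeLaw_snd_eq_one hfull,
    ← lintegral_indicator_const hm]
  refine lintegral_mono_ae ?_
  have hprice : ∀ᵐ a ∂(equilibriumStrategy n h : Measure (FirmAction μ)),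
      (a.1 : ℝ) ∈ Set.Ico ((1 - μ) ^ (n - 1) * priceCap μ c) (priceCap μ c) := by
    refine ae_equilibriumStrategy h (measurableSet_price measurableSet_Ico) fun u hu => ?_
    rw [coe_quantileAction]
    exact ⟨h.lowPrice_le_priceQuantile u, h.priceQuantile_lt hu hn⟩
  filter_upwards [ae_outcomeLaw_of_ae hfull, ae_outcomeLaw_of_ae hprice]
    with ⟨a, x⟩ ⟨F, ha, hF⟩ ⟨hpL, hpU⟩
  rw [Set.indicator_apply]
  split_ifs with hx
  · have hx1 : x = 1 := hx
    have hs : firmSurplus c (b i) (a, x) = priceCap μ c - a.1 := by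
      rw [firmSurplus_eq, h.cappedPosterior_full _ ha hF, hx1,
        min_eq_right (by simpa using h.priceCap_lt_one.le)]
    simp only at hpL hpU
    have hp : 0 < (a.1 : ℝ) := h.lowPrice_pos.trans_le hpL
    rw [revenue, hs, if_pos (by linarith), h.winProb_equilibriumStrategy_eq hn hb i hpL hpU,
      ← ENNReal.ofReal_mul hp.le, mul_div_cancel₀ _ hp.ne']
  · exact zero_le

omit hn

lemma Params.lintegral_min_reservation (F : Signal μ) :
    ∫⁻ x : unitInterval, ENNReal.ofReal (min (x : ℝ) (reservation c F))
      ∂(F : Measure unitInterval) = ENNReal.ofReal (μ - c) := by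
  rw [← h.integral_min_reservation F, ofReal_integral_eq_lintegral_ofReal
    (integrable_of_continuous (by fun_prop))]
  exact Filter.Eventually.of_forall fun x => le_min x.2.1 (h.reservation_pos F).le

/-- A posted signal gives the mean `μ - c` exactly. A hidden one is believed uninformative, so its
capped posterior never exceeds the reservation value `μ - c`. -/
lemma Params.lintegral_cappedPosterior_noInformation_le (σ : ProbabilityMeasure (FirmAction μ)) :
    ∫⁻ ω, ENNReal.ofReal (cappedPosterior c (fun _ => noInformation h) ω) ∂(outcomeLaw σ)
      ≤ ENNReal.ofReal (μ - c) := by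
  have hm : Measurable fun ω : FirmAction μ × unitInterval =>
      ENNReal.ofReal (cappedPosterior c (fun _ => noInformation h) ω) :=
    ENNReal.measurable_ofReal.comp (h.measurable_cappedPosterior measurable_const)
  rw [outcomeLaw, Measure.lintegral_compProd hm]
  refine (lintegral_mono fun a => ?_).trans_eq
    ((lintegral_const (ENNReal.ofReal (μ - c))).trans (by simp))
  rcases a with ⟨p, F | F⟩
  · exact (h.lintegral_min_reservation F).le
  · refine (lintegral_mono fun x => ENNReal.ofReal_le_ofReal (min_le_right _ _)).trans_eq ?_
    simp only [FirmAction.observe, believedSignal, Sum.map_inr, Sum.elim_inr,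
      h.reservation_noInformation]
    simp

lemma Params.lintegral_mul_cappedPosterior_le {b : ℝ≥0 → Signal μ}
    {σ' : ProbabilityMeasure (FirmAction μ)} {K : ℝ} (hK : 0 ≤ K)
    (hσ' : ∫⁻ ω, ENNReal.ofReal (cappedPosterior c b ω) ∂(outcomeLaw σ')
      ≤ ENNReal.ofReal (μ - c)) :
    ∫⁻ ω, ENNReal.ofReal (K / priceCap μ c * cappedPosterior c b ω) ∂(outcomeLaw σ')
      ≤ ENNReal.ofReal (K * μ) := by
  have hU := h.priceCap_pos
  have h0 : 0 ≤ K / priceCap μ c := by positivity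
  simp only [ENNReal.ofReal_mul h0]
  rw [lintegral_const_mul' _ _ ENNReal.ofReal_ne_top]
  refine (mul_le_mul_right hσ' _).trans_eq ?_
  rw [← ENNReal.ofReal_mul h0, ← h.mean_mul_priceCap]
  congr 1
  field_simp

include hn

lemma Params.isSymmetricEquilibrium_optionalPosting :
    IsSymmetricEquilibrium c (optionalPosting μ) (equilibriumStrategy n h)
      (fun _ : Fin n => fun _ => noInformation h)
      (indexStrategy h (fun _ : Fin n => fun _ => noInformation h) fun _ => measurable_const) where
  feasible := Filter.Eventually.of_forall fun _ => trivial
  measurable_belief _ := measurable_const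
  consistent _ A B _ _ := by
    -- Nothing is hidden on the path, so Bayes' rule does not restrict the conjecture.
    have h0 : (equilibriumStrategy n h : Measure (FirmAction μ)) {a | a.Hidden ∧ a.1 ∈ A} = 0 := by
      refine measure_mono_null ?_ (h.postsFullSignal_equilibriumStrategy (n := n))
      rintro a ⟨ha, -⟩ ⟨F, hF, -⟩
      simp [FirmAction.Hidden, hF] at ha
    rw [setLIntegral_measure_zero _ _ h0, setLIntegral_measure_zero _ _ h0]
  rational := h.sequentiallyRational_indexStrategy _
  optimal i σ' _ := by
    have hb : ∀ _ : Fin n, Measurable fun _ : ℝ≥0 => noInformation h := fun _ => measurable_const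
    have hτ := h.sequentiallyRational_indexStrategy hb
    have hwin := fun t => h.winProb_equilibriumStrategy_le (t := t) hn hb i
    refine (h.expectedProfit_le hb hτ _ σ' i).trans ?_
    have h1 := h.le_expectedProfit hb hτ (equilibriumStrategy n h) (equilibriumStrategy n h) i
    rw [Function.update_eq_self] at h1
    refine le_trans ?_ h1
    refine le_trans ?_ (h.le_lintegral_revenue_equilibriumStrategy hn hb i)
    refine (lintegral_mono (h.revenue_le h.lowPrice_pos.le hwin)).trans ?_
    exact h.lintegral_mul_cappedPosterior_le h.lowPrice_pos.le
      (h.lintegral_cappedPosterior_noInformation_le σ')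

lemma Params.isSymmetricEquilibrium_mandatoryPosting :
    IsSymmetricEquilibrium c (mandatoryPosting μ) (equilibriumStrategy n h)
      (fun _ : Fin n => fun _ => noInformation h)
      (indexStrategy h (fun _ : Fin n => fun _ => noInformation h) fun _ => measurable_const) := by
  have heq := h.isSymmetricEquilibrium_optionalPosting hn
  refine ⟨?_, heq.measurable_belief, heq.consistent, heq.rational, fun i σ' _ =>
    heq.optimal i σ' (Filter.Eventually.of_forall fun _ => trivial)⟩
  filter_upwards [h.postsFullSignal_equilibriumStrategy (n := n)] with a ⟨F, hF, _⟩
  simp [mandatoryPosting, FirmAction.Hidden, hF]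

end PriceDistribution

/-! ### Consequences of consistent conjectures -/

section Consistency

open ProbabilityTheory

variable {n : ℕ} {μ c : ℝ}

lemma measurableSet_hidden : MeasurableSet {a : FirmAction μ | a.Hidden} := by
  have : {a : FirmAction μ | a.Hidden} = Prod.snd ⁻¹' Set.range Sum.inr := by
    ext ⟨p, s⟩
    cases s <;> simp [FirmAction.Hidden]
  rw [this]
  exact measurable_snd measurableSet_range_inr

/-- The conjecture as a kernel. -/
def conjectureKernel (b : ℝ≥0 → Signal μ) (hb : Measurable b) : Kernel ℝ≥0 unitInterval where
  toFun p := b p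
  measurable' := measurable_subtype_coe.comp hb

instance (b : ℝ≥0 → Signal μ) (hb : Measurable b) : IsMarkovKernel (conjectureKernel b hb) :=
  ⟨fun p => inferInstanceAs (IsProbabilityMeasure (b p : Measure unitInterval))⟩

variable {σ : ProbabilityMeasure (FirmAction μ)} {b : ℝ≥0 → Signal μ}

/-- The strategy restricted to the actions that hide the signal. -/
def hiddenPart (σ : ProbabilityMeasure (FirmAction μ)) : Measure (FirmAction μ) :=
  (σ : Measure (FirmAction μ)).restrict {a | a.Hidden}

instance : IsFiniteMeasure (hiddenPart σ) := by
  unfold hiddenPart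
  infer_instance

/-- Consistency says that, on the hidden part, price and true posterior have the same joint law as
price and a posterior drawn from the conjecture. -/
lemma BeliefConsistent.compProd_eq (hc : BeliefConsistent σ b) (hb : Measurable b) :
    (hiddenPart σ ⊗ₘ signalKernel μ).map (Prod.map Prod.fst id)
      = (hiddenPart σ).map Prod.fst ⊗ₘ conjectureKernel b hb := by
  refine Measure.ext_prod fun {A B} hA hB => ?_
  have hmap : Measurable (Prod.map Prod.fst id : FirmAction μ × unitInterval → _) :=
    measurable_fst.prodMap measurable_id
  have hH : Prod.fst ⁻¹' A ∩ {a : FirmAction μ | a.Hidden}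
      = {a : FirmAction μ | a.Hidden ∧ a.1 ∈ A} := by
    ext a
    exact and_comm
  rw [Measure.map_apply hmap (hA.prod hB)]
  change (hiddenPart σ ⊗ₘ signalKernel μ) ((Prod.fst ⁻¹' A) ×ˢ B) = _
  rw [Measure.compProd_apply_prod (measurable_fst hA) hB, Measure.compProd_apply_prod hA hB,
    setLIntegral_map hA (Kernel.measurable_coe _ hB) measurable_fst, hiddenPart,
    Measure.restrict_restrict (measurable_fst hA), hH]
  exact hc A B hA hB

lemma BeliefConsistent.lintegral_hidden (hc : BeliefConsistent σ b) (hb : Measurable b)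
    {g : ℝ≥0 × unitInterval → ℝ≥0∞} (hg : Measurable g) :
    ∫⁻ a, ∫⁻ x, g (a.1, x) ∂(a.signal : Measure unitInterval) ∂(hiddenPart σ)
      = ∫⁻ a, ∫⁻ x, g (a.1, x) ∂(b a.1 : Measure unitInterval) ∂(hiddenPart σ) := by
  have hmap : Measurable (Prod.map Prod.fst id : FirmAction μ × unitInterval → _) :=
    measurable_fst.prodMap measurable_id
  have h1 : ∫⁻ q, g q ∂((hiddenPart σ ⊗ₘ signalKernel μ).map (Prod.map Prod.fst id))
      = ∫⁻ q, g q ∂((hiddenPart σ).map Prod.fst ⊗ₘ conjectureKernel b hb) := by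
    rw [hc.compProd_eq hb]
  rw [lintegral_map hg hmap,
    Measure.lintegral_compProd (f := fun q => g (Prod.map Prod.fst id q)) (hg.comp hmap),
    Measure.lintegral_compProd hg, lintegral_map (hg.lintegral_kernel_prod_right') measurable_fst]
    at h1
  exact h1

/-- Uniqueness of disintegration. It is needed because the conjectures about different firms may
differ off the path. -/
lemma ae_conjecture_eq {b b' : ℝ≥0 → Signal μ} (hc : BeliefConsistent σ b) (hb : Measurable b)
    (hc' : BeliefConsistent σ b') (hb' : Measurable b') :
    ∀ᵐ a ∂(σ : Measure (FirmAction μ)), a.Hidden → b a.1 = b' a.1 := by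
  have h1 := Kernel.ae_eq_of_compProd_eq ((hc.compProd_eq hb).symm.trans (hc'.compProd_eq hb'))
  have h2 := ae_of_ae_map measurable_fst.aemeasurable h1
  rw [hiddenPart, ae_restrict_iff' measurableSet_hidden] at h2
  filter_upwards [h2] with a ha hh
  exact Subtype.ext (ha hh)

lemma believedSignal_of_not_hidden (b : ℝ≥0 → Signal μ) {a : FirmAction μ} (ha : ¬ a.Hidden) :
    believedSignal b a.observe = a.signal := by
  rcases a with ⟨p, F | F⟩
  · rfl
  · simp [FirmAction.Hidden] at ha

lemma believedSignal_of_hidden (b : ℝ≥0 → Signal μ) {a : FirmAction μ} (ha : a.Hidden) :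
    believedSignal b a.observe = b a.1 := by
  rcases a with ⟨p, F | F⟩
  · simp [FirmAction.Hidden] at ha
  · rfl

lemma ae_firmSurplus_eq {b b' : ℝ≥0 → Signal μ} (hc : BeliefConsistent σ b) (hb : Measurable b)
    (hc' : BeliefConsistent σ b') (hb' : Measurable b') :
    firmSurplus c b =ᵐ[outcomeLaw σ] firmSurplus c b' := by
  filter_upwards [ae_outcomeLaw_of_ae (ae_conjecture_eq hc hb hc' hb')] with ω hω
  have : believedSignal b ω.1.observe = believedSignal b' ω.1.observe := by
    by_cases hh : ω.1.Hidden
    · rw [believedSignal_of_hidden _ hh, believedSignal_of_hidden _ hh, hω hh]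
    · rw [believedSignal_of_not_hidden _ hh, believedSignal_of_not_hidden _ hh]
  simp only [firmSurplus, reservationUtility, this]

/-- On the hidden part the true posterior may be replaced by a draw from the conjecture, and then
the cap is the reservation value of the very law that is integrated. -/
lemma Params.lintegral_cappedPosterior (h : Params μ c) (hc : BeliefConsistent σ b)
    (hb : Measurable b) :
    ∫⁻ ω, ENNReal.ofReal (cappedPosterior c b ω) ∂(outcomeLaw σ) = ENNReal.ofReal (μ - c) := by
  have hm : Measurable fun ω : FirmAction μ × unitInterval =>
      ENNReal.ofReal (cappedPosterior c b ω) :=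
    ENNReal.measurable_ofReal.comp (h.measurable_cappedPosterior hb)
  have hg : Measurable fun q : ℝ≥0 × unitInterval =>
      ENNReal.ofReal (min (q.2 : ℝ) (reservation c (b q.1))) :=
    ENNReal.measurable_ofReal.comp ((measurable_subtype_coe.comp measurable_snd).min
      (h.measurable_reservation.comp (hb.comp measurable_fst)))
  rw [outcomeLaw, Measure.lintegral_compProd hm,
    ← lintegral_add_compl _ (measurableSet_hidden (μ := μ))]
  have h1 : ∫⁻ a in {a : FirmAction μ | a.Hidden}, ∫⁻ x,
      ENNReal.ofReal (cappedPosterior c b (a, x)) ∂(signalKernel μ a) ∂(σ : Measure (FirmAction μ))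
      = ∫⁻ _ in {a : FirmAction μ | a.Hidden}, ENNReal.ofReal (μ - c)
        ∂(σ : Measure (FirmAction μ)) := by
    refine Eq.trans ?_ ((hc.lintegral_hidden hb hg).trans ?_)
    · refine setLIntegral_congr_fun measurableSet_hidden fun a ha => ?_
      simp only [cappedPosterior, believedSignal_of_hidden b ha]
      rfl
    · exact lintegral_congr fun a => h.lintegral_min_reservation (b a.1)
  have h2 : ∫⁻ a in {a : FirmAction μ | a.Hidden}ᶜ, ∫⁻ x,
      ENNReal.ofReal (cappedPosterior c b (a, x)) ∂(signalKernel μ a) ∂(σ : Measure (FirmAction μ))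
      = ∫⁻ _ in {a : FirmAction μ | a.Hidden}ᶜ, ENNReal.ofReal (μ - c)
        ∂(σ : Measure (FirmAction μ)) := by
    refine setLIntegral_congr_fun measurableSet_hidden.compl fun a ha => ?_
    simp only [cappedPosterior, believedSignal_of_not_hidden b ha]
    exact h.lintegral_min_reservation a.signal
  rw [h1, h2, lintegral_add_compl _ measurableSet_hidden]
  simp

end Consistency

/-! ### Equilibrium conditions -/

section Equilibrium

open ProbabilityTheory

variable {n : ℕ} {μ c : ℝ} {S : Set (FirmAction μ)} {σ : ProbabilityMeasure (FirmAction μ)}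
  {b : Fin n → ℝ≥0 → Signal μ} {τ : SearchStrategy n μ}

lemma winProb_mono_lt {s t : ℝ} (hst : s ≤ t) (i : Fin n) :
    winProb c b (· < ·) σ i s ≤ winProb c b (· < ·) σ i t :=
  Finset.prod_le_prod' fun _ _ => measure_mono fun _ hω => lt_of_lt_of_le hω hst

lemma winProb_le_winProb_lt {s t : ℝ} (hst : s < t) (i : Fin n) :
    winProb c b (· ≤ ·) σ i s ≤ winProb c b (· < ·) σ i t :=
  Finset.prod_le_prod' fun _ _ => measure_mono fun _ hω => lt_of_le_of_lt hω hst

lemma winProb_le_one (R : ℝ → ℝ → Prop) (i : Fin n) (t : ℝ) : winProb c b R σ i t ≤ 1 :=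
  Finset.prod_le_one' fun _ _ => prob_le_one

variable (h : Params μ c)
include h

lemma Params.le_profit_of_deviation (hS : MeasurableSet S)
    (heq : IsSymmetricEquilibrium c S σ b τ) (i : Fin n) {a : FirmAction μ} (ha : a ∈ S) {t : ℝ}
    (ht : 0 < t) :
    ENNReal.ofReal a.1 * winProb c b (· < ·) σ i t *
      (a.signal : Measure unitInterval) {x | t ≤ firmSurplus c (b i) (a, x)}
      ≤ expectedProfit τ (fun _ => σ) i := by
  have hb := heq.measurable_belief
  let σ' : ProbabilityMeasure (FirmAction μ) := ⟨Measure.dirac a, inferInstance⟩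
  have hσ' : ∀ᵐ a' ∂(σ' : Measure (FirmAction μ)), a' ∈ S := (ae_dirac_iff hS).2 ha
  refine le_trans ?_ ((h.le_expectedProfit hb heq.rational σ σ' i).trans (heq.optimal i σ' hσ'))
  -- The price condition is automatic under the Dirac mass at `a`; including it makes the bound
  -- below valid at every outcome.
  set E : Set (FirmAction μ × unitInterval) :=
    {ω | t ≤ firmSurplus c (b i) ω ∧ (a.1 : ℝ) ≤ ω.1.1}
  have hE : MeasurableSet E :=
    (measurableSet_le measurable_const (h.measurable_firmSurplus (hb i))).inter
      (measurableSet_le measurable_const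
        (measurable_coe_nnreal_real.comp (measurable_fst.comp measurable_fst)))
  have hEm : outcomeLaw σ' E
      = (a.signal : Measure unitInterval) {x | t ≤ firmSurplus c (b i) (a, x)} := by
    rw [outcomeLaw, Measure.compProd_apply hE]
    change ∫⁻ a', _ ∂(Measure.dirac a) = _
    rw [lintegral_dirac' _ (Kernel.measurable_kernel_prodMk_left hE)]
    rw [signalKernel_apply]
    congr 1
    ext x
    simp [E]
  rw [← hEm, ← lintegral_indicator_const hE]
  refine lintegral_mono fun ω => ?_
  by_cases hω : ω ∈ E
  · rw [Set.indicator_of_mem hω, revenue, if_pos (ht.trans_le hω.1)]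
    exact mul_le_mul' (ENNReal.ofReal_le_ofReal hω.2)
      (winProb_mono_lt hω.1 i)
  · rw [Set.indicator_of_notMem hω]
    exact zero_le

lemma Params.le_profit_of_post_fullInformation (hS : MeasurableSet S)
    (hpost : mandatoryPosting μ ⊆ S) (heq : IsSymmetricEquilibrium c S σ b τ) (i : Fin n) {p : ℝ}
    (hp : 0 < p) (hpU : p < priceCap μ c) :
    ENNReal.ofReal (p * μ) * winProb c b (· < ·) σ i (priceCap μ c - p)
      ≤ expectedProfit τ (fun _ => σ) i := by
  set F := fullSignal h.mean_pos h.mean_lt_one.le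
  have hF : (F : Measure unitInterval) = fullInformation μ := fullSignal_coe _ _
  set a : FirmAction μ := (⟨p, hp.le⟩, Sum.inl F)
  have ha : a ∈ S := hpost (by simp [mandatoryPosting, FirmAction.Hidden, a])
  refine le_trans ?_ (h.le_profit_of_deviation hS heq i ha
    (show 0 < priceCap μ c - p by linarith))
  have h1 : ENNReal.ofReal μ ≤ (a.signal : Measure unitInterval)
      {x | priceCap μ c - p ≤ firmSurplus c (b i) (a, x)} := by
    have := twoPointSignal_apply_ge h.mean_pos 1 (by simpa using h.mean_lt_one.le)
      (s := {x | priceCap μ c - p ≤ firmSurplus c (b i) (a, x)}) (by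
        rw [Set.mem_ofPred_eq, firmSurplus_eq, h.cappedPosterior_full (b i) rfl hF,
          min_eq_right (by simpa using h.priceCap_lt_one.le)]
        rfl)
    rwa [show μ / ((1 : unitInterval) : ℝ) = μ by simp] at this
  calc _ = ENNReal.ofReal p * winProb c b (· < ·) σ i (priceCap μ c - p) * ENNReal.ofReal μ := by
        rw [ENNReal.ofReal_mul hp.le]; ring
    _ ≤ _ := mul_le_mul_right h1 _

lemma Params.expectedProfit_le_one (hb : ∀ i, Measurable (b i))
    (hτ : SequentiallyRational c b τ) (i : Fin n) : expectedProfit τ (fun _ => σ) i ≤ 1 := by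
  have h1 := h.expectedProfit_le hb hτ σ σ i
  rw [Function.update_eq_self] at h1
  refine h1.trans ((lintegral_mono (g := fun _ => (1 : ℝ≥0∞)) fun ω => ?_).trans_eq (by simp))
  unfold revenue
  split_ifs with h0
  · rw [firmSurplus_eq] at h0
    have h2 := (h.cappedPosterior_mem (b i) ω).2
    have h3 := h.priceCap_lt_one
    refine mul_le_one' ?_ (winProb_le_one _ _ _)
    rw [← ENNReal.ofReal_one]
    exact ENNReal.ofReal_le_ofReal (by linarith)
  · exact zero_le

lemma Params.expectedProfit_ne_top (hb : ∀ i, Measurable (b i))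
    (hτ : SequentiallyRational c b τ) (i : Fin n) : expectedProfit τ (fun _ => σ) i ≠ ∞ :=
  ne_top_of_le_ne_top ENNReal.one_ne_top (h.expectedProfit_le_one hb hτ i)

omit h in
/-- The expected profit of firm `i` divided by the prior mean. -/
def scaledProfit (τ : SearchStrategy n μ) (σ : ProbabilityMeasure (FirmAction μ)) (i : Fin n) : ℝ :=
  (expectedProfit τ (fun _ => σ) i).toReal / μ

lemma Params.ofReal_scaledProfit_mul (hb : ∀ i, Measurable (b i))
    (hτ : SequentiallyRational c b τ) (i : Fin n) :
    ENNReal.ofReal (scaledProfit τ σ i * μ) = expectedProfit τ (fun _ => σ) i := by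
  rw [scaledProfit, div_mul_cancel₀ _ h.mean_pos.ne',
    ENNReal.ofReal_toReal (h.expectedProfit_ne_top hb hτ i)]

lemma Params.scaledProfit_nonneg (i : Fin n) : 0 ≤ scaledProfit τ σ i :=
  div_nonneg ENNReal.toReal_nonneg h.mean_pos.le

/-- Full information posted at a price just below `priceCap - t` strictly beats every rival whose
effective surplus is at most `t`; let the price increase to `priceCap - t`. -/
lemma Params.winProb_le (hS : MeasurableSet S) (hpost : mandatoryPosting μ ⊆ S)
    (heq : IsSymmetricEquilibrium c S σ b τ) (i : Fin n) {t : ℝ} (ht0 : 0 ≤ t)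
    (htU : t < priceCap μ c) :
    winProb c b (· ≤ ·) σ i t ≤ ENNReal.ofReal (scaledProfit τ σ i / (priceCap μ c - t)) := by
  have hμ := h.mean_pos
  set K := scaledProfit τ σ i
  set W := (winProb c b (· ≤ ·) σ i t).toReal
  have hWtop : winProb c b (· ≤ ·) σ i t ≠ ∞ :=
    ne_top_of_le_ne_top ENNReal.one_ne_top (winProb_le_one _ _ _)
  have hK : 0 ≤ K := h.scaledProfit_nonneg i
  have hkey : ∀ p, 0 < p → p < priceCap μ c - t → p * W ≤ K := by
    intro p hp hpt
    have h1 := h.le_profit_of_post_fullInformation hS hpost heq i hp (by linarith)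
    rw [← h.ofReal_scaledProfit_mul heq.measurable_belief heq.rational i] at h1
    have h2 : ENNReal.ofReal (p * μ * W) ≤ ENNReal.ofReal (K * μ) := by
      refine le_trans ?_ h1
      rw [ENNReal.ofReal_mul (by positivity), ENNReal.ofReal_toReal hWtop]
      exact mul_le_mul_right (winProb_le_winProb_lt (by linarith) i) _
    rw [ENNReal.ofReal_le_ofReal_iff (by positivity)] at h2
    nlinarith
  rw [← ENNReal.ofReal_toReal hWtop]
  refine ENNReal.ofReal_le_ofReal ?_
  have hv : 0 < priceCap μ c - t := by linarith
  rw [le_div_iff₀ hv]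
  by_contra! hlt
  have hW : 0 < W := by
    refine ENNReal.toReal_nonneg.lt_of_ne fun h0 => ?_
    rw [← h0, zero_mul] at hlt
    linarith
  have h1 : K / W < priceCap μ c - t := by
    rw [div_lt_iff₀ hW, mul_comm]
    exact hlt
  have h0 : 0 ≤ K / W := by positivity
  -- A price strictly between `K / W` and `priceCap - t` violates `hkey`.
  have h2 := hkey ((K / W + (priceCap μ c - t)) / 2) (by linarith) (by linarith)
  have h3 : K / W * W = K := div_mul_cancel₀ _ hW.ne'
  nlinarith

/-- The profit is at most the revenue with all ties won, which is at most the integral of the linear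
bound, which equals the profit. So equality holds throughout. -/
lemma Params.lintegral_revenue_le_profit (hS : MeasurableSet S) (hpost : mandatoryPosting μ ⊆ S)
    (heq : IsSymmetricEquilibrium c S σ b τ) (i : Fin n) :
    ∫⁻ ω, revenue c b (· ≤ ·) σ i ω ∂(outcomeLaw σ) ≤ expectedProfit τ (fun _ => σ) i ∧
    revenue c b (· ≤ ·) σ i =ᵐ[outcomeLaw σ] fun ω => ENNReal.ofReal
      (scaledProfit τ σ i / priceCap μ c * cappedPosterior c (b i) ω) := by
  have hb := heq.measurable_belief
  have hwin := fun t => h.winProb_le (t := t) hS hpost heq i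
  have h1 : ∀ ω, revenue c b (· ≤ ·) σ i ω ≤ _ := h.revenue_le (h.scaledProfit_nonneg i) hwin
  have h2 := h.lintegral_mul_cappedPosterior_le (h.scaledProfit_nonneg (σ := σ) (τ := τ) i)
    (h.lintegral_cappedPosterior (heq.consistent i) (hb i)).le
  rw [h.ofReal_scaledProfit_mul hb heq.rational] at h2
  have h3 := h.expectedProfit_le hb heq.rational σ σ i
  rw [Function.update_eq_self] at h3
  refine ⟨(lintegral_mono h1).trans h2, ?_⟩
  refine ae_eq_of_ae_le_of_lintegral_le (Filter.Eventually.of_forall h1) ?_ ?_ (h2.trans h3)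
  · exact ne_top_of_le_ne_top (h.expectedProfit_ne_top hb heq.rational i)
      ((lintegral_mono h1).trans h2)
  · exact (ENNReal.measurable_ofReal.comp
      (measurable_const.mul (h.measurable_cappedPosterior (hb i)))).aemeasurable

/-- Capped posteriors have mean `μ - c`, so no rival almost surely offers `s > μ - c`. Full
information at price `priceCap - s > 0` thus sells with positive probability. -/
lemma Params.scaledProfit_pos (hS : MeasurableSet S) (hpost : mandatoryPosting μ ⊆ S)
    (heq : IsSymmetricEquilibrium c S σ b τ) (i : Fin n) : 0 < scaledProfit τ σ i := by
  have hb := heq.measurable_belief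
  have hlt := h.lt_priceCap
  have hpos := h.sub_pos
  have hμ := h.mean_pos
  set s := (μ - c + priceCap μ c) / 2 with hs
  have h1 := h.le_profit_of_post_fullInformation hS hpost heq i
    (p := priceCap μ c - s) (by linarith) (by linarith)
  rw [sub_sub_cancel, ← h.ofReal_scaledProfit_mul hb heq.rational] at h1
  have h2 : winProb c b (· < ·) σ i s ≠ 0 := by
    rw [winProb, Finset.prod_ne_zero_iff]
    intro j _ h0
    have h3 : ∀ᵐ ω ∂(outcomeLaw σ), s ≤ cappedPosterior c (b j) ω := by
      have : ∀ᵐ ω ∂(outcomeLaw σ), ¬ firmSurplus c (b j) ω < s := by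
        rw [ae_iff]; simpa using h0
      filter_upwards [this] with ω hω
      rw [firmSurplus_eq] at hω
      have := NNReal.coe_nonneg ω.1.1
      linarith
    have h4 := h.lintegral_cappedPosterior (heq.consistent j) (hb j)
    have h5 : ENNReal.ofReal s ≤ ENNReal.ofReal (μ - c) := by
      rw [← h4]
      refine le_trans (le_of_eq ?_)
        (lintegral_mono_ae (h3.mono fun ω hω => ENNReal.ofReal_le_ofReal hω))
      simp
    rw [ENNReal.ofReal_le_ofReal_iff hpos.le] at h5
    linarith
  have h3 : 0 < ENNReal.ofReal (scaledProfit τ σ i * μ) := by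
    refine lt_of_lt_of_le (ENNReal.mul_pos ?_ h2) h1
    exact (ENNReal.ofReal_pos.2 (mul_pos (by linarith) hμ)).ne'
  rw [ENNReal.ofReal_pos] at h3
  exact pos_of_mul_pos_left h3 hμ.le

omit h in
-- The true signal has mean `μ > 0`, so almost every action has a typical outcome with positive
-- posterior; this turns statements on outcomes into statements on actions.
lemma exists_pos_of_ae (h0 : 0 < μ) {P : FirmAction μ × unitInterval → Prop}
    (hP : ∀ᵐ ω ∂(outcomeLaw σ), P ω) :
    ∀ᵐ a ∂(σ : Measure (FirmAction μ)), ∃ x : unitInterval, 0 < (x : ℝ) ∧ P (a, x) := by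
  filter_upwards [Measure.ae_ae_of_ae_compProd hP] with a ha
  have h1 : ∃ᵐ x : unitInterval ∂(a.signal : Measure unitInterval), 0 < (x : ℝ) := by
    intro hx
    have h2 : ∫ x : unitInterval, (x : ℝ) ∂(a.signal : Measure unitInterval) = 0 :=
      integral_eq_zero_of_ae (hx.mono fun x hx => le_antisymm (not_lt.1 hx) x.2.1)
    rw [a.signal.integral_eq] at h2
    exact h0.ne' h2
  exact (h1.and_eventually ha).exists

lemma Params.ae_of_revenue_eq (hS : MeasurableSet S) (hpost : mandatoryPosting μ ⊆ S)
    (heq : IsSymmetricEquilibrium c S σ b τ) (i : Fin n) :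
    ∀ᵐ ω ∂(outcomeLaw σ), 0 < (ω.2 : ℝ) → 0 < (ω.1.1 : ℝ) ∧ 0 ≤ firmSurplus c (b i) ω ∧
      (firmSurplus c (b i) ω = 0 ∨ cappedPosterior c (b i) ω = priceCap μ c) ∧
      winProb c b (· ≤ ·) σ i (firmSurplus c (b i) ω)
        = ENNReal.ofReal (scaledProfit τ σ i / (priceCap μ c - firmSurplus c (b i) ω)) := by
  filter_upwards [(h.lintegral_revenue_le_profit hS hpost heq i).2] with ω hω hx
  exact h.of_revenue_eq (h.scaledProfit_pos hS hpost heq i)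
    (fun t => h.winProb_le hS hpost heq i) (lt_min hx (h.reservation_pos _)) hω

/-- With an atom at `t ≥ 0`, all firms would tie at `t` with positive probability, and two of them
would both win weakly. The atom is the same for all firms because their conjectures agree on the
path. -/
lemma Params.measure_firmSurplus_eq_zero (hn : 2 ≤ n) (hS : MeasurableSet S)
    (hpost : mandatoryPosting μ ⊆ S) (heq : IsSymmetricEquilibrium c S σ b τ) (i : Fin n) {t : ℝ}
    (ht : 0 ≤ t) : outcomeLaw σ {ω | firmSurplus c (b i) ω = t} = 0 := by
  have hb := heq.measurable_belief
  obtain ⟨j, hj⟩ : ∃ j : Fin n, i ≠ j := by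
    have : Nontrivial (Fin n) := Fin.nontrivial_iff_two_le.2 hn
    obtain ⟨j, hj⟩ := exists_ne i
    exact ⟨j, hj.symm⟩
  -- At price `0` the revenue would say nothing about the probability of a sale.
  have hpos : ∀ᵐ a ∂(σ : Measure (FirmAction μ)), 0 < a.1 := by
    filter_upwards [exists_pos_of_ae h.mean_pos (h.ae_of_revenue_eq hS hpost heq i)]
      with a ⟨x, hx, hP⟩
    exact NNReal.coe_pos.1 (hP hx).1
  have h1 := h.pi_both_win_eq_zero hb heq.rational hpos
    (h.expectedProfit_ne_top hb heq.rational)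
    (fun i => (h.lintegral_revenue_le_profit hS hpost heq i).1) hj
  have h2 : Measure.pi (fun _ : Fin n => outcomeLaw σ)
      (Set.univ.pi fun j => {ω | firmSurplus c (b j) ω = t}) = 0 := by
    refine measure_mono_null (fun ω hω => ?_) h1
    have hω' : ∀ k, surpluses c b ω k = t := fun k => hω k (Set.mem_univ k)
    constructor
    · exact ⟨by simpa only [hω'] using ht, fun k _ => by simp only [hω', le_refl]⟩
    · exact ⟨by simpa only [hω'] using ht, fun k _ => by simp only [hω', le_refl]⟩
  rw [Measure.pi_pi, Finset.prod_eq_zero_iff] at h2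
  obtain ⟨k, -, hk⟩ := h2
  rw [← hk]
  refine measure_congr ?_
  filter_upwards [ae_firmSurplus_eq (c := c) (heq.consistent i) (hb i) (heq.consistent k) (hb k)]
    with ω hω
  exact propext ⟨fun h => hω.symm.trans h, fun h => hω.trans h⟩

lemma Params.winProb_lt_eq_le (hn : 2 ≤ n) (hS : MeasurableSet S)
    (hpost : mandatoryPosting μ ⊆ S) (heq : IsSymmetricEquilibrium c S σ b τ) (i : Fin n) {t : ℝ}
    (ht : 0 ≤ t) : winProb c b (· < ·) σ i t = winProb c b (· ≤ ·) σ i t := by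
  refine Finset.prod_congr rfl fun j _ => measure_congr ?_
  have h0 : ∀ᵐ ω ∂(outcomeLaw σ), ¬ firmSurplus c (b j) ω = t := by
    rw [ae_iff]
    simpa using h.measure_firmSurplus_eq_zero hn hS hpost heq j ht
  filter_upwards [h0] with ω hω
  exact propext ⟨fun h => le_of_lt h, fun h => lt_of_le_of_ne h hω⟩

lemma Params.ae_price_optimal (hn : 2 ≤ n) (hS : MeasurableSet S)
    (hpost : mandatoryPosting μ ⊆ S) (heq : IsSymmetricEquilibrium c S σ b τ) (i : Fin n) :
    ∀ᵐ a ∂(σ : Measure (FirmAction μ)), 0 < (a.1 : ℝ) ∧ (a.1 : ℝ) < priceCap μ c ∧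
      reservation c (believedSignal (b i) a.observe) = priceCap μ c ∧
      winProb c b (· ≤ ·) σ i (priceCap μ c - a.1)
        = ENNReal.ofReal (scaledProfit τ σ i / a.1) := by
  have h0 : ∀ᵐ ω ∂(outcomeLaw σ), ¬ firmSurplus c (b i) ω = 0 := by
    rw [ae_iff]
    simpa using h.measure_firmSurplus_eq_zero hn hS hpost heq i le_rfl
  filter_upwards [exists_pos_of_ae h.mean_pos
    ((h.ae_of_revenue_eq hS hpost heq i).and h0)] with a ⟨x, hx, hP, hne⟩
  obtain ⟨h1, h2, h3, h4⟩ := hP hx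
  have h5 := h3.resolve_left hne
  have h6 := firmSurplus_eq (c := c) (b i) (a, x)
  rw [h5] at h6
  simp only at h6
  rw [h6, sub_sub_cancel] at h4
  refine ⟨h1, ?_, ?_, h4⟩
  · have := lt_of_le_of_ne h2 (Ne.symm hne)
    linarith
  · refine le_antisymm (h.reservation_mem _).2 ?_
    rw [← h5]
    exact min_le_right _ _

/-- A hidden signal must be believed to be full information, and the conjecture depends on the price
only. The firm can then pool some bad news into the good posterior unnoticed and sell more often at
the same price. -/
lemma Params.ae_not_hidden (hn : 2 ≤ n)
    (heq : IsSymmetricEquilibrium c (optionalPosting μ) σ b τ) :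
    ∀ᵐ a ∂(σ : Measure (FirmAction μ)), ¬ a.Hidden := by
  have hpost : mandatoryPosting μ ⊆ optionalPosting μ := Set.subset_univ _
  have hS : MeasurableSet (optionalPosting μ) := MeasurableSet.univ
  by_contra hfreq
  let i : Fin n := ⟨0, by omega⟩
  obtain ⟨a, ha, hp, hpU, hres, hwin⟩ := ((Filter.not_eventually.1 hfreq).and_eventually
    (h.ae_price_optimal hn hS hpost heq i)).exists
  rw [not_not] at ha
  have hμ := h.mean_pos
  have hU := h.priceCap_pos
  have hU1 := h.priceCap_lt_one
  have hK := h.scaledProfit_pos hS hpost heq i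
  set K := scaledProfit τ σ i
  -- `v ≥ priceCap` keeps the capped posterior at its maximum, `v ≥ μ` makes the two-point signal
  -- feasible, and `v < 1` gives `μ / v > μ`.
  obtain ⟨v, hv⟩ : ∃ v : unitInterval, (v : ℝ) = max (priceCap μ c) μ :=
    ⟨⟨_, le_max_of_le_left hU.le, max_le hU1.le h.mean_lt_one.le⟩, rfl⟩
  have hvμ : μ ≤ v := hv ▸ le_max_right _ _
  have hvU : priceCap μ c ≤ v := hv ▸ le_max_left _ _
  have hv1 : (v : ℝ) < 1 := hv ▸ max_lt hU1 h.mean_lt_one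
  have hv0 : (0 : ℝ) < v := hμ.trans_le hvμ
  set a' : FirmAction μ := (a.1, Sum.inr (twoPointSignal hμ v hvμ))
  have hbel : believedSignal (b i) a'.observe = believedSignal (b i) a.observe := by
    rw [believedSignal_of_hidden _ ha, believedSignal_of_hidden _ (by rfl)]
  have h1 := h.le_profit_of_deviation hS heq i (a := a') trivial
    (t := priceCap μ c - a.1) (by linarith)
  have h2 : ENNReal.ofReal (μ / v) ≤ (a'.signal : Measure unitInterval)
      {x | priceCap μ c - a.1 ≤ firmSurplus c (b i) (a', x)} := by
    refine twoPointSignal_apply_ge hμ v hvμ ?_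
    rw [Set.mem_ofPred_eq, firmSurplus_eq, cappedPosterior, hbel, hres, min_eq_right hvU]
  rw [h.winProb_lt_eq_le hn hS hpost heq i (by linarith), hwin,
    ← h.ofReal_scaledProfit_mul heq.measurable_belief heq.rational i] at h1
  have h3 := (mul_le_mul_right h2 _).trans h1
  rw [← ENNReal.ofReal_mul (NNReal.coe_nonneg _), ← ENNReal.ofReal_mul (by positivity),
    ENNReal.ofReal_le_ofReal_iff (by positivity)] at h3
  have h4 : (a'.1 : ℝ) * (K / a.1) = K := by
    change (a.1 : ℝ) * (K / a.1) = K
    field_simp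
  rw [h4] at h3
  have h5 : μ / v ≤ μ := le_of_mul_le_mul_left h3 hK
  rw [div_le_iff₀ hv0] at h5
  nlinarith

end Equilibrium

/-! ### The price distribution in equilibrium -/

section Uniqueness

open ProbabilityTheory

variable {n : ℕ} {μ c : ℝ}

/-- Half of the probability integral transform, valid without continuity. By inner regularity it
suffices to treat a compact subset; its greatest element `m` bounds its mass by the distribution
function at `m`. -/
lemma measure_cdf_le (ρ : Measure ℝ) [IsProbabilityMeasure ρ] {t : ℝ} (ht : 0 ≤ t) :
    ρ.real {s | ρ.real (Set.Iic s) ≤ t} ≤ t := by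
  have hA : MeasurableSet {s | ρ.real (Set.Iic s) ≤ t} := by
    refine Set.OrdConnected.measurableSet ⟨fun x _ y hy z hz => ?_⟩
    exact (measureReal_mono (Set.Iic_subset_Iic.2 hz.2)).trans hy
  refine ENNReal.toReal_le_of_le_ofReal ht ?_
  rw [hA.measure_eq_iSup_isCompact]
  refine iSup_le fun K => iSup_le fun hKA => iSup_le fun hK => ?_
  rcases K.eq_empty_or_nonempty with rfl | hne
  · simp
  · obtain ⟨m, hm, hmax⟩ := hK.exists_isGreatest hne
    have hsub : K ⊆ Set.Iic m := fun x hx => hmax hx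
    refine (measure_mono hsub).trans ?_
    rw [← ofReal_measureReal]
    exact ENNReal.ofReal_le_ofReal (hKA hm)

/-- The law of the price. -/
def priceLaw (σ : ProbabilityMeasure (FirmAction μ)) : Measure ℝ :=
  (σ : Measure (FirmAction μ)).map fun a => (a.1 : ℝ)

lemma measurable_price : Measurable fun a : FirmAction μ => (a.1 : ℝ) :=
  measurable_coe_nnreal_real.comp measurable_fst

instance (σ : ProbabilityMeasure (FirmAction μ)) : IsProbabilityMeasure (priceLaw σ) :=
  Measure.isProbabilityMeasure_map measurable_price.aemeasurable

variable (h : Params μ c)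
include h

/-- A distribution function that makes all prices in its support equally profitable, and no other
price more profitable, is `priceCDF`. -/
lemma Params.cdf_eq_priceCDF (hn : 2 ≤ n) (ρ : Measure ℝ) [IsProbabilityMeasure ρ] {K : ℝ}
    (hle : ∀ p, 0 < p → p ≤ priceCap μ c → (1 - μ * ρ.real (Set.Iic p)) ^ (n - 1) ≤ K / p)
    (hae : ∀ᵐ p ∂ρ, 0 < p ∧ p < priceCap μ c ∧ (1 - μ * ρ.real (Set.Iic p)) ^ (n - 1) = K / p)
    {p : ℝ} (hpL : (1 - μ) ^ (n - 1) * priceCap μ c ≤ p) (hpU : p ≤ priceCap μ c) :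
    ρ.real (Set.Iic p) = priceCDF n μ c p := by
  have hμ := h.mean_pos
  have hμ1 := h.mean_lt_one
  have hU := h.priceCap_pos
  have hn1 : n - 1 ≠ 0 := by omega
  set Φ : ℝ → ℝ := fun p => ρ.real (Set.Iic p)
  have hΦ1 : ∀ p, Φ p ≤ 1 := fun p => measureReal_le_one
  have hpos : ∀ p, 0 < 1 - μ * Φ p := fun p => by nlinarith [hΦ1 p]
  -- The bound at the price `priceCap`, together with `Φ ≤ 1`.
  have hKL : (1 - μ) ^ (n - 1) * priceCap μ c ≤ K := by
    have h1 := hle _ hU le_rfl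
    rw [← le_div_iff₀ hU]
    exact (pow_le_pow_left₀ (by linarith) (by nlinarith [hΦ1 (priceCap μ c)]) _).trans h1
  have hK0 : 0 < K := h.lowPrice_pos.trans_le hKL
  have hKU : K = (1 - μ) ^ (n - 1) * priceCap μ c := by
    refine le_antisymm ?_ hKL
    by_contra! hlt
    set B : ℝ := (K / priceCap μ c) ^ (((n - 1 : ℕ) : ℝ)⁻¹)
    have hB0 : 0 ≤ B := Real.rpow_nonneg (by positivity) _
    have hB : B ^ (n - 1) = K / priceCap μ c := Real.rpow_inv_natCast_pow (by positivity) hn1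
    have hB1 : 1 - μ < B := by
      rw [← pow_lt_pow_iff_left₀ (by linarith) hB0 hn1, hB, lt_div_iff₀ hU]
      exact hlt
    -- If `K` were larger, `Φ` would stay below a constant less than `1` at almost every price,
    -- against `measure_cdf_le`. The maximum with `0` only serves the sign condition there.
    have hall : ∀ᵐ s ∂ρ, Φ s ≤ max ((1 - B) / μ) 0 := by
      filter_upwards [hae] with s ⟨hs0, hsU, hs⟩
      refine le_max_of_le_left ?_
      rw [le_div_iff₀ hμ]
      have h1 : B ≤ 1 - μ * Φ s := by
        rw [← pow_le_pow_iff_left₀ hB0 (hpos s).le hn1, hB, hs]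
        exact div_le_div_of_nonneg_left hK0.le hs0 hsU.le
      linarith
    have h1 := measure_cdf_le ρ (le_max_right ((1 - B) / μ) 0)
    have h2 : ρ.real {s | Φ s ≤ max ((1 - B) / μ) 0} = 1 := by
      rw [measureReal_congr (Filter.eventuallyEq_univ.2 hall), probReal_univ]
    rw [h2] at h1
    have h3 : max ((1 - B) / μ) 0 < 1 := by
      refine max_lt ?_ one_pos
      rw [div_lt_one hμ]
      linarith
    linarith
  have hp : 0 < p := h.lowPrice_pos.trans_le hpL
  apply le_antisymm
  -- Almost every `s ≤ p` has `K / s ≥ K / p`, hence `Φ s ≤ priceCDF p`. So `{s ≤ p}` almost surely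
  -- lies in a sublevel set of `Φ`, and `measure_cdf_le` bounds its mass.
  · have h1 : ∀ᵐ s ∂ρ, s ≤ p → Φ s ≤ priceCDF n μ c p := by
      filter_upwards [hae] with s ⟨hs0, hsU, hs⟩ hsp
      have h2 : (1 - μ * priceCDF n μ c p) ^ (n - 1) ≤ (1 - μ * Φ s) ^ (n - 1) := by
        rw [h.one_sub_mul_priceCDF_pow hn hp, hs, hKU]
        exact div_le_div_of_nonneg_left h.lowPrice_pos.le hs0 hsp
      rw [pow_le_pow_iff_left₀ (h.one_sub_mul_priceCDF_pos hp).le (hpos s).le hn1] at h2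
      nlinarith
    refine le_trans ?_ (measure_cdf_le ρ (h.priceCDF_nonneg hn hp hpL))
    refine ENNReal.toReal_mono (measure_ne_top _ _) (measure_mono_ae ?_)
    filter_upwards [h1] with s hs hsp
    exact hs hsp
  · have h2 : (1 - μ * Φ p) ^ (n - 1) ≤ (1 - μ * priceCDF n μ c p) ^ (n - 1) := by
      rw [h.one_sub_mul_priceCDF_pow hn hp, ← hKU]
      exact hle p hp hpU
    rw [pow_le_pow_iff_left₀ (hpos p).le (h.one_sub_mul_priceCDF_pos hp).le hn1] at h2
    nlinarith

variable {S : Set (FirmAction μ)} {σ : ProbabilityMeasure (FirmAction μ)}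
  {b : Fin n → ℝ≥0 → Signal μ} {τ : SearchStrategy n μ}

lemma Params.postsFullInformation (hn : 2 ≤ n) (hS : MeasurableSet S)
    (hpost : mandatoryPosting μ ⊆ S) (heq : IsSymmetricEquilibrium c S σ b τ)
    (hhid : ∀ᵐ a ∂(σ : Measure (FirmAction μ)), ¬ a.Hidden) : PostsFullInformation n c σ := by
  have hb := heq.measurable_belief
  have hμ := h.mean_pos
  have hμ1 := h.mean_lt_one
  let i : Fin n := ⟨0, by omega⟩
  have hopt := h.ae_price_optimal hn hS hpost heq i
  have hfull : PostsFullSignal σ := by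
    filter_upwards [hhid, hopt] with a ha ⟨_, _, hres, _⟩
    rw [believedSignal_of_not_hidden _ ha] at hres
    rcases a with ⟨p, F | F⟩
    · exact ⟨F, rfl, h.eq_fullInformation_of_reservation hres⟩
    · simp [FirmAction.Hidden] at ha
  refine ⟨hfull, fun p hpL hpU => ?_⟩
  have hlaw : ∀ {s : Set ℝ}, MeasurableSet s →
      (σ : Measure (FirmAction μ)) {a | (a.1 : ℝ) ∈ s} = priceLaw σ s := fun hs => by
    rw [priceLaw, Measure.map_apply measurable_price hs]
    rfl
  have hwin : ∀ q, 0 < q → q ≤ priceCap μ c → winProb c b (· ≤ ·) σ i (priceCap μ c - q)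
      = ENNReal.ofReal ((1 - μ * (priceLaw σ).real (Set.Iic q)) ^ (n - 1)) := by
    intro q hq hqU
    -- Without atoms, rival prices of at least `q` may be replaced by prices above `q`, whose
    -- probability is the complement of the distribution function.
    rw [← h.winProb_lt_eq_le hn hS hpost heq i (by linarith),
      h.winProb_rel measurableSet_rel_lt hb hfull, ← h.ofReal_add_mul_pow measureReal_le_one,
      ← probReal_compl_eq_one_sub measurableSet_Iic, ofReal_measureReal, Set.compl_Iic,
      ← hlaw measurableSet_Ioi]
    · congr 4
      ext a
      simp only [Set.mem_ofPred_eq, Set.mem_Ioi, sub_lt_sub_iff_left]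
    · filter_upwards [hopt] with a ⟨ha, _⟩
      linarith
  have hΦ0 : ∀ q, 0 ≤ (1 - μ * (priceLaw σ).real (Set.Iic q)) ^ (n - 1) := fun q =>
    pow_nonneg (by nlinarith [measureReal_le_one (μ := priceLaw σ) (s := Set.Iic q)]) _
  have hK0 := h.scaledProfit_nonneg (τ := τ) (σ := σ) i
  have hle : ∀ q, 0 < q → q ≤ priceCap μ c →
      (1 - μ * (priceLaw σ).real (Set.Iic q)) ^ (n - 1) ≤ scaledProfit τ σ i / q := by
    intro q hq hqU
    have h1 := h.winProb_le hS hpost heq i (t := priceCap μ c - q) (by linarith) (by linarith)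
    rw [hwin q hq hqU, sub_sub_cancel, ENNReal.ofReal_le_ofReal_iff (by positivity)] at h1
    exact h1
  have hae : ∀ᵐ q ∂(priceLaw σ), 0 < q ∧ q < priceCap μ c ∧
      (1 - μ * (priceLaw σ).real (Set.Iic q)) ^ (n - 1) = scaledProfit τ σ i / q := by
    rw [priceLaw, ae_map_iff measurable_price.aemeasurable, ← priceLaw]
    · filter_upwards [hopt] with a ⟨h1, h2, _, h3⟩
      refine ⟨h1, h2, ?_⟩
      rw [hwin _ h1 h2.le, ENNReal.ofReal_eq_ofReal_iff (hΦ0 _) (by positivity)] at h3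
      exact h3
    · refine (measurableSet_lt measurable_const measurable_id).inter
        ((measurableSet_lt measurable_id measurable_const).inter (measurableSet_eq_fun ?_ ?_))
      · have hmono : Monotone fun q => (priceLaw σ).real (Set.Iic q) := fun x y hxy =>
          measureReal_mono (Set.Iic_subset_Iic.2 hxy)
        exact (measurable_const.sub (measurable_const.mul hmono.measurable)).pow_const _
      · exact measurable_const.div measurable_id
  rw [← h.cdf_eq_priceCDF hn (priceLaw σ) hle hae hpL hpU, ofReal_measureReal,
    ← hlaw measurableSet_Iic]
  rfl

/-- `priceCDF` is `0` and `1` at the end points, so monotonicity fixes the distribution function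
outside the interval too. The action is a function of the price, since the full-information signal
is a single element. -/
lemma Params.eq_of_postsFullInformation (hn : 2 ≤ n) {σ' : ProbabilityMeasure (FirmAction μ)}
    (hσ : PostsFullInformation n c σ) (hσ' : PostsFullInformation n c σ') : σ = σ' := by
  have hμ := h.mean_pos
  have hL := h.lowPrice_pos (n := n)
  have hLU : (1 - μ) ^ (n - 1) * priceCap μ c ≤ priceCap μ c :=
    mul_le_of_le_one_left h.priceCap_pos.le
      (pow_le_one₀ (by linarith [h.mean_lt_one]) (by linarith))
  have hlow : priceCDF n μ c ((1 - μ) ^ (n - 1) * priceCap μ c) ≤ 0 := by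
    have h1 := h.one_sub_mul_priceCDF_pow hn hL
    rw [div_self hL.ne'] at h1
    have h2 := (one_le_pow_iff_of_nonneg (h.one_sub_mul_priceCDF_pos hL).le (by omega)).1 h1.ge
    nlinarith
  have hhigh : 1 ≤ priceCDF n μ c (priceCap μ c) := by
    have h1 := h.one_sub_mul_priceCDF_pow hn h.priceCap_pos
    rw [mul_div_assoc, div_self h.priceCap_pos.ne', mul_one] at h1
    have h2 := (pow_left_inj₀ (h.one_sub_mul_priceCDF_pos h.priceCap_pos).le
      (by linarith [h.mean_lt_one]) (by omega)).1 h1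
    nlinarith
  have hcdf : ∀ {σ : ProbabilityMeasure (FirmAction μ)}, PostsFullInformation n c σ → ∀ p : ℝ≥0,
      (σ : Measure (FirmAction μ)) {a | a.1 ≤ p}
        = if (p : ℝ) < (1 - μ) ^ (n - 1) * priceCap μ c then 0
          else if (p : ℝ) ≤ priceCap μ c then ENNReal.ofReal (priceCDF n μ c p) else 1 := by
    intro σ hσ p
    split_ifs with h1 h2
    · have h3 := hσ.2 ⟨_, hL.le⟩ le_rfl hLU
      refine measure_mono_null (fun a ha => ?_)
        (h3.trans (ENNReal.ofReal_eq_zero.2 hlow))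
      exact le_trans (show a.1 ≤ p from ha) (NNReal.coe_le_coe.1 h1.le)
    · exact hσ.2 p (not_lt.1 h1) h2
    · have h3 := hσ.2 ⟨_, h.priceCap_pos.le⟩ hLU le_rfl
      refine le_antisymm prob_le_one ?_
      refine (ENNReal.one_le_ofReal.2 hhigh).trans (h3.symm.le.trans (measure_mono fun a ha => ?_))
      exact le_trans (show a.1 ≤ _ from ha) (NNReal.coe_le_coe.1 (not_le.1 h2).le)
  have hfst : (σ : Measure (FirmAction μ)).map Prod.fst
      = (σ' : Measure (FirmAction μ)).map Prod.fst := by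
    have : IsProbabilityMeasure ((σ : Measure (FirmAction μ)).map Prod.fst) :=
      Measure.isProbabilityMeasure_map measurable_fst.aemeasurable
    refine Measure.ext_of_Iic _ _ fun p => ?_
    rw [Measure.map_apply measurable_fst measurableSet_Iic,
      Measure.map_apply measurable_fst measurableSet_Iic]
    exact (hcdf hσ p).trans (hcdf hσ' p).symm
  set F := fullSignal h.mean_pos h.mean_lt_one.le
  have hg : Measurable fun p : ℝ≥0 => ((p, Sum.inl F) : FirmAction μ) :=
    measurable_id.prodMk measurable_const
  have hrec : ∀ {σ : ProbabilityMeasure (FirmAction μ)}, PostsFullInformation n c σ →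
      (σ : Measure (FirmAction μ)) = ((σ : Measure (FirmAction μ)).map Prod.fst).map
        fun p : ℝ≥0 => ((p, Sum.inl F) : FirmAction μ) := by
    intro σ hσ
    rw [Measure.map_map hg measurable_fst]
    conv_lhs => rw [← Measure.map_id (μ := (σ : Measure (FirmAction μ)))]
    refine Measure.map_congr ?_
    filter_upwards [hσ.1] with a ⟨G, ha, hG⟩
    have hGF : G = F := Subtype.ext (hG.trans (fullSignal_coe _ _).symm)
    exact Prod.ext rfl (ha.trans (congrArg Sum.inl hGF))
  refine Subtype.ext ?_
  exact (hrec hσ).trans ((congrArg _ hfst).trans (hrec hσ').symm)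

omit h in
lemma measurableSet_mandatoryPosting : MeasurableSet (mandatoryPosting μ) :=
  measurableSet_hidden.compl

lemma Params.eq_equilibriumStrategy_of_optionalPosting (hn : 2 ≤ n)
    (heq : IsSymmetricEquilibrium c (optionalPosting μ) σ b τ) : σ = equilibriumStrategy n h :=
  h.eq_of_postsFullInformation hn
    (h.postsFullInformation hn MeasurableSet.univ (Set.subset_univ _) heq (h.ae_not_hidden hn heq))
    (h.equilibriumStrategy_postsFullInformation hn)

lemma Params.eq_equilibriumStrategy_of_mandatoryPosting (hn : 2 ≤ n)
    (heq : IsSymmetricEquilibrium c (mandatoryPosting μ) σ b τ) : σ = equilibriumStrategy n h :=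
  h.eq_of_postsFullInformation hn
    (h.postsFullInformation hn measurableSet_mandatoryPosting subset_rfl heq heq.feasible)
    (h.equilibriumStrategy_postsFullInformation hn)

end Uniqueness

end PostingGame

end

/-! ### The main theorem -/

theorem mainTheorem3 (n : ℕ) (hn : 2 ≤ n) (μ c : ℝ) (hμ0 : 0 < μ) (hμ1 : μ < 1)
    (hc0 : 0 < c) (hcμ : c < μ) :
    ∃ σ : ProbabilityMeasure (PostingGame.FirmAction μ),
      PostingGame.PostsFullInformation n c σ ∧
      (∃ (b : ℝ≥0 → PostingGame.Signal μ) (τ : PostingGame.SearchStrategy n μ),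
        PostingGame.IsSymmetricEquilibrium c (PostingGame.optionalPosting μ) σ (fun _ => b) τ) ∧
      (∀ (σ' : ProbabilityMeasure (PostingGame.FirmAction μ))
        (b : Fin n → ℝ≥0 → PostingGame.Signal μ) (τ : PostingGame.SearchStrategy n μ),
        PostingGame.IsSymmetricEquilibrium c (PostingGame.optionalPosting μ) σ' b τ → σ' = σ) ∧
      (∃ (b : ℝ≥0 → PostingGame.Signal μ) (τ : PostingGame.SearchStrategy n μ),
        PostingGame.IsSymmetricEquilibrium c (PostingGame.mandatoryPosting μ) σ (fun _ => b) τ) ∧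
      (∀ (σ' : ProbabilityMeasure (PostingGame.FirmAction μ))
        (b : Fin n → ℝ≥0 → PostingGame.Signal μ) (τ : PostingGame.SearchStrategy n μ),
        PostingGame.IsSymmetricEquilibrium c (PostingGame.mandatoryPosting μ) σ' b τ → σ' = σ) := by
  have h : PostingGame.Params μ c := ⟨hμ0, hμ1, hc0, hcμ⟩
  exact ⟨PostingGame.equilibriumStrategy n h, h.equilibriumStrategy_postsFullInformation hn,
    ⟨_, _, h.isSymmetricEquilibrium_optionalPosting hn⟩,
    fun _ _ _ heq => h.eq_equilibriumStrategy_of_optionalPosting hn heq,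
    ⟨_, _, h.isSymmetricEquilibrium_mandatoryPosting hn⟩,
    fun _ _ _ heq => h.eq_equilibriumStrategy_of_mandatoryPosting hn heq⟩
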